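/- **Lemma 4.4 (All-Numbers 3SUM over Quadratic Universes).** Write $[U] = \{1, \dots, U\}$. In 3SUM one is given a set $A \subseteq [U]$ and has to decide whether there are $a, b, c \in A$ with $a + b = c$. In All-Numbers 3SUM one is given a set $A \subseteq [U]$ and has to decide, for each $c \in A$, whether there are $a, b \in A$ with $a + b = c$. In both problems $n = |A| \ge 1$ denotes the size of the input set, which is given as a list of its elements in arbitrary order, and the elements $a, b$ need not be distinct. Algorithms are deterministic word-RAM programs with words of $O(\log n)$ bits. The *deterministic 3SUM hypothesis* states that for every $\epsilon > 0$ there is a constant $c$ such that no deterministic algorithm solves 3SUM over the universe $[n^c]$ in time $O(n^{2-\epsilon})$. Assume the deterministic 3SUM hypothesis. Then for every $\epsilon > 0$ there is no deterministic algorithm that solves All-Numbers 3SUM over the universe $[n^2]$ in time $O(n^{2-\epsilon})$. -/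

import Mathlib

/-!
# Deterministic word-RAM algorithms, 3SUM and All-Numbers 3SUM

The model is the usual word RAM: words of `w` bits, constantly many registers, random access
memory addressed by words, unit-cost arithmetic, logical and comparison operations on words.
Programs are structured (sequencing, branching, loops) instead of lists of instructions with jumps,
and the memory consists of constantly many banks (a program names only finitely many of them);
each of these conventions changes running times by at most a constant factor.
-/

namespace WordRAM

/-- The unit-cost binary operations on words. -/
inductive Op where
  | add | sub | mul | div | mod | and | or | xor | shl | shr | lt | eq

/-- The value of an operation: arithmetic is unsigned and modulo `2 ^ w`; comparisons return
`1` or `0`. -/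
def Op.eval {w : ℕ} : Op → BitVec w → BitVec w → BitVec w
  | .add, x, y => x + y
  | .sub, x, y => x - y
  | .mul, x, y => x * y
  | .div, x, y => x / y
  | .mod, x, y => x % y
  | .and, x, y => x &&& y
  | .or,  x, y => x ||| y
  | .xor, x, y => x ^^^ y
  | .shl, x, y => x <<< y
  | .shr, x, y => x >>> y
  | .lt,  x, y => if x < y then 1#w else 0#w
  | .eq,  x, y => if x = y then 1#w else 0#w

/-- Deterministic word-RAM programs. Registers and memory banks are named by natural numbers that
are fixed in the text of the program; a program does not depend on the word length. -/
inductive Prog where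
  /-- do nothing -/
  | skip
  /-- register `d` := the number `c` -/
  | const (d c : ℕ)
  /-- register `d` := (register `a`) `o` (register `b`) -/
  | op (o : Op) (d a b : ℕ)
  /-- register `d` := the cell of bank `m` whose address is in register `a` -/
  | load (d m a : ℕ)
  /-- the cell of bank `m` whose address is in register `a` := register `b` -/
  | store (m a b : ℕ)
  /-- first `p`, then `q` -/
  | seq (p q : Prog)
  /-- if register `a` is nonzero then `p` else `q` -/
  | ite (a : ℕ) (p q : Prog)
  /-- while register `a` is nonzero do `p` -/
  | loop (a : ℕ) (p : Prog)

/-- A state of the machine with word length `w`: the contents of the registers, and of every cell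
of every memory bank. -/
@[ext] structure State (w : ℕ) where
  reg : ℕ → BitVec w
  mem : ℕ → BitVec w → BitVec w

/-- Write the word `v` into register `d`. -/
def State.setReg {w : ℕ} (s : State w) (d : ℕ) (v : BitVec w) : State w :=
  { s with reg := Function.update s.reg d v }

/-- Write the word `v` into the cell with address `i` of bank `m`. -/
def State.setMem {w : ℕ} (s : State w) (m : ℕ) (i v : BitVec w) : State w :=
  { s with mem := Function.update s.mem m (Function.update (s.mem m) i v) }

/-- `Exec p s t s'`: started in state `s`, the program `p` halts after exactly `t` steps in
state `s'`. Every instruction and every test of a branch or loop condition is one step. -/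
inductive Exec {w : ℕ} : Prog → State w → ℕ → State w → Prop where
  | skip (s : State w) : Exec .skip s 1 s
  | const (s : State w) (d c : ℕ) : Exec (.const d c) s 1 (s.setReg d (BitVec.ofNat w c))
  | op (s : State w) (o : Op) (d a b : ℕ) :
      Exec (.op o d a b) s 1 (s.setReg d (o.eval (s.reg a) (s.reg b)))
  | load (s : State w) (d m a : ℕ) : Exec (.load d m a) s 1 (s.setReg d (s.mem m (s.reg a)))
  | store (s : State w) (m a b : ℕ) : Exec (.store m a b) s 1 (s.setMem m (s.reg a) (s.reg b))
  | seq {p q : Prog} {s s₁ s₂ : State w} {t₁ t₂ : ℕ} :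
      Exec p s t₁ s₁ → Exec q s₁ t₂ s₂ → Exec (.seq p q) s (t₁ + t₂) s₂
  | ite_true {a : ℕ} {p q : Prog} {s s₁ : State w} {t : ℕ} :
      s.reg a ≠ 0#w → Exec p s t s₁ → Exec (.ite a p q) s (t + 1) s₁
  | ite_false {a : ℕ} {p q : Prog} {s s₁ : State w} {t : ℕ} :
      s.reg a = 0#w → Exec q s t s₁ → Exec (.ite a p q) s (t + 1) s₁
  | loop_true {a : ℕ} {p : Prog} {s s₁ s₂ : State w} {t₁ t₂ : ℕ} :
      s.reg a ≠ 0#w → Exec p s t₁ s₁ → Exec (.loop a p) s₁ t₂ s₂ →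
        Exec (.loop a p) s (t₁ + t₂ + 1) s₂
  | loop_false {a : ℕ} {p : Prog} {s : State w} :
      s.reg a = 0#w → Exec (.loop a p) s 1 s

/-- The input convention: register `0` holds `n`, and the first `n` cells of bank `0` hold the
numbers `x 0, …, x (n - 1)`. Nothing is said about the other registers and cells. -/
def HoldsInput {w n : ℕ} (x : Fin n → ℕ) (s : State w) : Prop :=
  s.reg 0 = BitVec.ofNat w n ∧
    ∀ i : Fin n, s.mem 0 (BitVec.ofNat w i) = BitVec.ofNat w (x i)

end WordRAM

/-- The list `x` enumerates, in some order and without repetition, a set `A = Set.range x` of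
exactly `n` numbers in the universe `[U] = {1, …, U}`. -/
def EnumeratesSubset (n U : ℕ) (x : Fin n → ℕ) : Prop :=
  Function.Injective x ∧ Set.range x ⊆ Set.Icc 1 U

/-- A computational problem on finite sets of numbers, given by its correct final states: the
relation between the input list and the state in which the machine halts. -/
abbrev SetProblem : Type :=
  ∀ {w n : ℕ}, (Fin n → ℕ) → WordRAM.State w → Prop

open Classical in
/-- 3SUM: decide whether there are `a, b, c ∈ A` with `a + b = c`. The answer, `1` or `0`, is left
in register `0`. -/
def ThreeSum : SetProblem := fun {w _n} x s =>
  s.reg 0 =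
    if ∃ a ∈ Set.range x, ∃ b ∈ Set.range x, ∃ c ∈ Set.range x, a + b = c then 1#w else 0#w

open Classical in
/-- All-Numbers 3SUM: decide for each `c ∈ A` whether there are `a, b ∈ A` with `a + b = c`. The
answer for `c = x i`, `1` or `0`, is left in cell `i` of bank `1`. -/
def AllNumbersThreeSum : SetProblem := fun {w n} x s =>
  ∀ i : Fin n, s.mem 1 (BitVec.ofNat w i) =
    if ∃ a ∈ Set.range x, ∃ b ∈ Set.range x, a + b = x i then 1#w else 0#w

/-- The problem `P`, restricted to sets of `n ≥ 1` numbers over the universe `[U n]`, is solved by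
a deterministic word-RAM algorithm in time `O(T n)`, where the words have `O(log n)` bits: there
are a program and constants `k` and `C` such that for every word length `w ≥ k (⌊log₂ n⌋ + 1)` the
program halts on every input within `C * T n` steps with the correct output. The words that do not
belong to the input are initially arbitrary (demanding that they be zero yields the same notion, as
zero-initialized memory can be simulated with constant overhead). -/
def SolvableInTime (P : SetProblem) (U : ℕ → ℕ) (T : ℕ → ℝ) : Prop :=
  ∃ (p : WordRAM.Prog) (k : ℕ) (C : ℝ),
    ∀ n : ℕ, 1 ≤ n → ∀ x : Fin n → ℕ, EnumeratesSubset n (U n) x →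
      ∀ w : ℕ, k * (Nat.log 2 n + 1) ≤ w →
        ∀ s : WordRAM.State w, WordRAM.HoldsInput x s →
          ∃ (t : ℕ) (s' : WordRAM.State w),
            WordRAM.Exec p s t s' ∧ (t : ℝ) ≤ C * T n ∧ P x s'

/-- The deterministic 3SUM hypothesis: for any `ε > 0` there is a constant `c` such that there is
no deterministic algorithm for 3SUM over `[n ^ c]` in time `O(n ^ (2 - ε))`. -/
def DeterministicThreeSumHypothesis : Prop :=
  ∀ ε : ℝ, 0 < ε → ∃ c : ℕ,
    ¬ SolvableInTime ThreeSum (fun n => n ^ c) (fun n => (n : ℝ) ^ (2 - ε))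

/-! Suppose that All-Numbers 3SUM over `[N ^ 2]` can be solved in time `O(N ^ (2 - ε))`, and fix a
constant `K ≥ max(6, 6 / ε)`. The claim follows from a deterministic universe reduction that solves
3SUM over `[n ^ c]`, for every constant `c`, in time `O(n ^ (2 - 1 / K))`; this contradicts the
hypothesis for the exponent `1 / K`.

Let `g = ⌊n ^ (1 / K)⌋` and `r = 2 K - 3`. A number is hashed to its residues modulo `r` moduli that
are at most `g`, and these residues are the digits of its code in a base `B` of order `g` with `2 g
≤ B`. All codes are below `V = B ^ r`, which is of order `g ^ (2 K - 3)` and hence fits a universe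
quadratic in `n`. If `a + b = c`, then in every digit the residues of `a` and `b` add up to that of
`c` or exceed it by the modulus. So the codes of `a` and `b` add up to the code of `c` plus one of
`2 ^ r` carry codes (`exists_hashCode_add_eq`).

The moduli have to leave few coincidences between codes. They are chosen greedily, each minimizing
the number of coincidences. If there is no solution, then every difference `a + b - c` is nonzero
and has `O(log n)` prime divisors, so averaging over the primes up to `g` shows that the best choice
shrinks the count by a factor of about `π(g) / log n` (`primeCounting_mul_tripleCount_le`). After
`r` choices, `O(n ^ 3 / g ^ (r - 1)) = O(g ^ (K + 4))` coincidences are left (`exists_le_mul_pow`).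
A larger count therefore proves that a solution exists.

The count is evaluated exactly by a Fourier transform over `r` digits
(`sum_fourier_eq_tripleCount`), in time `O(g ^ (r + 1))` plus a term linear in `n`. Trying `g`
candidates for each of the `r` moduli thus costs `O(g ^ (r + 2)) = O(g ^ (2 K - 1))`. The transform
works modulo `Q = q ^ e`, where `q = B + 1` is a prime found by brute force and a generator modulo
`q` is lifted to a root of unity of order `B` (`IsGen.orth`). Since `Q` exceeds every possible
count, the residue determines the count.

With few coincidences, the numbers are split into `g ^ 5` groups, with one call of the All-Numbers
program per group. Its input consists of the codes of the group, the codes of all numbers, and all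
targets (code plus carry), shifted into intervals such that a target is a sum exactly if a group
member and another number hit it (`exists_add_eq_iff_hasPair`). For each positive answer the group
is searched, with the time charged to the coincidences found: in total `O(g ^ (K + 4) * n / g ^ 5) =
O(g ^ (2 K - 1))`. The calls cost `O(n ^ (5 / K) * n ^ (2 - ε))`, and `6 / K ≤ ε` makes this `O(n ^
(2 - 1 / K))` (`reduction_time_le`).

The algorithm is written as an actual program and verified with a Hoare logic that bounds running
times (`Tr`, with the rule `Tr.forLoop` and the frame property `Exec.agree`). -/

namespace WordRAM

/-! ### Frame conditions and renaming -/

/-- The program never writes to register `v`. -/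
def Prog.keepsReg : Prog → ℕ → Bool
  | .skip, _ => true
  | .const d _, v => !(Nat.beq d v)
  | .op _ d _ _, v => !(Nat.beq d v)
  | .load d _ _, v => !(Nat.beq d v)
  | .store _ _ _, _ => true
  | .seq p q, v => p.keepsReg v && q.keepsReg v
  | .ite _ p q, v => p.keepsReg v && q.keepsReg v
  | .loop _ p, v => p.keepsReg v

/-- The program never writes to bank `b`. -/
def Prog.keepsBank : Prog → ℕ → Bool
  | .skip, _ => true
  | .const _ _, _ => true
  | .op _ _ _ _, _ => true
  | .load _ _ _, _ => true
  | .store m _ _, b => !(Nat.beq m b)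
  | .seq p q, b => p.keepsBank b && q.keepsBank b
  | .ite _ p q, b => p.keepsBank b && q.keepsBank b
  | .loop _ p, b => p.keepsBank b

theorem not_natBeq {a b : ℕ} : (!(Nat.beq a b)) = true ↔ b ≠ a := by
  constructor
  · rintro h rfl
    simp [Nat.beq_refl] at h
  · intro h
    cases hab : Nat.beq a b
    · rfl
    · exact absurd (Nat.eq_of_beq_eq_true hab).symm h

theorem Exec.reg_eq {w : ℕ} {p : Prog} {s s' : State w} {t : ℕ} (h : Exec p s t s') {v : ℕ}
    (hv : p.keepsReg v = true) : s'.reg v = s.reg v := by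
  induction h with
  | skip => rfl
  | const => exact Function.update_of_ne (not_natBeq.1 hv) _ _
  | op => exact Function.update_of_ne (not_natBeq.1 hv) _ _
  | load => exact Function.update_of_ne (not_natBeq.1 hv) _ _
  | store => rfl
  | seq _ _ h1 h2 => simp_all [Prog.keepsReg]
  | ite_true _ _ h => simp_all [Prog.keepsReg]
  | ite_false _ _ h => simp_all [Prog.keepsReg]
  | loop_true _ _ _ h1 h2 => simp_all [Prog.keepsReg]
  | loop_false => rfl

theorem Exec.mem_eq {w : ℕ} {p : Prog} {s s' : State w} {t : ℕ} (h : Exec p s t s') {b : ℕ}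
    (hb : p.keepsBank b = true) : s'.mem b = s.mem b := by
  induction h with
  | skip => rfl
  | const => rfl
  | op => rfl
  | load => rfl
  | store => exact Function.update_of_ne (not_natBeq.1 hb) _ _
  | seq _ _ h1 h2 => simp_all [Prog.keepsBank]
  | ite_true _ _ h => simp_all [Prog.keepsBank]
  | ite_false _ _ h => simp_all [Prog.keepsBank]
  | loop_true _ _ _ h1 h2 => simp_all [Prog.keepsBank]
  | loop_false => rfl

/-- Rename the registers and the memory banks of a program. -/
def Prog.rename (f g : ℕ → ℕ) : Prog → Prog
  | .skip => .skip
  | .const d c => .const (f d) c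
  | .op o d a b => .op o (f d) (f a) (f b)
  | .load d m a => .load (f d) (g m) (f a)
  | .store m a b => .store (g m) (f a) (f b)
  | .seq p q => .seq (p.rename f g) (q.rename f g)
  | .ite a p q => .ite (f a) (p.rename f g) (q.rename f g)
  | .loop a p => .loop (f a) (p.rename f g)

/-- The state seen by a program whose registers and banks are renamed. -/
def State.pull {w : ℕ} (f g : ℕ → ℕ) (s : State w) : State w :=
  ⟨fun r => s.reg (f r), fun m => s.mem (g m)⟩

theorem State.pull_setReg {w : ℕ} {f : ℕ → ℕ} (g : ℕ → ℕ) (hf : f.Injective) (s : State w) (d : ℕ)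
    (v : BitVec w) : (s.setReg (f d) v).pull f g = (s.pull f g).setReg d v := by
  ext1
  · funext r
    simp [State.pull, State.setReg, Function.update, hf.eq_iff]
  · rfl

theorem State.pull_setMem {w : ℕ} (f : ℕ → ℕ) {g : ℕ → ℕ} (hg : g.Injective) (s : State w) (m : ℕ)
    (i v : BitVec w) : (s.setMem (g m) i v).pull f g = (s.pull f g).setMem m i v := by
  ext1
  · rfl
  · funext b
    by_cases h : b = m <;> simp [State.pull, State.setMem, Function.update, hg.eq_iff, h]

/-- This is what allows the hypothetical All-Numbers program to be called as a subroutine: with its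
registers and banks renamed injectively, it runs inside a larger state, step by step and in the same
time, without disturbing the caller's data. -/
theorem Exec.rename {w : ℕ} {f g : ℕ → ℕ} (hf : f.Injective) (hg : g.Injective) {p : Prog}
    {s s' : State w} {t : ℕ} (h : Exec p s t s') :
    ∀ u : State w, u.pull f g = s → ∃ u', Exec (p.rename f g) u t u' ∧ u'.pull f g = s' := by
  induction h with
  | skip s => exact fun u hu => ⟨u, .skip u, hu⟩
  | const s d c =>
    rintro u rfl
    exact ⟨_, .const u _ c, State.pull_setReg g hf ..⟩
  | op s o d a b =>
    rintro u rfl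
    exact ⟨_, .op u o _ _ _, State.pull_setReg g hf ..⟩
  | load s d m a =>
    rintro u rfl
    exact ⟨_, .load u _ _ _, State.pull_setReg g hf ..⟩
  | store s m a b =>
    rintro u rfl
    exact ⟨_, .store u _ _ _, State.pull_setMem f hg ..⟩
  | seq _ _ h1 h2 =>
    intro u hu
    obtain ⟨u1, e1, hu1⟩ := h1 u hu
    obtain ⟨u2, e2, hu2⟩ := h2 u1 hu1
    exact ⟨u2, .seq e1 e2, hu2⟩
  | ite_true ha _ h =>
    rintro u rfl
    obtain ⟨u1, e1, hu1⟩ := h u rfl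
    exact ⟨u1, .ite_true ha e1, hu1⟩
  | ite_false ha _ h =>
    rintro u rfl
    obtain ⟨u1, e1, hu1⟩ := h u rfl
    exact ⟨u1, .ite_false ha e1, hu1⟩
  | loop_true ha _ _ h1 h2 =>
    rintro u rfl
    obtain ⟨u1, e1, hu1⟩ := h1 u rfl
    obtain ⟨u2, e2, hu2⟩ := h2 u1 hu1
    exact ⟨u2, .loop_true ha e1 e2, hu2⟩
  | loop_false ha =>
    rintro u rfl
    exact ⟨u, .loop_false ha, rfl⟩

theorem Prog.keepsReg_rename {f g : ℕ → ℕ} {v : ℕ} (hv : ∀ r, f r ≠ v) (p : Prog) :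
    (p.rename f g).keepsReg v = true := by
  induction p <;> simp only [Prog.rename, Prog.keepsReg, not_natBeq, Bool.and_eq_true] <;>
    first | exact (hv _).symm | simp_all

theorem Prog.keepsBank_rename {f g : ℕ → ℕ} {b : ℕ} (hb : ∀ m, g m ≠ b) (p : Prog) :
    (p.rename f g).keepsBank b = true := by
  induction p <;> simp only [Prog.rename, Prog.keepsBank, not_natBeq, Bool.and_eq_true] <;>
    first | exact (hb _).symm | simp_all

/-! ### Named variables and arrays -/

/-- The variables of the reduction. -/
inductive Var
  | n | g | q | om | Q | ze | B | L | V | inv | S | best | bp | thr | ans | gs | cnt | val | idx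
  | a1 | a2 | a3 | a5 | i | j | k | l | x | y | z | acc | ok | onum
  deriving DecidableEq

/-- The arrays of the reduction. -/
inductive Arr
  | inp | code | off | P | T | T2 | FT | pw1 | pw2 | head | nxt | num | pos | oin | oout
  deriving DecidableEq

/-- The register that holds a variable. -/
def Var.reg (v : Var) : ℕ := 2 * v.ctorIdx

/-- The bank that holds an array. -/
def Arr.bank (a : Arr) : ℕ := a.ctorIdx

theorem Var.reg_injective : Var.reg.Injective := by
  intro a b h
  have h' : a.ctorIdx = b.ctorIdx := by unfold Var.reg at h; omega
  exact (Var.ofNat_ctorIdx a).symm.trans ((congrArg Var.ofNat h').trans (Var.ofNat_ctorIdx b))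

theorem Arr.bank_injective : Arr.bank.Injective := by
  intro a b h
  exact (Arr.ofNat_ctorIdx a).symm.trans ((congrArg Arr.ofNat h).trans (Arr.ofNat_ctorIdx b))

@[simp] theorem Var.reg_eq_reg {a b : Var} : a.reg = b.reg ↔ a = b := Var.reg_injective.eq_iff

@[simp] theorem Arr.bank_eq_bank {a b : Arr} : a.bank = b.bank ↔ a = b := Arr.bank_injective.eq_iff

/-- Variables live in even registers, so the odd ones are free as a stack for the evaluation of
expressions. -/
theorem Var.reg_ne_temp (v : Var) (t : ℕ) : v.reg ≠ 2 * t + 1 := by unfold Var.reg; omega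

/-- The values of all variables and arrays, as natural numbers. -/
@[ext] structure NSt where
  r : Var → ℕ
  m : Arr → ℕ → ℕ

/-- Assign `x` to the variable `v`. -/
def NSt.set (σ : NSt) (v : Var) (x : ℕ) : NSt := ⟨fun u => if u = v then x else σ.r u, σ.m⟩

/-- Assign `x` to the cell `i` of the array `a`. -/
def NSt.put (σ : NSt) (a : Arr) (i x : ℕ) : NSt :=
  ⟨σ.r, fun b j => if b = a ∧ j = i then x else σ.m b j⟩

@[simp] theorem NSt.set_r_same (σ : NSt) (v : Var) (x : ℕ) : (σ.set v x).r v = x := by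
  simp [NSt.set]

@[simp] theorem NSt.set_r_of_ne (σ : NSt) {u v : Var} (h : u ≠ v) (x : ℕ) :
    (σ.set v x).r u = σ.r u := by
  simp [NSt.set, h]

@[simp] theorem NSt.set_m (σ : NSt) (v : Var) (x : ℕ) : (σ.set v x).m = σ.m := rfl

@[simp] theorem NSt.put_r (σ : NSt) (a : Arr) (i x : ℕ) : (σ.put a i x).r = σ.r := rfl

@[simp] theorem NSt.put_m_same (σ : NSt) (a : Arr) (i x j : ℕ) :
    (σ.put a i x).m a j = if j = i then x else σ.m a j := by
  simp [NSt.put]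

@[simp] theorem NSt.put_m_of_ne (σ : NSt) {a b : Arr} (h : b ≠ a) (i x : ℕ) :
    (σ.put a i x).m b = σ.m b := by
  funext j
  simp [NSt.put, h]

/-- The variables and arrays of a machine state. -/
def State.view {w : ℕ} (s : State w) : NSt :=
  ⟨fun v => (s.reg v.reg).toNat,
    fun a i => if i < 2 ^ w then (s.mem a.bank (BitVec.ofNat w i)).toNat else 0⟩

/-! ### Expressions -/

/-- Arithmetic expressions over variables and arrays. -/
inductive Expr
  | var (v : Var)
  | num (c : ℕ)
  | bin (o : Op) (a b : Expr)
  | get (m : Arr) (i : Expr)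

instance : Coe Var Expr := ⟨.var⟩
instance (c : ℕ) : OfNat Expr c := ⟨.num c⟩
instance : Add Expr := ⟨.bin .add⟩
instance : Sub Expr := ⟨.bin .sub⟩
instance : Mul Expr := ⟨.bin .mul⟩
instance : Div Expr := ⟨.bin .div⟩
instance : Mod Expr := ⟨.bin .mod⟩

/-- The expression that is `1` or `0` according to whether `a < b`. -/
def Expr.lt (a b : Expr) : Expr := .bin .lt a b

/-- The expression that is `1` or `0` according to whether `a = b`. -/
def Expr.eq (a b : Expr) : Expr := .bin .eq a b

/-- The operations on natural numbers (bitwise operations are not used). -/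
def Op.natEval : Op → ℕ → ℕ → ℕ
  | .add, x, y => x + y
  | .sub, x, y => x - y
  | .mul, x, y => x * y
  | .div, x, y => x / y
  | .mod, x, y => x % y
  | .lt, x, y => if x < y then 1 else 0
  | .eq, x, y => if x = y then 1 else 0
  | _, _, _ => 0

/-- The operation neither overflows nor underflows. -/
def Op.safe (W : ℕ) : Op → ℕ → ℕ → Prop
  | .add, x, y => x + y < W
  | .sub, x, y => y ≤ x
  | .mul, x, y => x * y < W
  | .div, _, _ => True
  | .mod, _, _ => True
  | .lt, _, _ => True
  | .eq, _, _ => True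
  | _, _, _ => False

/-- The value of an expression. -/
def Expr.eval (σ : NSt) : Expr → ℕ
  | .var v => σ.r v
  | .num c => c
  | .bin o a b => o.natEval (a.eval σ) (b.eval σ)
  | .get m i => σ.m m (i.eval σ)

/-- No overflow or underflow occurs in the evaluation of an expression. -/
def Expr.Ok (W : ℕ) (σ : NSt) : Expr → Prop
  | .var _ => True
  | .num c => c < W
  | .bin o a b => a.Ok W σ ∧ b.Ok W σ ∧ o.safe W (a.eval σ) (b.eval σ)
  | .get _ i => i.Ok W σ

/-- The number of steps needed to evaluate an expression. -/
def Expr.cost : Expr → ℕ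
  | .var _ => 1
  | .num _ => 1
  | .bin _ a b => a.cost + b.cost + 1
  | .get _ i => i.cost + 1

section simp_lemmas
variable (W : ℕ) (σ : NSt) (a b : Expr) (v : Var) (c : ℕ) (m : Arr)

@[simp] theorem Expr.eval_var : (Expr.var v).eval σ = σ.r v := rfl
@[simp] theorem Expr.eval_num : (Expr.num c).eval σ = c := rfl
@[simp] theorem Expr.eval_ofNat : (ofNat(c) : Expr).eval σ = OfNat.ofNat c := rfl
@[simp] theorem Expr.eval_add : (a + b).eval σ = a.eval σ + b.eval σ := rfl
@[simp] theorem Expr.eval_sub : (a - b).eval σ = a.eval σ - b.eval σ := rfl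
@[simp] theorem Expr.eval_mul : (a * b).eval σ = a.eval σ * b.eval σ := rfl
@[simp] theorem Expr.eval_div : (a / b).eval σ = a.eval σ / b.eval σ := rfl
@[simp] theorem Expr.eval_mod : (a % b).eval σ = a.eval σ % b.eval σ := rfl
@[simp] theorem Expr.eval_lt : (a.lt b).eval σ = if a.eval σ < b.eval σ then 1 else 0 := rfl
@[simp] theorem Expr.eval_eq : (a.eq b).eval σ = if a.eval σ = b.eval σ then 1 else 0 := rfl
@[simp] theorem Expr.eval_get : (Expr.get m a).eval σ = σ.m m (a.eval σ) := rfl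

@[simp] theorem Expr.ok_var : (Expr.var v).Ok W σ := trivial
@[simp] theorem Expr.ok_num : (Expr.num c).Ok W σ ↔ c < W := Iff.rfl
@[simp] theorem Expr.ok_ofNat : (ofNat(c) : Expr).Ok W σ ↔ OfNat.ofNat c < W := Iff.rfl
@[simp] theorem Expr.ok_add :
    (a + b).Ok W σ ↔ a.Ok W σ ∧ b.Ok W σ ∧ a.eval σ + b.eval σ < W := Iff.rfl
@[simp] theorem Expr.ok_sub :
    (a - b).Ok W σ ↔ a.Ok W σ ∧ b.Ok W σ ∧ b.eval σ ≤ a.eval σ := Iff.rfl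
@[simp] theorem Expr.ok_mul :
    (a * b).Ok W σ ↔ a.Ok W σ ∧ b.Ok W σ ∧ a.eval σ * b.eval σ < W := Iff.rfl
@[simp] theorem Expr.ok_div : (a / b).Ok W σ ↔ a.Ok W σ ∧ b.Ok W σ :=
  ⟨fun h => ⟨h.1, h.2.1⟩, fun h => ⟨h.1, h.2, trivial⟩⟩
@[simp] theorem Expr.ok_mod : (a % b).Ok W σ ↔ a.Ok W σ ∧ b.Ok W σ :=
  ⟨fun h => ⟨h.1, h.2.1⟩, fun h => ⟨h.1, h.2, trivial⟩⟩
@[simp] theorem Expr.ok_lt : (a.lt b).Ok W σ ↔ a.Ok W σ ∧ b.Ok W σ :=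
  ⟨fun h => ⟨h.1, h.2.1⟩, fun h => ⟨h.1, h.2, trivial⟩⟩
@[simp] theorem Expr.ok_eq : (a.eq b).Ok W σ ↔ a.Ok W σ ∧ b.Ok W σ :=
  ⟨fun h => ⟨h.1, h.2.1⟩, fun h => ⟨h.1, h.2, trivial⟩⟩
@[simp] theorem Expr.ok_get : (Expr.get m a).Ok W σ ↔ a.Ok W σ := Iff.rfl

@[simp] theorem Expr.cost_var : (Expr.var v).cost = 1 := rfl
@[simp] theorem Expr.cost_num : (Expr.num c).cost = 1 := rfl
@[simp] theorem Expr.cost_ofNat : (ofNat(c) : Expr).cost = 1 := rfl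
@[simp] theorem Expr.cost_add : (a + b).cost = a.cost + b.cost + 1 := rfl
@[simp] theorem Expr.cost_sub : (a - b).cost = a.cost + b.cost + 1 := rfl
@[simp] theorem Expr.cost_mul : (a * b).cost = a.cost + b.cost + 1 := rfl
@[simp] theorem Expr.cost_div : (a / b).cost = a.cost + b.cost + 1 := rfl
@[simp] theorem Expr.cost_mod : (a % b).cost = a.cost + b.cost + 1 := rfl
@[simp] theorem Expr.cost_lt : (a.lt b).cost = a.cost + b.cost + 1 := rfl
@[simp] theorem Expr.cost_eq : (a.eq b).cost = a.cost + b.cost + 1 := rfl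
@[simp] theorem Expr.cost_get : (Expr.get m a).cost = a.cost + 1 := rfl

end simp_lemmas

/-- Evaluate an expression into temporary register number `t`. -/
def Expr.compile : Expr → ℕ → Prog
  | .var v, t => .op .or (2 * t + 1) v.reg v.reg
  | .num c, t => .const (2 * t + 1) c
  | .bin o a b, t =>
      .seq (.seq (a.compile t) (b.compile (t + 1))) (.op o (2 * t + 1) (2 * t + 1) (2 * (t + 1) +
          1))
  | .get m i, t => .seq (i.compile t) (.load (2 * t + 1) m.bank (2 * t + 1))

theorem State.view_setReg_temp {w : ℕ} (s : State w) (t : ℕ) (v : BitVec w) :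
    (s.setReg (2 * t + 1) v).view = s.view := by
  ext1
  · funext u
    simp [State.view, State.setReg, Function.update, Var.reg_ne_temp]
  · rfl

theorem State.view_setReg_var {w : ℕ} (s : State w) (v : Var) (x : BitVec w) :
    (s.setReg v.reg x).view = s.view.set v x.toNat := by
  ext1
  · funext u
    by_cases h : u = v <;> simp [State.view, State.setReg, Function.update, NSt.set, h]
  · rfl

/-- The view assigns `0` to addresses from `2 ^ w` on. If addresses wrapped around instead, a write
to cell `i` would also change cell `i + 2 ^ w`, and `put` would not describe it. -/
theorem State.view_setMem {w : ℕ} (s : State w) (a : Arr) (i x : BitVec w) :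
    (s.setMem a.bank i x).view = s.view.put a i.toNat x.toNat := by
  ext1
  · rfl
  · funext b j
    by_cases h : b = a
    · subst h
      by_cases hj : j < 2 ^ w
      · have : BitVec.ofNat w j = i ↔ j = i.toNat := by
          constructor
          · rintro rfl
            simp [Nat.mod_eq_of_lt hj]
          · rintro rfl
            simp
        by_cases hji : j = i.toNat
        · subst hji
          simp [State.view, State.setMem, NSt.put, i.isLt]
        · have hne : BitVec.ofNat w j ≠ i := fun h => hji (this.1 h)
          simp [State.view, State.setMem, NSt.put, hj, Function.update, hne, hji]
      · have hji : j ≠ i.toNat := by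
          rintro rfl
          exact hj i.isLt
        simp [State.view, State.setMem, NSt.put, hj, hji]
    · simp [State.view, State.setMem, NSt.put, h]

/-- A positive word length is needed because comparisons evaluate to `1`, which has to be a word. -/
theorem Expr.eval_lt_of_ok {w : ℕ} [NeZero w] (s : State w) (e : Expr) (h : e.Ok (2 ^ w) s.view) :
    e.eval s.view < 2 ^ w := by
  have hpos : 1 < 2 ^ w := Nat.one_lt_two_pow (NeZero.ne w)
  induction e with
  | var v => exact (s.reg v.reg).isLt
  | num c => exact h
  | bin o a b iha ihb =>
    obtain ⟨ha, hb, ho⟩ := h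
    have ha' := iha ha
    have hb' := ihb hb
    cases o <;> simp only [Op.safe] at ho <;> simp only [Expr.eval, Op.natEval]
    · exact ho
    · omega
    · exact ho
    · exact (Nat.div_le_self _ _).trans_lt ha'
    · exact (Nat.mod_le _ _).trans_lt ha'
    · split <;> omega
    · split <;> omega
  | get m i ih =>
    simp only [Expr.eval, State.view]
    split
    · exact (s.mem _ _).isLt
    · omega

theorem Op.toNat_eval {w : ℕ} [NeZero w] (o : Op) (x y : BitVec w)
    (h : o.safe (2 ^ w) x.toNat y.toNat) : (o.eval x y).toNat = o.natEval x.toNat y.toNat := by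
  have hpos : 1 < 2 ^ w := Nat.one_lt_two_pow (NeZero.ne w)
  cases o <;> simp only [Op.safe] at h <;> simp only [Op.eval, Op.natEval]
  · rw [BitVec.toNat_add, Nat.mod_eq_of_lt h]
  · exact BitVec.toNat_sub_of_le h
  · rw [BitVec.toNat_mul, Nat.mod_eq_of_lt h]
  · exact BitVec.toNat_udiv
  · exact BitVec.toNat_umod
  · simp only [BitVec.lt_def]
    split <;> simp [Nat.mod_eq_of_lt hpos]
  · simp only [← BitVec.toNat_inj]
    split <;> simp [Nat.mod_eq_of_lt hpos]

/-- The last clause is the stack discipline: evaluation at height `t` leaves the temporaries below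
`t` alone, so a first operand survives the evaluation of the second one. -/
theorem Expr.exec_compile {w : ℕ} [NeZero w] (e : Expr) :
    ∀ (t : ℕ) (s : State w), e.Ok (2 ^ w) s.view → ∃ s', Exec (e.compile t) s e.cost s' ∧
      s'.view = s.view ∧ (s'.reg (2 * t + 1)).toNat = e.eval s.view ∧
      ∀ u < t, s'.reg (2 * u + 1) = s.reg (2 * u + 1) := by
  induction e with
  | var v =>
    intro t s _
    refine ⟨_, .op s _ _ _ _, State.view_setReg_temp .., ?_, fun u hu => ?_⟩
    · simp [State.setReg, Op.eval, State.view]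
    · have : u ≠ t := hu.ne
      simp [State.setReg, this]
  | num c =>
    intro t s h
    refine ⟨_, .const s _ _, State.view_setReg_temp .., ?_, fun u hu => ?_⟩
    · simp only [State.setReg, Function.update_self, Expr.eval, BitVec.toNat_ofNat]
      exact Nat.mod_eq_of_lt h
    · have : u ≠ t := hu.ne
      simp [State.setReg, this]
  | bin o a b iha ihb =>
    intro t s h
    obtain ⟨ha, hb, ho⟩ := h
    obtain ⟨s1, e1, v1, r1, k1⟩ := iha t s ha
    obtain ⟨s2, e2, v2, r2, k2⟩ := ihb (t + 1) s1 (v1 ▸ hb)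
    have r1' : (s2.reg (2 * t + 1)).toNat = a.eval s.view := by rw [k2 t (by omega), r1]
    rw [v1] at r2
    refine ⟨_, .seq (.seq e1 e2) (.op s2 _ _ _ _), ?_, ?_, fun u hu => ?_⟩
    · rw [State.view_setReg_temp, v2, v1]
    · simp only [State.setReg, Function.update_self, Expr.eval]
      rw [Op.toNat_eval _ _ _ (by rw [r1', r2]; exact ho), r1', r2]
    · have : u ≠ t := hu.ne
      simp [State.setReg, this, k2 u (by omega), k1 u hu]
  | get m i ih =>
    intro t s h
    obtain ⟨s1, e1, v1, r1, k1⟩ := ih t s h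
    refine ⟨_, .seq e1 (.load s1 _ _ _), ?_, ?_, fun u hu => ?_⟩
    · rw [State.view_setReg_temp, v1]
    · have hlt := Expr.eval_lt_of_ok s i h
      simp only [State.setReg, Function.update_self, Expr.eval]
      rw [← v1] at r1 hlt ⊢
      simp only [State.view] at hlt r1 ⊢
      rw [if_pos hlt, ← r1]
      simp
    · have : u ≠ t := hu.ne
      simp [State.setReg, this, k1 u hu]

end WordRAM

namespace WordRAM

/-! ### Structured commands -/

/-- Assign the value of an expression to a variable. -/
def asg (v : Var) (e : Expr) : Prog := .seq (e.compile 0) (.op .or v.reg 1 1)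

/-- Write the value of `e` into the cell of `a` with index `i`. -/
def sto (a : Arr) (i e : Expr) : Prog :=
  .seq (.seq (i.compile 0) (e.compile 1)) (.store a.bank 1 3)

/-- Branch on whether the value of `e` is nonzero. -/
def cond (e : Expr) (p q : Prog) : Prog := .seq (e.compile 0) (.ite 1 p q)

/-- `for v := 0, …, N - 1 do p`. -/
def forLoop (v : Var) (N : Expr) (p : Prog) : Prog :=
  .seq (.seq (asg v 0) ((Expr.lt v N).compile 0))
    (.loop 1 (.seq (.seq p (asg v (v + 1))) ((Expr.lt v N).compile 0)))

infixr:60 " ;; " => Prog.seq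

/-- The program does not write to the variable `v`. -/
def Prog.keepsVar (p : Prog) (v : Var) : Bool := p.keepsReg v.reg

/-- The program does not write to the array `a`. -/
def Prog.keepsArr (p : Prog) (a : Arr) : Bool := p.keepsBank a.bank

/-- `σ'` agrees with `σ` on everything that is not written to by `p`. -/
structure Agree (p : Prog) (σ σ' : NSt) : Prop where
  var : ∀ v, p.keepsVar v = true → σ'.r v = σ.r v
  arr : ∀ a, p.keepsArr a = true → σ'.m a = σ.m a

theorem Agree.refl (p : Prog) (σ : NSt) : Agree p σ σ := ⟨fun _ _ => rfl, fun _ _ => rfl⟩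

theorem Agree.trans {p : Prog} {σ σ' σ'' : NSt} (h : Agree p σ σ') (h' : Agree p σ' σ'') :
    Agree p σ σ'' :=
  ⟨fun v hv => (h'.var v hv).trans (h.var v hv), fun a ha => (h'.arr a ha).trans (h.arr a ha)⟩

/-- The frame rule: a syntactic check of the instructions replaces any invariant about data that a
program does not touch. -/
theorem Exec.agree {w : ℕ} {p : Prog} {s s' : State w} {t : ℕ} (h : Exec p s t s') :
    Agree p s.view s'.view where
  var v hv := by simp only [State.view]; rw [h.reg_eq hv]
  arr a ha := by simp only [State.view]; rw [h.mem_eq ha]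

theorem Expr.keepsReg_compile (e : Expr) (t : ℕ) (v : Var) :
    (e.compile t).keepsReg v.reg = true := by
  induction e generalizing t with
  | var => exact not_natBeq.2 (v.reg_ne_temp t)
  | num => exact not_natBeq.2 (v.reg_ne_temp t)
  | bin o a b iha ihb =>
    simp [Expr.compile, Prog.keepsReg, iha, ihb, not_natBeq.2 (v.reg_ne_temp t)]
  | get m i ih => simp [Expr.compile, Prog.keepsReg, ih, not_natBeq.2 (v.reg_ne_temp t)]

theorem Expr.keepsBank_compile (e : Expr) (t b : ℕ) : (e.compile t).keepsBank b = true := by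
  induction e generalizing t with
  | var => rfl
  | num => rfl
  | bin o a b iha ihb => simp [Expr.compile, Prog.keepsBank, iha, ihb]
  | get m i ih => simp [Expr.compile, Prog.keepsBank, ih]

section keeps
variable (u v : Var) (a b : Arr) (e i N : Expr) (p q : Prog)

@[simp] theorem keepsVar_asg : (asg u e).keepsVar v = true ↔ v ≠ u := by
  have : (Prog.op .or u.reg 1 1).keepsReg v.reg = true ↔ v ≠ u := by
    simp only [Prog.keepsReg, not_natBeq]
    exact Var.reg_eq_reg.not
  simp only [asg, Prog.keepsVar, Prog.keepsReg, Expr.keepsReg_compile, Bool.true_and] at this ⊢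
  exact this

@[simp] theorem keepsVar_sto : (sto a i e).keepsVar v = true := by
  simp [sto, Prog.keepsVar, Prog.keepsReg, Expr.keepsReg_compile]

@[simp] theorem keepsVar_cond :
    (cond e p q).keepsVar v = true ↔ p.keepsVar v = true ∧ q.keepsVar v = true := by
  simp [cond, Prog.keepsVar, Prog.keepsReg, Expr.keepsReg_compile]

@[simp] theorem keepsVar_seq :
    (p ;; q).keepsVar v = true ↔ p.keepsVar v = true ∧ q.keepsVar v = true := by
  simp [Prog.keepsVar, Prog.keepsReg]

@[simp] theorem keepsVar_skip : Prog.skip.keepsVar v = true := rfl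

@[simp] theorem keepsVar_forLoop :
    (forLoop u N p).keepsVar v = true ↔ v ≠ u ∧ p.keepsVar v = true := by
  have h (e : Expr) := keepsVar_asg u v e
  simp only [Prog.keepsVar] at h
  simp only [forLoop, Prog.keepsVar, Prog.keepsReg, Expr.keepsReg_compile, Bool.and_eq_true, h]
  tauto

@[simp] theorem keepsArr_asg : (asg u e).keepsArr a = true := by
  simp [asg, Prog.keepsArr, Prog.keepsBank, Expr.keepsBank_compile]

@[simp] theorem keepsArr_sto : (sto b i e).keepsArr a = true ↔ a ≠ b := by
  simp only [sto, Prog.keepsArr, Prog.keepsBank, Expr.keepsBank_compile, Bool.true_and,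
    not_natBeq]
  exact Arr.bank_eq_bank.not

@[simp] theorem keepsArr_cond :
    (cond e p q).keepsArr a = true ↔ p.keepsArr a = true ∧ q.keepsArr a = true := by
  simp [cond, Prog.keepsArr, Prog.keepsBank, Expr.keepsBank_compile]

@[simp] theorem keepsArr_seq :
    (p ;; q).keepsArr a = true ↔ p.keepsArr a = true ∧ q.keepsArr a = true := by
  simp [Prog.keepsArr, Prog.keepsBank]

@[simp] theorem keepsArr_skip : Prog.skip.keepsArr a = true := rfl

@[simp] theorem keepsArr_forLoop :
    (forLoop u N p).keepsArr a = true ↔ p.keepsArr a = true := by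
  have h (e : Expr) := keepsArr_asg u a e
  simp only [Prog.keepsArr] at h
  simp [forLoop, Prog.keepsArr, Prog.keepsBank, Expr.keepsBank_compile, h]

end keeps

/-! ### Total correctness with running times -/

/-- Started with the values `σ`, the program `p` halts within `T` steps in a state that
satisfies `Q`. -/
def Tr (w : ℕ) (p : Prog) (σ : NSt) (T : ℕ) (Q : NSt → Prop) : Prop :=
  ∀ s : State w, s.view = σ → ∃ t s', Exec p s t s' ∧ t ≤ T ∧ Q s'.view

namespace Tr
variable {w : ℕ} {p q : Prog} {σ : NSt} {T T' T₁ T₂ : ℕ} {Q R : NSt → Prop}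

theorem mono (h : Tr w p σ T Q) (hT : T ≤ T') (hQ : ∀ σ', Agree p σ σ' → Q σ' → R σ') :
    Tr w p σ T' R := by
  intro s hs
  obtain ⟨t, s', e, ht, hq⟩ := h s hs
  exact ⟨t, s', e, ht.trans hT, hQ _ (hs ▸ e.agree) hq⟩

theorem post (h : Tr w p σ T Q) (hQ : ∀ σ', Agree p σ σ' → Q σ' → R σ') : Tr w p σ T R :=
  h.mono le_rfl hQ

theorem time (h : Tr w p σ T Q) (hT : T ≤ T') : Tr w p σ T' Q := h.mono hT fun _ _ h => h

theorem skip (h : Q σ) : Tr w .skip σ 1 Q := fun s hs => ⟨1, s, .skip s, le_rfl, hs ▸ h⟩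

theorem seq (hp : Tr w p σ T₁ R) (hq : ∀ σ', Agree p σ σ' → R σ' → Tr w q σ' T₂ Q) :
    Tr w (p ;; q) σ (T₁ + T₂) Q := by
  intro s hs
  obtain ⟨t₁, s₁, e₁, ht₁, h₁⟩ := hp s hs
  obtain ⟨t₂, s₂, e₂, ht₂, h₂⟩ := hq _ (hs ▸ e₁.agree) h₁ s₁ rfl
  exact ⟨_, _, .seq e₁ e₂, by omega, h₂⟩

variable [NeZero w]

/-- There is no move instruction; the result is copied as the disjunction of the temporary register
with itself. -/
theorem asg {v : Var} {e : Expr} (he : e.Ok (2 ^ w) σ) (h : Q (σ.set v (e.eval σ))) :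
    Tr w (asg v e) σ (e.cost + 1) Q := by
  rintro s rfl
  obtain ⟨s₁, e₁, v₁, r₁, -⟩ := e.exec_compile 0 s he
  refine ⟨_, _, .seq e₁ (.op s₁ _ _ _ _), le_rfl, ?_⟩
  rw [State.view_setReg_var, v₁]
  simpa only [Op.eval, BitVec.or_self, r₁] using h

theorem sto {a : Arr} {i e : Expr} (hi : i.Ok (2 ^ w) σ) (he : e.Ok (2 ^ w) σ)
    (h : Q (σ.put a (i.eval σ) (e.eval σ))) : Tr w (sto a i e) σ (i.cost + e.cost + 1) Q := by
  rintro s rfl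
  obtain ⟨s₁, e₁, v₁, r₁, -⟩ := i.exec_compile 0 s hi
  obtain ⟨s₂, e₂, v₂, r₂, k₂⟩ := e.exec_compile 1 s₁ (v₁ ▸ he)
  refine ⟨_, _, .seq (.seq e₁ e₂) (.store s₂ _ _ _), le_rfl, ?_⟩
  have r₁' : (s₂.reg 1).toNat = i.eval s.view := by rw [k₂ 0 (by omega), r₁]
  rw [State.view_setMem, v₂, v₁, r₁', r₂, v₁]
  exact h

theorem asg_seq {v : Var} {e : Expr} (he : e.Ok (2 ^ w) σ) (h : Tr w q (σ.set v (e.eval σ)) T Q) :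
    Tr w (WordRAM.asg v e ;; q) σ (e.cost + 1 + T) Q :=
  (Tr.asg (Q := fun σ' => σ' = σ.set v (e.eval σ)) he rfl).seq fun _ _ h' => h' ▸ h

theorem sto_seq {a : Arr} {i e : Expr} (hi : i.Ok (2 ^ w) σ) (he : e.Ok (2 ^ w) σ)
    (h : Tr w q (σ.put a (i.eval σ) (e.eval σ)) T Q) :
    Tr w (WordRAM.sto a i e ;; q) σ (i.cost + e.cost + 1 + T) Q :=
  (Tr.sto (Q := fun σ' => σ' = σ.put a (i.eval σ) (e.eval σ)) hi he rfl).seq fun _ _ h' => h' ▸ h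

theorem cond {e : Expr} (he : e.Ok (2 ^ w) σ) (hp : e.eval σ ≠ 0 → Tr w p σ T Q)
    (hq : e.eval σ = 0 → Tr w q σ T Q) : Tr w (cond e p q) σ (e.cost + 1 + T) Q := by
  rintro s rfl
  obtain ⟨s₁, e₁, v₁, r₁, -⟩ := e.exec_compile 0 s he
  by_cases h : s₁.reg 1 = 0#w
  · have h0 : e.eval s.view = 0 := by rw [← r₁, h]; rfl
    obtain ⟨t, s₂, e₂, ht, h₂⟩ := hq h0 s₁ v₁
    exact ⟨_, _, .seq e₁ (.ite_false h e₂), by omega, h₂⟩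
  · have h0 : e.eval s.view ≠ 0 := by
      rw [← r₁]
      exact fun h' => h (BitVec.eq_of_toNat_eq h')
    obtain ⟨t, s₂, e₂, ht, h₂⟩ := hp h0 s₁ v₁
    exact ⟨_, _, .seq e₁ (.ite_true h e₂), by omega, h₂⟩

/-- The rule for loops, with an invariant `I` and a bound `c i` for the time spent in iteration
number `i`. -/
theorem forLoop {v : Var} {lim : Expr} {N : ℕ} {c : ℕ → ℕ} {I : ℕ → NSt → Prop}
    (hlim : ∀ σ', Agree (forLoop v lim p) σ σ' → lim.Ok (2 ^ w) σ' ∧ lim.eval σ' = N)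
    (hv : p.keepsVar v = true) (h0 : I 0 (σ.set v 0))
    (hstep : ∀ i < N, ∀ σ', Agree (WordRAM.forLoop v lim p) σ σ' → σ'.r v = i → I i σ' →
      Tr w p σ' (c i) fun σ'' => I (i + 1) (σ''.set v (i + 1))) :
    Tr w (WordRAM.forLoop v lim p) σ (∑ i ∈ Finset.range N, (c i + (lim.cost + 7)) + (lim.cost + 5))
      fun σ' => I N σ' := by
  rintro s rfl
  have hpos : 1 < 2 ^ w := Nat.one_lt_two_pow (NeZero.ne w)
  set P := WordRAM.forLoop v lim p with hP
  have agree_set : ∀ σ' (x : ℕ), Agree P s.view σ' → Agree P s.view (σ'.set v x) := by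
    intro σ' x h
    refine ⟨fun u hu => ?_, fun a ha => h.arr a ha⟩
    have huv : u ≠ v := ((keepsVar_forLoop v u lim p).1 hu).1
    rw [NSt.set_r_of_ne _ huv, h.var u hu]
  have agree_p : ∀ σ' σ'', Agree P s.view σ' → Agree p σ' σ'' → Agree P s.view σ'' := by
    intro σ' σ'' h h'
    refine h.trans ⟨fun u hu => h'.var u ?_, fun a ha => h'.arr a ?_⟩
    · exact ((keepsVar_forLoop v u lim p).1 hu).2
    · exact (keepsArr_forLoop v a lim p).1 ha
  -- The limit is the value of an expression without overflow, hence a word, so incrementing the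
  -- counter up to `N` cannot overflow.
  have hNW : N < 2 ^ w := by
    obtain ⟨h, h'⟩ := hlim s.view (Agree.refl _ _)
    exact h' ▸ Expr.eval_lt_of_ok s lim h
  have test : ∀ (s₁ : State w) (i : ℕ), Agree P s.view s₁.view → s₁.view.r v = i → ∃ s₂,
      Exec ((Expr.lt v lim).compile 0) s₁ (lim.cost + 2) s₂ ∧ s₂.view = s₁.view ∧
        (s₂.reg 1).toNat = if i < N then 1 else 0 := by
    intro s₁ i hag hi
    obtain ⟨ho, he⟩ := hlim _ hag
    obtain ⟨s₂, e₂, v₂, r₂, -⟩ := (Expr.lt v lim).exec_compile 0 s₁ (by simp [ho])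
    refine ⟨s₂, ?_, v₂, ?_⟩
    · convert e₂ using 1
      simp
      omega
    · simpa [hi, he] using r₂
  -- Induction on the number `k` of remaining iterations, from the moment when the test for index
  -- `i` has been evaluated into register `1`.
  have main : ∀ (k i : ℕ) (s₁ : State w), i + k = N → Agree P s.view s₁.view →
      s₁.view.r v = i → I i s₁.view → (s₁.reg 1).toNat = (if i < N then 1 else 0) →
      ∃ t s₂, Exec (.loop 1 (.seq (.seq p (WordRAM.asg v (v + 1))) ((Expr.lt v lim).compile 0)))
        s₁ t s₂ ∧ t ≤ ∑ j ∈ Finset.range k, (c (i + j) + (lim.cost + 7)) + 1 ∧ I N s₂.view := by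
    intro k
    induction k with
    | zero =>
      intro i s₁ hiN hag hi hI h1
      have : i = N := by omega
      subst this
      refine ⟨_, s₁, .loop_false ?_, by simp, hI⟩
      apply BitVec.eq_of_toNat_eq
      simpa using h1
    | succ k ih =>
      intro i s₁ hiN hag hi hI h1
      have hiN' : i < N := by omega
      rw [if_pos hiN'] at h1
      obtain ⟨t₂, s₂, e₂, ht₂, hI₂⟩ := hstep i hiN' _ hag hi hI s₁ rfl
      have hag₂ := agree_p _ _ hag e₂.agree
      have hv₂ : s₂.view.r v = i := by rw [e₂.agree.var v hv, hi]
      obtain ⟨t₃, s₃, e₃, ht₃, hv₃⟩ := Tr.asg (v := v) (e := v + 1)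
        (Q := fun σ' => σ' = s₂.view.set v (i + 1)) (σ := s₂.view)
        (by simp [hv₂, NeZero.ne w]; omega) (by simp [hv₂]) s₂ rfl
      have hag₃ : Agree P s.view s₃.view := hv₃ ▸ agree_set _ _ hag₂
      have hi₃ : s₃.view.r v = i + 1 := by rw [hv₃]; simp
      obtain ⟨s₄, e₄, v₄, h₄⟩ := test s₃ (i + 1) hag₃ hi₃
      obtain ⟨t₅, s₅, e₅, ht₅, hI₅⟩ := ih (i + 1) s₄ (by omega) (v₄ ▸ hag₃) (v₄ ▸ hi₃)
        (by rw [v₄, hv₃]; exact hI₂) h₄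
      refine ⟨_, s₅, .loop_true ?_ (.seq (.seq e₂ e₃) e₄) e₅, ?_, hI₅⟩
      · intro h
        rw [h] at h1
        simp at h1
      · rw [Finset.sum_range_succ']
        simp only [Expr.cost_add, Expr.cost_var, Expr.cost_ofNat] at ht₃
        have : ∀ j, i + 1 + j = i + (j + 1) := fun j => by omega
        simp only [this] at ht₅
        simp only [add_zero]
        omega
  obtain ⟨t₁, s₁, e₁, ht₁, hv₁⟩ := Tr.asg (v := v) (e := 0)
    (Q := fun σ' => σ' = s.view.set v 0) (σ := s.view) (by simp) (by simp) s rfl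
  have hag₁ : Agree P s.view s₁.view := hv₁ ▸ agree_set _ _ (Agree.refl _ _)
  have hi₁ : s₁.view.r v = 0 := by rw [hv₁]; simp
  obtain ⟨s₂, e₂, v₂, h₂⟩ := test s₁ 0 hag₁ hi₁
  obtain ⟨t₃, s₃, e₃, ht₃, hI₃⟩ := main N 0 s₂ (by omega) (v₂ ▸ hag₁) (v₂ ▸ hi₁)
    (by rw [v₂, hv₁]; exact h0) h₂
  refine ⟨_, s₃, .seq (.seq e₁ e₂) e₃, ?_, hI₃⟩
  simp only [Expr.cost_ofNat, zero_add] at ht₁ ht₃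
  omega

end Tr
end WordRAM

namespace WordRAM

theorem Tr.forLoop_const {w : ℕ} [NeZero w] {p : Prog} {σ : NSt} {v : Var} {lim : Expr} {N c : ℕ}
    {I : ℕ → NSt → Prop}
    (hlim : ∀ σ', Agree (WordRAM.forLoop v lim p) σ σ' → lim.Ok (2 ^ w) σ' ∧ lim.eval σ' = N)
    (hv : p.keepsVar v = true) (h0 : I 0 (σ.set v 0))
    (hstep : ∀ i < N, ∀ σ', Agree (WordRAM.forLoop v lim p) σ σ' → σ'.r v = i → I i σ' →
      Tr w p σ' c fun σ'' => I (i + 1) (σ''.set v (i + 1))) :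
    Tr w (WordRAM.forLoop v lim p) σ (N * (c + (lim.cost + 7)) + (lim.cost + 5))
      fun σ' => I N σ' :=
  (Tr.forLoop (c := fun _ => c) hlim hv h0 hstep).time (by simp)

/-! ### Powers -/

/-- `d := b ^ lim`. -/
def power (d b : Var) (lim : Expr) : Prog :=
  asg d 1 ;; forLoop .j lim (asg d (d * b))

/-- `d := b ^ lim mod m`. -/
def powMod (d b m : Var) (lim : Expr) : Prog :=
  asg d 1 ;; forLoop .j lim (asg d (d * b % m))

section
variable {w : ℕ} [NeZero w] {σ : NSt} {d b : Var} {lim : Expr} {K : ℕ}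

theorem tr_power (hdb : d ≠ b) (hdj : d ≠ .j) (hbj : b ≠ .j)
    (hlim : ∀ σ', Agree (power d b lim) σ σ' → lim.Ok (2 ^ w) σ' ∧ lim.eval σ' = K)
    (hpos : 0 < σ.r b) (hW : σ.r b ^ K < 2 ^ w) :
    Tr w (power d b lim) σ ((K + 1) * (lim.cost + 20)) fun σ' => σ'.r d = σ.r b ^ K := by
  have hW1 : 1 < 2 ^ w := Nat.one_lt_two_pow (NeZero.ne w)
  refine (Tr.asg_seq (by simpa using NeZero.ne w) (Tr.forLoop_const (N := K) (c := 4)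
    (I := fun i σ' => σ'.r d = σ.r b ^ i) ?_ (by simp [hdj.symm]) ?_ ?_)).time ?_
  · intro σ' h
    refine hlim σ' ⟨fun v hv => ?_, fun a ha => h.arr a ?_⟩
    · simp only [power, keepsVar_seq, keepsVar_asg] at hv
      rw [h.var v hv.2, NSt.set_r_of_ne _ hv.1]
    · simp
  · simp [hdj]
  · intro i hi σ' h _ hI
    have hb : σ'.r b = σ.r b := by
      rw [h.var b (by simp [hbj, hdb.symm]), NSt.set_r_of_ne _ hdb.symm]
    have hlt : σ.r b ^ (i + 1) < 2 ^ w := (Nat.pow_le_pow_right hpos hi).trans_lt hW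
    have := Tr.asg (w := w) (v := d) (e := d * b) (σ := σ')
      (Q := fun σ'' => (σ''.set .j (i + 1)).r d = σ.r b ^ (i + 1))
      (by simpa [hI, hb, ← pow_succ] using hlt) (by simp [hdj, hI, hb, ← pow_succ])
    exact this
  · simp only [Expr.cost_ofNat]
    ring_nf
    omega

theorem tr_powMod {m : Var} (hdb : d ≠ b) (hdj : d ≠ .j) (hbj : b ≠ .j) (hdm : d ≠ m)
    (hmj : m ≠ .j)
    (hlim : ∀ σ', Agree (powMod d b m lim) σ σ' → lim.Ok (2 ^ w) σ' ∧ lim.eval σ' = K)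
    (hm : 1 < σ.r m) (hb : σ.r b < σ.r m) (hW : σ.r m * σ.r m < 2 ^ w) :
    Tr w (powMod d b m lim) σ ((K + 1) * (lim.cost + 20))
      fun σ' => σ'.r d = σ.r b ^ K % σ.r m := by
  refine (Tr.asg_seq (by simpa using NeZero.ne w) (Tr.forLoop_const (N := K) (c := 6)
    (I := fun i σ' => σ'.r d = σ.r b ^ i % σ.r m) ?_ (by simp [hdj.symm]) ?_ ?_)).time ?_
  · intro σ' h
    refine hlim σ' ⟨fun v hv => ?_, fun a ha => h.arr a ?_⟩
    · simp only [powMod, keepsVar_seq, keepsVar_asg] at hv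
      rw [h.var v hv.2, NSt.set_r_of_ne _ hv.1]
    · simp
  · simp [hdj, Nat.mod_eq_of_lt hm]
  · intro i hi σ' h _ hI
    have hb' : σ'.r b = σ.r b := by
      rw [h.var b (by simp [hbj, hdb.symm]), NSt.set_r_of_ne _ hdb.symm]
    have hm' : σ'.r m = σ.r m := by
      rw [h.var m (by simp [hmj, hdm.symm]), NSt.set_r_of_ne _ hdm.symm]
    have hlt : σ.r b ^ i % σ.r m * σ.r b < 2 ^ w :=
      (Nat.mul_le_mul (Nat.mod_lt _ (by omega)).le hb.le).trans_lt hW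
    have := Tr.asg (w := w) (v := d) (e := d * b % m) (σ := σ')
      (Q := fun σ'' => (σ''.set .j (i + 1)).r d = σ.r b ^ (i + 1) % σ.r m)
      (by simpa [hI, hb'] using hlt) (by simp [hdj, hI, hb', hm', pow_succ])
    exact this
  · simp only [Expr.cost_ofNat]
    ring_nf
    omega
end

/-! ### Integer roots -/

/-- `g := ⌊n ^ (1 / K)⌋`. -/
def rootProg (K : ℕ) : Prog :=
  asg .g 0 ;; forLoop .i Var.n (asg .x (Var.i + 1) ;; power .y .x (.num K) ;;
    cond (.lt Var.n Var.y) .skip (asg .g Var.x))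

/-- All candidates up to `n` are tried, which takes only linear time. The invariant says that `g` is
the largest candidate so far whose power is at most `n`. The powers formed go up to `n ^ K`, and
this is what the word length must accommodate. -/
theorem tr_rootProg {w : ℕ} [NeZero w] {σ : NSt} {K : ℕ} (hK : 0 < K) (hn : 1 ≤ σ.r .n)
    (hW : σ.r .n ^ K < 2 ^ w) (hKW : K < 2 ^ w) :
    Tr w (rootProg K) σ ((σ.r .n + 1) * ((K + 1) * 21 + 30)) fun σ' =>
      1 ≤ σ'.r .g ∧ σ'.r .g ^ K ≤ σ.r .n ∧ σ.r .n < (σ'.r .g + 1) ^ K := by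
  set n := σ.r .n with hn'
  have hnW : n < 2 ^ w := (Nat.le_self_pow hK.ne' n).trans_lt hW
  refine ((Tr.asg_seq (by simp) (Tr.forLoop_const (N := n) (c := (K + 1) * 21 + 10)
    (I := fun i σ' => (σ'.r .g) ^ K ≤ n ∧ ∀ y, 1 ≤ y → y ≤ i → y ^ K ≤ n → y ≤ σ'.r .g)
    ?_ ?_ ?_ ?_)).mono ?_ ?_)
  · intro σ' h
    simp [h.var .n (by simp [power]), hn']
  · simp [power]
  · simp [hK.ne']
    omega
  · intro i hi σ' h hvi hI
    have hn1 : σ'.r .n = n := by simp [h.var .n (by simp [power]), hn']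
    have hiW : (i + 1) ^ K < 2 ^ w := (Nat.pow_le_pow_left hi K).trans_lt hW
    refine ((Tr.asg_seq (by simp [hvi, NeZero.ne w]; omega)
      ((tr_power (K := K) (by decide) (by decide) (by decide) ?_ ?_ ?_).seq
        (T₂ := 6) (fun σ1 ha h1 => ?_))).time ?_)
    · simp [hKW]
    · simp
    · simpa [hvi] using hiW
    · have hn2 : σ1.r .n = n := by simp [ha.var .n (by simp [power]), hn1]
      have hx : σ1.r .x = i + 1 := by simp [ha.var .x (by simp [power]), hvi]
      have hg : σ1.r .g = σ'.r .g := by simp [ha.var .g (by simp [power])]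
      have hy : σ1.r .y = (i + 1) ^ K := by simp [h1, hvi]
      refine (Tr.cond (T := 2) (by simp) (fun hc => (Tr.skip ?_).time (by simp))
        (fun hc => (Tr.asg (by simp) ?_).time (by simp))).time (by simp)
      · simp only [Expr.eval_lt, Expr.eval_var, hn2, hy] at hc
        simp only [ne_eq, reduceCtorEq, not_false_eq_true, NSt.set_r_of_ne, hg]
        refine ⟨hI.1, fun y h1 h2 h3 => ?_⟩
        rcases Nat.lt_or_ge y (i + 1) with h | h
        · exact hI.2 y h1 (by omega) h3
        · have : y = i + 1 := by omega
          subst this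
          exact absurd hc (by simp; omega)
      · simp only [Expr.eval_lt, Expr.eval_var, hn2, hy] at hc
        simp only [ne_eq, reduceCtorEq, not_false_eq_true, NSt.set_r_of_ne, NSt.set_r_same,
          Expr.eval_var, hx]
        refine ⟨?_, fun y _ h2 _ => h2⟩
        by_contra hlt
        simp [not_le.1 hlt] at hc
    · simp
      omega
  · simp
    ring_nf
    omega
  · rintro σ' - ⟨h1, h2⟩
    have hg : 1 ≤ σ'.r .g := h2 1 le_rfl hn (by simpa using hn)
    refine ⟨hg, h1, ?_⟩
    by_contra hlt
    have hle : (σ'.r .g + 1) ^ K ≤ n := not_lt.1 hlt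
    have := h2 (σ'.r .g + 1) (by omega) ((Nat.le_self_pow hK.ne' _).trans hle) hle
    omega

end WordRAM

/-! ### Primitive roots, and the search for a prime modulus -/

namespace WordRAM

/-- `y` has multiplicative order exactly `q - 1` modulo `q`. -/
def IsGen (q y : ℕ) : Prop :=
  (∀ k, 1 ≤ k → k ≤ q - 2 → y ^ k % q ≠ 1) ∧ y ^ (q - 1) % q = 1

/-- The unit group of a prime field is cyclic. -/
theorem exists_isGen {q : ℕ} (hq : q.Prime) : ∃ y < q, IsGen q y := by
  have := Fact.mk hq
  obtain ⟨u, hu⟩ := IsCyclic.exists_generator (α := (ZMod q)ˣ)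
  have ho : orderOf u = q - 1 := by
    rw [orderOf_eq_card_of_forall_mem_zpowers hu, Nat.card_eq_fintype_card, ZMod.card_units]
  have key (k : ℕ) : (u : ZMod q).val ^ k % q = 1 ↔ u ^ k = 1 := by
    have h1 : (1 : ℕ) = 1 % q := (Nat.mod_eq_of_lt hq.one_lt).symm
    rw [h1, Units.ext_iff, Units.val_pow_eq_pow_val, Units.val_one]
    change (u : ZMod q).val ^ k ≡ 1 [MOD q] ↔ _
    rw [← ZMod.natCast_eq_natCast_iff]
    simp
  refine ⟨(u : ZMod q).val, ZMod.val_lt _, fun k hk hk' h => ?_, ?_⟩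
  · have := orderOf_dvd_of_pow_eq_one ((key k).1 h)
    have := Nat.le_of_dvd (by omega) this
    have := hq.two_le
    omega
  · rw [key, ← ho]
    exact pow_orderOf_eq_one u

/-- An element of order `q - 1` forces `φ(q) ≥ q - 1`, which happens only for primes. A generator is
thus its own certificate of primality, and the search needs no separate primality test. -/
theorem IsGen.prime {q y : ℕ} (hq : 3 ≤ q) (h : IsGen q y) : q.Prime := by
  have : NeZero q := ⟨by omega⟩
  have key (k : ℕ) : y ^ k % q = 1 ↔ (y : ZMod q) ^ k = 1 := by
    have h1 : (1 : ℕ) = 1 % q := (Nat.mod_eq_of_lt (by omega)).symm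
    rw [h1]
    change y ^ k ≡ 1 [MOD q] ↔ _
    rw [← ZMod.natCast_eq_natCast_iff]
    simp
  have hu : (y : ZMod q) ^ (q - 1) = 1 := (key _).1 h.2
  let u : (ZMod q)ˣ := Units.ofPowEqOne _ _ hu (by omega)
  have hu' (k : ℕ) : u ^ k = 1 ↔ y ^ k % q = 1 := by
    rw [key, Units.ext_iff]
    simp [u]
  have ho : orderOf u = q - 1 := by
    have hd : orderOf u ∣ q - 1 := orderOf_dvd_of_pow_eq_one ((hu' _).2 h.2)
    have hle := Nat.le_of_dvd (by omega) hd
    by_contra hne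
    refine h.1 (orderOf u) (orderOf_pos u) (by omega) ((hu' _).1 (pow_orderOf_eq_one u))
  have hc : q - 1 ≤ q.totient := by
    rw [← ho, ← ZMod.card_units_eq_totient]
    exact orderOf_le_card_univ
  have := Nat.totient_lt q (by omega)
  exact (Nat.totient_eq_iff_prime (by omega)).1 (by omega)

open Classical in
/-- The indicator of a proposition. -/
noncomputable def ind (p : Prop) : ℕ := if p then 1 else 0

theorem ind_of {p : Prop} (h : p) : ind p = 1 := if_pos h
theorem ind_of_not {p : Prop} (h : ¬ p) : ind p = 0 := if_neg h

/-- `ok := ` whether `a2` has multiplicative order `x - 1` modulo `x`. -/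
def testGen : Prog :=
  asg .ok 1 ;; asg .z 1 ;; forLoop .k (Var.x - 2)
    (asg .z (Var.z * Var.a2 % Var.x) ;; cond (.eq Var.z 1) (asg .ok 0) .skip) ;;
  asg .z (Var.z * Var.a2 % Var.x) ;; cond (.eq Var.z 1) .skip (asg .ok 0)

theorem tr_testGen {w : ℕ} [NeZero w] {σ : NSt} (hx : 3 ≤ σ.r .x) (hy : σ.r .a2 < σ.r .x)
    (hW : σ.r .x * σ.r .x < 2 ^ w) :
    Tr w testGen σ (σ.r .x * 40) fun σ' => σ'.r .ok = ind (IsGen (σ.r .x) (σ.r .a2)) := by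
  set x := σ.r .x with hx'
  set y := σ.r .a2 with hy'
  have hxW : 2 < 2 ^ w := by nlinarith
  refine (Tr.asg_seq (by simp [NeZero.ne w]) (Tr.asg_seq (by simp [NeZero.ne w])
    -- The loop covers the exponents `1, …, x - 2`, at which the power must differ from `1`; the
    -- exponent `x - 1`, at which it must be `1`, is tested after the loop.
    ((Tr.forLoop_const (N := x - 2) (c := 14)
    (I := fun i σ' => σ'.r .z = y ^ i % x ∧
      σ'.r .ok = ind (∀ k, 1 ≤ k → k ≤ i → y ^ k % x ≠ 1)) ?_ (by simp) ?_ ?_).seq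
    (T₂ := 20) (fun σ1 ha hI => ?_)))).time ?_
  · intro σ' h
    simp [h.var .x (by simp), ← hx', hxW]
    omega
  · have : 1 < x := by omega
    simp [Nat.mod_eq_of_lt this, ind]
  · intro i hi σ' h hk hI
    have ex : σ'.r .x = x := by simp [h.var .x (by simp), ← hx']
    have ey : σ'.r .a2 = y := by simp [h.var .a2 (by simp), ← hy']
    have hlt : y ^ i % x * y < 2 ^ w :=
      (Nat.mul_le_mul (Nat.mod_lt _ (by omega)).le hy.le).trans_lt hW
    refine (Tr.asg_seq (by simpa [hI.1, ey] using hlt) (Tr.cond (T := 2)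
      (by simp [NeZero.ne w]) (fun hc => (Tr.asg (by simp) ?_).time (by simp))
      (fun hc => (Tr.skip ?_).time (by simp)))).time (by simp)
    · simp [hI.1, ex, ey, ← pow_succ] at hc ⊢
      rw [ind_of_not]
      exact fun hh => hh (i + 1) (by omega) le_rfl hc
    · simp [hI.1, ex, ey, ← pow_succ] at hc ⊢
      rw [hI.2]
      congr 1
      apply propext
      constructor
      · intro hh k h1 h2
        rcases Nat.lt_or_ge i k with h | h
        · rwa [show k = i + 1 by omega]
        · exact hh k h1 h
      · exact fun hh k h1 h2 => hh k h1 (by omega)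
  · have ex : σ1.r .x = x := by simp [ha.var .x (by simp), ← hx']
    have ey : σ1.r .a2 = y := by simp [ha.var .a2 (by simp), ← hy']
    have hlt : y ^ (x - 2) % x * y < 2 ^ w :=
      (Nat.mul_le_mul (Nat.mod_lt _ (by omega)).le hy.le).trans_lt hW
    have es : x - 2 + 1 = x - 1 := by omega
    refine (Tr.asg_seq (by simpa [hI.1, ey] using hlt) (Tr.cond (T := 2)
      (by simp [NeZero.ne w])
      (fun hc => (Tr.skip ?_).time (by simp))
      (fun hc => (Tr.asg (by simp) ?_).time (by simp)))).time (by simp)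
    · simp [hI.1, ex, ey, ← pow_succ, es] at hc ⊢
      rw [hI.2]
      congr 1
      simp [IsGen, hc]
    · simp [hI.1, ex, ey, ← pow_succ, es] at hc ⊢
      rw [ind_of_not]
      exact fun hh => hc hh.2
  · simp
    omega

/-- Find a prime `q` with `2 g + 2 ≤ q ≤ 4 g + 4` and a generator `om` modulo `q`. -/
def searchGen : Prog :=
  asg .q 0 ;; forLoop .a1 (Var.g + Var.g + 3) (asg .x (Var.g + Var.g + 2 + Var.a1) ;;
    forLoop .a2 Var.x (cond Var.q .skip
      (testGen ;; cond Var.ok (asg .q Var.x ;; asg .om Var.a2) .skip)))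

/-- The specification of the pair found by `searchGen`. -/
def GoodGen (g q y : ℕ) : Prop := 2 * g + 2 ≤ q ∧ q ≤ 4 * g + 4 ∧ y < q ∧ IsGen q y

/-- By Bertrand's postulate for `2 g + 1` there is a prime in the range searched, and every prime
has a generator, so the search succeeds. Of order `g` moduli, `g` bases and `g` exponents are tried,
which gives the cubic bound. -/
theorem tr_searchGen {w : ℕ} [NeZero w] {σ : NSt} (hg : 1 ≤ σ.r .g)
    (hW : (4 * σ.r .g + 4) * (4 * σ.r .g + 4) < 2 ^ w) :
    Tr w searchGen σ (20000 * σ.r .g ^ 3) fun σ' => GoodGen (σ.r .g) (σ'.r .q) (σ'.r .om) := by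
  set g := σ.r .g with hg'
  have hxW : 4 * g + 4 < 2 ^ w := by nlinarith
  refine (Tr.asg_seq (by simp) (Tr.forLoop_const (N := g + g + 3)
    (c := (4 * g + 4) * ((4 * g + 4) * 40 + 20) + 20)
    (I := fun i σ' => (σ'.r .q = 0 ∧ ∀ c < i, ∀ y < 2 * g + 2 + c, ¬ IsGen (2 * g + 2 + c) y) ∨
      GoodGen g (σ'.r .q) (σ'.r .om)) ?_ (by simp [testGen]) (by simp) ?_)).mono ?_ ?_
  · intro σ' h
    simp [h.var .g (by simp [testGen]), ← hg']
    omega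
  · intro i hi σ' h hi' hI
    have eg : σ'.r .g = g := by simp [h.var .g (by simp [testGen]), ← hg']
    refine (Tr.asg_seq (by simp [eg, hi']; omega) (Tr.forLoop_const (N := 2 * g + 2 + i)
      (c := (4 * g + 4) * 40 + 12)
      (I := fun j σ' => (σ'.r .q = 0 ∧ (∀ c < i, ∀ y < 2 * g + 2 + c, ¬ IsGen (2 * g + 2 + c) y)
        ∧ ∀ y < j, ¬ IsGen (2 * g + 2 + i) y) ∨ GoodGen g (σ'.r .q) (σ'.r .om))
      ?_ (by simp [testGen]) (by simpa using hI) ?_)).mono ?_ ?_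
    · intro σ'' h'
      simp [h'.var .x (by simp [testGen]), eg, hi']
      omega
    · intro j hj σ2 h2 hj2 hI2
      have ex : σ2.r .x = 2 * g + 2 + i := by
        simp [h2.var .x (by simp [testGen]), eg, hi', two_mul]
      have hle : σ2.r .x ≤ 4 * g + 4 := by omega
      refine (Tr.cond (T := (4 * g + 4) * 40 + 10) (by simp)
        (fun hc => (Tr.skip ?_).time (by omega))
        (fun hc => ((tr_testGen (by omega) (by omega) ?_).seq (T₂ := 8)
          fun σ3 h3 hok => ?_).time (by omega))).time (by simp; omega)
      · simp at hc ⊢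
        exact Or.inr (hI2.resolve_left fun h => hc h.1)
      · exact (Nat.mul_le_mul hle hle).trans_lt hW
      · have eq : σ3.r .q = σ2.r .q := h3.var .q (by simp [testGen])
        have eo : σ3.r .om = σ2.r .om := h3.var .om (by simp [testGen])
        have ex3 : σ3.r .x = 2 * g + 2 + i := by rw [h3.var .x (by simp [testGen]), ex]
        have ea3 : σ3.r .a2 = j := by rw [h3.var .a2 (by simp [testGen]), hj2]
        rw [ex, hj2] at hok
        refine (Tr.cond (T := 6) (by simp)
          (fun hc' => (Tr.asg_seq (by simp) (Tr.asg (by simp) ?_)).time (by simp))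
          (fun hc' => (Tr.skip ?_).time (by simp))).time (by simp)
        · have hgen : IsGen (2 * g + 2 + i) j := by
            by_contra hne
            simp [hok, ind_of_not hne] at hc'
          right
          simp only [Expr.eval_var, ne_eq, reduceCtorEq, not_false_eq_true, NSt.set_r_of_ne,
            NSt.set_r_same, ex3, ea3]
          exact ⟨by omega, by omega, by omega, hgen⟩
        · simp at hc
          have hgen : ¬ IsGen (2 * g + 2 + i) j := by
            intro hne
            simp [hok, ind_of hne] at hc'
          rcases hI2 with hI2 | hI2
          · left
            simp only [ne_eq, reduceCtorEq, not_false_eq_true, NSt.set_r_of_ne, eq]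
            refine ⟨hI2.1, hI2.2.1, fun y hy => ?_⟩
            rcases Nat.lt_or_ge y j with h | h
            · exact hI2.2.2 y h
            · rwa [show y = j by omega]
          · exact absurd hI2.1 (by omega)
    · simp
      have : (2 * g + 2 + i) * ((4 * g + 4) * 40 + 12 + 8) ≤
        (4 * g + 4) * ((4 * g + 4) * 40 + 20) := Nat.mul_le_mul (by omega) (by omega)
      omega
    · rintro σ2 h2 (⟨h3, h4, h5⟩ | h3)
      · left
        refine ⟨by simpa using h3, fun c hc => ?_⟩
        rcases Nat.lt_or_ge c i with h | h
        · exact h4 c h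
        · rwa [show c = i by omega]
      · right
        simpa using h3
  · simp
    have h3 : g ^ 2 ≤ g ^ 3 := Nat.pow_le_pow_right hg (by omega)
    have h2 : g ≤ g ^ 3 := Nat.le_self_pow (by omega) g
    have h1 : 1 ≤ g ^ 3 := Nat.one_le_pow _ _ hg
    ring_nf
    omega
  · rintro σ' - (⟨-, h⟩ | h)
    · exfalso
      obtain ⟨p, hp, h1, h2⟩ := Nat.exists_prime_lt_and_le_two_mul (2 * g + 1) (by omega)
      obtain ⟨y, hy, hgen⟩ := exists_isGen hp
      have e : 2 * g + 2 + (p - (2 * g + 2)) = p := by omega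
      refine h (p - (2 * g + 2)) (by omega) y (by omega) (by rwa [e])
    · exact h

end WordRAM

/-! ### Digits -/

namespace WordRAM

theorem sum_range_mul_split {M : Type*} [AddCommMonoid M] (a b : ℕ) (f : ℕ → M) :
    ∑ x ∈ Finset.range (a * b), f x =
      ∑ i ∈ Finset.range a, ∑ j ∈ Finset.range b, f (i * b + j) := by
  induction a with
  | zero => simp
  | succ a ih => rw [Nat.succ_mul, Finset.sum_range_add, ih, Finset.sum_range_succ]

/-- The digit number `i` of `X` in base `B`. -/
def dig (B X i : ℕ) : ℕ := X / B ^ i % B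

theorem digitSum_lt {B : ℕ} {d : ℕ → ℕ} (r : ℕ) (hd : ∀ j < r, d j < B) :
    ∑ j ∈ Finset.range r, d j * B ^ j < B ^ r := by
  induction r with
  | zero => simp
  | succ r ih =>
    rw [Finset.sum_range_succ, pow_succ]
    have h1 := ih fun j hj => hd j (by omega)
    have h2 : (d r + 1) * B ^ r ≤ B * B ^ r := Nat.mul_le_mul_right _ (hd r (by omega))
    nlinarith

theorem dig_digitSum {B r : ℕ} {d : ℕ → ℕ} (hd : ∀ j < r, d j < B) {i : ℕ} (hi : i < r) :
    dig B (∑ j ∈ Finset.range r, d j * B ^ j) i = d i := by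
  have hB : 0 < B := (Nat.zero_le _).trans_lt (hd i hi)
  obtain ⟨m, rfl⟩ : ∃ m, r = i + 1 + m := ⟨r - (i + 1), by omega⟩
  have hlow := digitSum_lt i fun j hj => hd j (by omega)
  have e : ∑ j ∈ Finset.range (i + 1 + m), d j * B ^ j =
      ∑ j ∈ Finset.range i, d j * B ^ j +
        B ^ i * (d i + B * ∑ j ∈ Finset.range m, d (i + 1 + j) * B ^ j) := by
    rw [Finset.sum_range_add, Finset.sum_range_succ, mul_add, ← mul_assoc, Finset.mul_sum,
      add_assoc, mul_comm (d i)]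
    congr 2
    refine Finset.sum_congr rfl fun j _ => ?_
    ring
  rw [dig, e, Nat.add_mul_div_left _ _ (pow_pos hB i), Nat.div_eq_of_lt hlow, zero_add,
    Nat.add_mul_mod_self_left, Nat.mod_eq_of_lt (hd i hi)]

theorem digitSum_dig (B X r : ℕ) :
    ∑ j ∈ Finset.range r, dig B X j * B ^ j = X % B ^ r := by
  induction r with
  | zero => simp [Nat.mod_one]
  | succ r ih =>
    rw [Finset.sum_range_succ, ih, dig, pow_succ, Nat.mod_mul, mul_comm]

theorem dig_lt {B : ℕ} (hB : 0 < B) (X i : ℕ) : dig B X i < B := Nat.mod_lt _ hB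

/-- If no digit of the sum overflows, the digits of `X + Y` are the sums of the digits. -/
theorem add_eq_iff_dig {B r X Y Z : ℕ} (hX : X < B ^ r) (hY : Y < B ^ r) (hZ : Z < B ^ r)
    (hXY : ∀ i < r, dig B X i + dig B Y i < B) :
    X + Y = Z ↔ ∀ i < r, dig B X i + dig B Y i = dig B Z i := by
  have e : ∑ j ∈ Finset.range r, (dig B X j + dig B Y j) * B ^ j = X + Y := by
    simp only [add_mul, Finset.sum_add_distrib, digitSum_dig, Nat.mod_eq_of_lt, hX, hY]
  constructor
  · rintro rfl i hi
    rw [← e, dig_digitSum hXY hi]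
  · intro h
    rw [← e, ← Nat.mod_eq_of_lt hZ, ← digitSum_dig]
    exact Finset.sum_congr rfl fun i hi => by rw [h i (Finset.mem_range.1 hi)]

theorem dig_of_split_low {B t l X i : ℕ} (hi : i < t) : dig B (l * B ^ t + X) i = dig B X i := by
  obtain ⟨m, rfl⟩ : ∃ m, t = i + 1 + m := ⟨t - (i + 1), by omega⟩
  rcases Nat.eq_zero_or_pos B with rfl | hB
  · simp [dig, Nat.add_assoc]
  · have e : l * B ^ (i + 1 + m) + X = X + B ^ i * (B * (l * B ^ m)) := by ring
    rw [dig, e, Nat.add_mul_div_left _ _ (pow_pos hB i), Nat.add_mul_mod_self_left, dig]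

theorem dig_of_split_top {B t l X : ℕ} (hl : l < B) (hX : X < B ^ t) :
    dig B (l * B ^ t + X) t = l := by
  have hB : 0 < B ^ t := (Nat.zero_le _).trans_lt hX
  rw [dig, mul_comm, Nat.mul_add_div hB, Nat.div_eq_of_lt hX, add_zero, Nat.mod_eq_of_lt hl]

/-! ### Characters and the multidimensional Fourier transform -/

section Fourier
variable {R : Type*} [CommRing R]

/-- The character with frequency `J`, evaluated at `X`, over the first `t` digits. -/
def chi (ζ : R) (B t J X : ℕ) : R := ∏ i ∈ Finset.range t, ζ ^ (dig B J i * dig B X i)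

theorem chi_split {B t : ℕ} (ζ : R) {j J l X : ℕ} (hj : j < B) (hJ : J < B ^ t) (hl : l < B)
    (hX : X < B ^ t) :
    chi ζ B (t + 1) (j * B ^ t + J) (l * B ^ t + X) = chi ζ B t J X * ζ ^ (j * l) := by
  rw [chi, Finset.prod_range_succ, dig_of_split_top hj hJ, dig_of_split_top hl hX]
  congr 1
  refine Finset.prod_congr rfl fun i hi => ?_
  rw [dig_of_split_low (Finset.mem_range.1 hi), dig_of_split_low (Finset.mem_range.1 hi)]

/-- The digits of a number below `B ^ r` range independently over all values, so the sum of products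
factors. -/
theorem sum_prod_dig (B : ℕ) (f : ℕ → ℕ → R) (r : ℕ) :
    ∑ J ∈ Finset.range (B ^ r), ∏ i ∈ Finset.range r, f i (dig B J i) =
      ∏ i ∈ Finset.range r, ∑ j ∈ Finset.range B, f i j := by
  induction r with
  | zero => simp
  | succ r ih =>
    rw [pow_succ, mul_comm, sum_range_mul_split, Finset.prod_range_succ, ← ih, mul_comm,
      Finset.sum_mul]
    refine Finset.sum_congr rfl fun j hj => ?_
    rw [Finset.mul_sum]
    refine Finset.sum_congr rfl fun J hJ => ?_
    rw [Finset.prod_range_succ, dig_of_split_top (Finset.mem_range.1 hj) (Finset.mem_range.1 hJ),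
      mul_comm]
    congr 1
    exact Finset.prod_congr rfl fun i hi => by rw [dig_of_split_low (Finset.mem_range.1 hi)]

/-- `ζ` and `ζ'` are inverse to each other, and their powers satisfy the orthogonality relations
for the cyclic group of order `B`. -/
structure Orth (B : ℕ) (ζ ζ' : R) : Prop where
  mul_eq : ζ * ζ' = 1
  sum_eq : ∀ s < B, ∀ t < B, s ≠ t → ∑ j ∈ Finset.range B, ζ ^ (j * s) * ζ' ^ (j * t) = 0

/-- Characters detect the equation `X + Y = Z`: the sum factors over the digits, and each factor is
`B` or `0` according to whether that digit is right. The absence of carries turns equality of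
numbers into equality of digits. -/
theorem Orth.sum_chi {B : ℕ} {ζ ζ' : R} (h : Orth B ζ ζ') {r X Y Z : ℕ} (hX : X < B ^ r)
    (hY : Y < B ^ r) (hZ : Z < B ^ r) (hB : 0 < B) (hXY : ∀ i < r, dig B X i + dig B Y i < B) :
    ∑ J ∈ Finset.range (B ^ r), chi ζ B r J X * chi ζ B r J Y * chi ζ' B r J Z =
      if X + Y = Z then (B : R) ^ r else 0 := by
  simp only [chi, ← Finset.prod_mul_distrib, ← pow_add, ← mul_add]
  rw [sum_prod_dig B (fun i j => ζ ^ (j * (dig B X i + dig B Y i)) * ζ' ^ (j * dig B Z i)) r]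
  split_ifs with hs
  · rw [add_eq_iff_dig hX hY hZ hXY] at hs
    have : ∀ i ∈ Finset.range r, ∑ j ∈ Finset.range B,
        ζ ^ (j * (dig B X i + dig B Y i)) * ζ' ^ (j * dig B Z i) = (B : R) := by
      intro i hi
      rw [hs i (Finset.mem_range.1 hi)]
      simp [← mul_pow, h.mul_eq]
    rw [Finset.prod_congr rfl this]
    simp
  · rw [add_eq_iff_dig hX hY hZ hXY] at hs
    push Not at hs
    obtain ⟨i, hi, hne⟩ := hs
    exact Finset.prod_eq_zero (Finset.mem_range.2 hi)
      (h.sum_eq _ (hXY i hi) _ (dig_lt hB Z i) hne)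

end Fourier

/-! ### Roots of unity modulo prime powers -/

/-- In the geometric sum identity `(∑ (ζ ^ k) ^ j) * (ζ ^ k - 1) = ζ ^ (k B) - 1 = 0` the second
factor has to be cancelled. In a ring with zero divisors it does not suffice that it is nonzero,
hence the assumption on units. -/
theorem orth_of_isUnit_sub_one {R : Type*} [CommRing R] {B : ℕ} {ζ : R} (hB : 0 < B)
    (h1 : ζ ^ B = 1) (hu : ∀ k, 0 < k → k < B → IsUnit (ζ ^ k - 1)) :
    Orth B ζ (ζ ^ (B - 1)) := by
  have hinv : ζ * ζ ^ (B - 1) = 1 := by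
    rw [← pow_succ', Nat.sub_add_cancel hB, h1]
  have hsum : ∀ k, 0 < k → k < B → ∑ j ∈ Finset.range B, (ζ ^ k) ^ j = 0 := by
    intro k hk hk'
    have := geom_sum_mul (ζ ^ k) B
    rw [← pow_mul, mul_comm k, pow_mul, h1, one_pow, sub_self] at this
    exact ((hu k hk hk').mul_left_eq_zero).1 this
  refine ⟨hinv, fun s hs t ht hst => ?_⟩
  rcases Nat.lt_or_gt_of_ne hst with h | h
  -- The exponent `s - t` is negative here and is replaced by its representative modulo `B`.
  · rw [← hsum (B - (t - s)) (by omega) (by omega)]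
    refine Finset.sum_congr rfl fun j _ => ?_
    have e1 : ζ ^ (B - (t - s)) = ζ ^ s * (ζ ^ (B - 1)) ^ t := by
      have h2 : (ζ ^ (B - 1)) ^ t = ζ ^ (B - t) := by
        calc (ζ ^ (B - 1)) ^ t = (ζ ^ (B - 1)) ^ t * ζ ^ B := by rw [h1, mul_one]
          _ = (ζ ^ (B - 1)) ^ t * (ζ ^ t * ζ ^ (B - t)) := by
            rw [← pow_add, Nat.add_sub_cancel' ht.le]
          _ = (ζ * ζ ^ (B - 1)) ^ t * ζ ^ (B - t) := by ring
          _ = ζ ^ (B - t) := by rw [hinv, one_pow, one_mul]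
      rw [h2, ← pow_add]
      congr 1
      omega
    rw [e1, mul_comm j s, mul_comm j t, pow_mul, pow_mul, mul_pow]
  · rw [← hsum (s - t) (by omega) (by omega)]
    refine Finset.sum_congr rfl fun j _ => ?_
    have e1 : s = t + (s - t) := by omega
    have e2 : ζ ^ (j * s) = ζ ^ (j * t) * (ζ ^ (s - t)) ^ j := by
      rw [← pow_mul, ← pow_add, mul_comm (s - t), ← mul_add, ← e1]
    rw [e2, mul_right_comm, ← mul_pow, hinv, one_pow, one_mul]

/-- The ring is local with residue field `ZMod q`. -/
theorem isUnit_of_castHom {q e : ℕ} (hq : q.Prime) (he : 0 < e) (x : ZMod (q ^ e))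
    (hx : ZMod.castHom (dvd_pow_self q he.ne') (ZMod q) x ≠ 0) : IsUnit x := by
  have : NeZero (q ^ e) := ⟨pow_ne_zero _ hq.ne_zero⟩
  obtain ⟨n, rfl⟩ : ∃ n : ℕ, (n : ZMod (q ^ e)) = x := ⟨x.val, ZMod.natCast_zmod_val x⟩
  rw [ZMod.isUnit_iff_coprime]
  rw [map_natCast, Ne, ZMod.natCast_eq_zero_iff] at hx
  exact (Nat.Coprime.pow_left e ((Nat.Prime.coprime_iff_not_dvd hq).2 hx)).symm

/-- The Teichmüller lift. Raising `y` to the power `q ^ (e - 1)` does not change it modulo `q`, by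
Fermat, but makes `ζ ^ (q - 1)` a power with exponent `φ(q ^ e)`, hence `1` by Euler. For `0 < k < q
- 1` the element `ζ ^ k - 1` is nonzero modulo `q` because `y` is a generator, so it is a unit
modulo `q ^ e`. -/
theorem IsGen.orth {q y e : ℕ} (hq : 3 ≤ q) (h : IsGen q y) (he : 0 < e) (ζ : ZMod (q ^ e))
    (hζ : ζ = (y : ZMod (q ^ e)) ^ (q ^ (e - 1))) :
    ζ ^ (q - 1) = 1 ∧ Orth (q - 1) ζ (ζ ^ (q - 1 - 1)) := by
  have hp := h.prime hq
  have := Fact.mk hp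
  have key (k : ℕ) : y ^ k % q = 1 ↔ (y : ZMod q) ^ k = 1 := by
    have h1 : (1 : ℕ) = 1 % q := (Nat.mod_eq_of_lt (by omega)).symm
    rw [h1]
    change y ^ k ≡ 1 [MOD q] ↔ _
    rw [← ZMod.natCast_eq_natCast_iff]
    simp
  have hmap : ZMod.castHom (dvd_pow_self q he.ne') (ZMod q) ζ = (y : ZMod q) := by
    rw [hζ, map_pow, map_natCast, ZMod.pow_card_pow]
  have hy : IsUnit (y : ZMod (q ^ e)) := by
    refine isUnit_of_castHom hp he _ fun h0 => ?_
    rw [map_natCast] at h0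
    have := (key _).1 h.2
    rw [h0, zero_pow (by omega)] at this
    exact zero_ne_one this
  have h1 : ζ ^ (q - 1) = 1 := by
    rw [hζ, ← pow_mul, ← Nat.totient_prime_pow hp he]
    obtain ⟨u, hu⟩ := hy
    rw [← hu, ← Units.val_pow_eq_pow_val, ZMod.pow_totient, Units.val_one]
  refine ⟨h1, orth_of_isUnit_sub_one (by omega) h1 fun k hk hk' => ?_⟩
  refine isUnit_of_castHom hp he _ ?_
  rw [map_sub, map_pow, hmap, map_one, sub_ne_zero]
  exact fun h0 => h.1 k hk (by omega) ((key k).2 h0)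

/-- The inverse of `q - 1` modulo `q ^ e`. -/
theorem pred_mul_inv {q e : ℕ} (hq : 2 ≤ q) :
    ((q - 1 : ℕ) : ZMod (q ^ e)) * ((q ^ e - (q ^ e - 1) / (q - 1) : ℕ) : ZMod (q ^ e)) = 1 := by
  -- The quotient times `q - 1` is `q ^ e - 1`, that is, `-1` modulo `q ^ e`; so the negative of the
  -- quotient is the inverse.
  have hd : (q - 1) * ((q ^ e - 1) / (q - 1)) = q ^ e - 1 :=
    Nat.mul_div_cancel' (by simpa using Nat.sub_dvd_pow_sub_pow q 1 e)
  have hle : (q ^ e - 1) / (q - 1) ≤ q ^ e := (Nat.div_le_self _ _).trans (Nat.sub_le _ _)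
  have hpos : 1 ≤ q ^ e := Nat.one_le_pow _ _ (by omega)
  rw [Nat.cast_sub hle, mul_sub, ← Nat.cast_mul, ← Nat.cast_mul, hd, Nat.cast_mul,
    ZMod.natCast_self, mul_zero, Nat.cast_sub hpos, ZMod.natCast_self]
  simp

end WordRAM

/-! ### Parameters and root tables of the Fourier transform -/

namespace WordRAM

/-- `ze := ze ^ (q ^ (e - 1)) mod Q`. -/
def liftRoot (e : ℕ) : Prog :=
  forLoop .i (.num (e - 1)) (powMod .y .ze .Q Var.q ;; asg .ze Var.y)

/-- Tabulate the powers of `ze` modulo `Q`. -/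
def powTable (a : Arr) : Prog :=
  asg .y 1 ;; forLoop .i Var.B (sto a Var.i Var.y ;; asg .y (Var.y * Var.ze % Var.Q))

/-- Compute all parameters of the reduction. -/
def setup (K r e : ℕ) : Prog :=
  rootProg K ;; searchGen ;; power .Q .q (.num e) ;; asg .ze Var.om ;; liftRoot e ;;
  asg .B (Var.q - 1) ;; power .L .B (.num (r - 1)) ;; asg .V (Var.L * Var.B) ;;
  asg .x (Var.Q - (Var.Q - 1) / (Var.q - 1)) ;; powMod .inv .x .Q (.num r) ;;
  powTable .pw1 ;; asg .ze (.get .pw1 (Var.B - 1)) ;; powTable .pw2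

variable {w : ℕ} [NeZero w]

theorem natCast_mod_self (a Q : ℕ) : ((a % Q : ℕ) : ZMod Q) = a := by
  rw [ZMod.natCast_eq_natCast_iff]
  exact Nat.mod_modEq a Q

/-- The exponent `q ^ (e - 1)` is reached by raising to the power `q` repeatedly, so that about `e *
q` multiplications suffice. -/
theorem tr_liftRoot {σ : NSt} {e Q q z : ℕ} (hQ' : σ.r .Q = Q) (hq' : σ.r .q = q)
    (hz' : σ.r .ze = z) (hQ : 1 < Q) (hz : z < Q) (hW : Q * Q < 2 ^ w) (he : e < 2 ^ w) :
    Tr w (liftRoot e) σ (e * ((q + 1) * 21 + 20) + 10) fun σ' => σ'.r .ze < Q ∧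
      (σ'.r .ze : ZMod Q) = (z : ZMod Q) ^ (q ^ (e - 1)) := by
  refine (Tr.forLoop_const (N := e - 1) (c := (q + 1) * 21 + 2)
    (I := fun i σ' => σ'.r .ze < Q ∧ (σ'.r .ze : ZMod Q) = (z : ZMod Q) ^ (q ^ i))
    ?_ (by simp [powMod]) (by simpa [hz'] using hz) ?_).time ?_
  · intro σ' h
    simp
    omega
  · intro i hi σ' h hi' hI
    have eQ : σ'.r .Q = Q := (h.var .Q (by simp [powMod])).trans hQ'
    have eq : σ'.r .q = q := (h.var .q (by simp [powMod])).trans hq'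
    refine ((tr_powMod (K := q) (by decide) (by decide) (by decide) (by decide) (by decide)
      ?_ (by omega) (by omega) (by rw [eQ]; exact hW)).seq (T₂ := 2) fun σ1 h1 h2 =>
        (Tr.asg (by simp) ?_).time (by simp)).time (by simp)
    · intro σ1 h1
      simp [h1.var .q (by simp [powMod]), eq]
    · rw [eQ] at h2
      simp only [Expr.eval_var, ne_eq, reduceCtorEq, not_false_eq_true, NSt.set_r_of_ne,
        NSt.set_r_same, h2, natCast_mod_self]
      refine ⟨Nat.mod_lt _ (by omega), ?_⟩
      rw [Nat.cast_pow, hI.2, ← pow_mul, pow_succ]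
  · have : (e - 1) * ((q + 1) * 21 + 2 + (1 + 7)) ≤ e * ((q + 1) * 21 + 20) :=
      Nat.mul_le_mul (by omega) (by omega)
    simp only [Expr.cost_num]
    omega

theorem tr_powTable {σ : NSt} {a : Arr} {Q B : ℕ} {z : ZMod Q} (hQ' : σ.r .Q = Q)
    (hB' : σ.r .B = B) (hz' : (σ.r .ze : ZMod Q) = z) (hQ : 1 < Q) (hz : σ.r .ze < Q)
    (hW : Q * Q < 2 ^ w) :
    Tr w (powTable a) σ (B * 20 + 10) fun σ' => ∀ j < B, σ'.m a j < Q ∧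
      (σ'.m a j : ZMod Q) = z ^ j := by
  refine (Tr.asg_seq (by simp [NeZero.ne w]) (Tr.forLoop_const (N := B) (c := 10)
    (I := fun i σ' => (σ'.r .y < Q ∧ (σ'.r .y : ZMod Q) = z ^ i) ∧
      ∀ j < i, σ'.m a j < Q ∧ (σ'.m a j : ZMod Q) = z ^ j)
    ?_ (by simp) (by simpa using hQ) ?_)).mono ?_ ?_
  · intro σ' h
    simp [h.var .B (by simp), hB']
  · intro i hi σ' h hi' hI
    have eQ : σ'.r .Q = Q := by simp [h.var .Q (by simp), hQ']
    have ez : σ'.r .ze = σ.r .ze := by simp [h.var .ze (by simp)]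
    have hlt : σ'.r .y * σ.r .ze < 2 ^ w := (Nat.mul_le_mul hI.1.1.le hz.le).trans_lt hW
    refine (Tr.sto_seq (by simp) (by simp) (Tr.asg (by simpa [ez] using hlt) ?_)).time (by simp)
    simp only [Expr.eval_var, Expr.eval_mod, Expr.eval_mul, NSt.put_r, ne_eq, reduceCtorEq,
      not_false_eq_true, NSt.set_r_of_ne, NSt.set_r_same, eQ, ez, natCast_mod_self, NSt.set_m,
      NSt.put_m_same, hi']
    refine ⟨⟨Nat.mod_lt _ (by omega), ?_⟩, fun j hj => ?_⟩
    · rw [Nat.cast_mul, hI.1.2, hz', pow_succ]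
    · split_ifs with hji
      · exact hji ▸ hI.1
      · exact hI.2 j (by omega)
  · simp
    omega
  · exact fun σ' _ h => h.2

/-- The values computed by `setup`. -/
structure Params (r e : ℕ) (σ : NSt) : Prop where
  one_le_g : 1 ≤ σ.r .g
  q_ge : 2 * σ.r .g + 2 ≤ σ.r .q
  q_le : σ.r .q ≤ 4 * σ.r .g + 4
  B_eq : σ.r .B = σ.r .q - 1
  Q_eq : σ.r .Q = σ.r .q ^ e
  L_eq : σ.r .L = σ.r .B ^ (r - 1)
  V_eq : σ.r .V = σ.r .B ^ r
  inv_lt : σ.r .inv < σ.r .Q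
  inv_eq : (σ.r .inv : ZMod (σ.r .Q)) * (σ.r .B : ZMod (σ.r .Q)) ^ r = 1
  tables : ∃ ζ ζ' : ZMod (σ.r .Q), Orth (σ.r .B) ζ ζ' ∧
    (∀ j < σ.r .B, σ.m .pw1 j < σ.r .Q ∧ (σ.m .pw1 j : ZMod (σ.r .Q)) = ζ ^ j) ∧
    ∀ j < σ.r .B, σ.m .pw2 j < σ.r .Q ∧ (σ.m .pw2 j : ZMod (σ.r .Q)) = ζ' ^ j

theorem IsGen.orth' {q y e Q : ℕ} (hQ : Q = q ^ e) (hq : 3 ≤ q) (h : IsGen q y) (he : 0 < e) :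
    Orth (q - 1) ((y : ZMod Q) ^ (q ^ (e - 1)))
      (((y : ZMod Q) ^ (q ^ (e - 1))) ^ (q - 1 - 1)) := by
  subst hQ
  exact (h.orth hq he _ rfl).2

theorem pred_pow_mul_inv_pow {q e r Q : ℕ} (hQ : Q = q ^ e) (hq : 2 ≤ q) :
    (((Q - (Q - 1) / (q - 1)) ^ r % Q : ℕ) : ZMod Q) * ((q - 1 : ℕ) : ZMod Q) ^ r = 1 := by
  subst hQ
  rw [natCast_mod_self, Nat.cast_pow, ← mul_pow, mul_comm, pred_mul_inv hq, one_pow]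

/-- The bound on `(4 g + 4) ^ e` squared makes room for products of two residues modulo `Q = q ^ e`;
because of `r ≤ e`, it also covers the size `B ^ r` of the hash universe. -/
theorem tr_setup {σ : NSt} {K r e g : ℕ} (hK : 0 < K) (hr : 0 < r) (hre : r ≤ e)
    (hn : 1 ≤ σ.r .n) (hg1 : g ^ K ≤ σ.r .n) (hg2 : σ.r .n < (g + 1) ^ K)
    (hKW : K < 2 ^ w) (heW : e < 2 ^ w) (hnW : σ.r .n ^ K < 2 ^ w)
    (hW : (4 * g + 4) ^ e * (4 * g + 4) ^ e < 2 ^ w) :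
    Tr w (setup K r e) σ ((σ.r .n + 1) * ((K + 1) * 21 + 30) + 21000 * (e + 1) * g ^ 3)
      fun σ' => Params r e σ' ∧ σ'.r .g = g := by
  have he : 0 < e := by omega
  have hg0 : 1 ≤ g := by
    rcases Nat.eq_zero_or_pos g with rfl | h
    · simp at hg2; omega
    · exact h
  have h4 : 4 * g + 4 ≤ (4 * g + 4) ^ e := Nat.le_self_pow he.ne' _
  have h44 : (4 * g + 4) * (4 * g + 4) < 2 ^ w := (Nat.mul_le_mul h4 h4).trans_lt hW
  have h4W : (4 * g + 4) ^ e < 2 ^ w := by nlinarith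
  refine ((tr_rootProg hK hn hnW hKW).seq (T₂ := 20000 * g ^ 3 + ((e + 1) * 21 + (2 +
    ((e * ((4 * g + 5) * 21 + 20) + 10) + (4 + ((e + 1) * 21 + (4 + (12 + ((e + 1) * 21 +
    (((4 * g + 4) * 20 + 10) + (5 + ((4 * g + 4) * 20 + 10))))))))))))
    fun σ1 a1 h1 => ?_).time ?_
  -- The integer root is unique, so the computed one is the given `g`.
  · have e1 : σ1.r .g = g := by
      obtain ⟨-, h2, h3⟩ := h1
      have l1 := (Nat.pow_lt_pow_iff_left hK.ne').1 (h2.trans_lt hg2)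
      have l2 := (Nat.pow_lt_pow_iff_left hK.ne').1 (hg1.trans_lt h3)
      omega
    refine ((tr_searchGen (by omega) (by rw [e1]; exact h44)).time (by rw [e1])).seq
      fun σ2 a2 h2 => ?_
    rw [e1] at h2
    obtain ⟨q1, q2, y1, y2⟩ := h2
    have e2 : σ2.r .g = g := by rw [a2.var .g (by simp [searchGen, testGen]), e1]
    set q := σ2.r .q with hq
    have hqe : q ^ e ≤ (4 * g + 4) ^ e := Nat.pow_le_pow_left q2 e
    have hqe1 : q ≤ q ^ e := Nat.le_self_pow he.ne' _
    have hrr : (q - 1) ^ r ≤ (4 * g + 4) ^ e :=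
      (Nat.pow_le_pow_left (show q - 1 ≤ 4 * g + 4 by omega) r).trans
        (Nat.pow_le_pow_right (by omega) hre)
    have hrr' : (q - 1) ^ (r - 1) ≤ (q - 1) ^ r := Nat.pow_le_pow_right (by omega) (by omega)
    refine ((tr_power (K := e) (by decide) (by decide) (by decide) (by simp [heW]) (by omega)
      (by rw [← hq]; omega)).time (by simp)).seq fun σ3 a3 h3 => ?_
    rw [← hq] at h3
    have e3 : σ3.r .g = g := by rw [a3.var .g (by simp [power]), e2]
    have q3 : σ3.r .q = q := by rw [a3.var .q (by simp [power])]
    have y3 : σ3.r .om = σ2.r .om := by rw [a3.var .om (by simp [power])]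
    set Q := σ3.r .Q with hQ
    have hQ1 : 1 < Q := by omega
    have hQW : Q * Q < 2 ^ w := by
      refine (Nat.mul_le_mul ?_ ?_).trans_lt hW <;> omega
    refine (Tr.asg_seq (T := e * ((4 * g + 5) * 21 + 20) + 10 + (4 + ((e + 1) * 21 + (4 + (12 +
      ((e + 1) * 21 + (((4 * g + 4) * 20 + 10) + (5 + ((4 * g + 4) * 20 + 10)))))))))
      (by simp) ?_).time (by simp)
    refine ((tr_liftRoot (e := e) (Q := Q) (q := q) (z := σ2.r .om) (by simp [← hQ])
      (by simp [q3]) (by simp [y3]) hQ1 (by omega) hQW heW).time ?_).seq fun σ4 a4 h4 => ?_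
    · have : (q + 1) * 21 + 20 ≤ (4 * g + 5) * 21 + 20 := by omega
      exact Nat.add_le_add_right (Nat.mul_le_mul_left e this) 10
    have e4 : σ4.r .g = g := by rw [a4.var .g (by simp [liftRoot, powMod])]; simp [e3]
    have q4 : σ4.r .q = q := by rw [a4.var .q (by simp [liftRoot, powMod])]; simp [q3]
    have Q4 : σ4.r .Q = Q := by rw [a4.var .Q (by simp [liftRoot, powMod])]; simp [← hQ]
    refine (Tr.asg_seq (T := (e + 1) * 21 + (4 + (12 +
      ((e + 1) * 21 + (((4 * g + 4) * 20 + 10) + (5 + ((4 * g + 4) * 20 + 10)))))))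
      (by simp [q4, NeZero.ne w]; omega) ?_).time (by simp)
    refine ((tr_power (K := r - 1) (by decide) (by decide) (by decide)
      (by simp; omega) (by simp [q4]; omega) (by simp [q4]; omega)).time
      (Nat.mul_le_mul (by omega) (by simp))).seq fun σ5 a5 h5 => ?_
    have e5 : σ5.r .g = g := by rw [a5.var .g (by simp [power])]; simp [e4]
    have q5 : σ5.r .q = q := by rw [a5.var .q (by simp [power])]; simp [q4]
    have Q5 : σ5.r .Q = Q := by rw [a5.var .Q (by simp [power])]; simp [Q4]
    have B5 : σ5.r .B = q - 1 := by rw [a5.var .B (by simp [power])]; simp [q4]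
    have z5 : σ5.r .ze = σ4.r .ze := by rw [a5.var .ze (by simp [power])]; simp
    have L5 : σ5.r .L = (q - 1) ^ (r - 1) := by rw [h5]; simp [q4]
    have V5 : σ5.r .L * σ5.r .B = (q - 1) ^ r := by
      rw [L5, B5, ← pow_succ, Nat.sub_add_cancel hr]
    refine (Tr.asg_seq (T := 12 +
      ((e + 1) * 21 + (((4 * g + 4) * 20 + 10) + (5 + ((4 * g + 4) * 20 + 10)))))
      (by simp [V5]; omega) ?_).time (by simp)
    refine (Tr.asg_seq (T :=
      (e + 1) * 21 + (((4 * g + 4) * 20 + 10) + (5 + ((4 * g + 4) * 20 + 10))))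
      ?_ ?_).time (by simp)
    · have : (Q - 1) / (q - 1) ≤ Q - 1 := Nat.div_le_self _ _
      simp [Q5, q5, NeZero.ne w]
      omega
    have hdiv : 0 < (Q - 1) / (q - 1) := Nat.div_pos (by omega) (by omega)
    refine ((tr_powMod (K := r) (by decide) (by decide) (by decide) (by decide) (by decide)
      (by simp; omega) (by simpa [Q5] using hQ1) (by simp [Q5, q5]; omega)
      (by simpa [Q5] using hQW)).time
      (Nat.mul_le_mul (by omega) (by simp))).seq fun σ6 a6 h6 => ?_
    have e6 : σ6.r .g = g := by rw [a6.var .g (by simp [powMod])]; simp [e5]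
    have q6 : σ6.r .q = q := by rw [a6.var .q (by simp [powMod])]; simp [q5]
    have Q6 : σ6.r .Q = Q := by rw [a6.var .Q (by simp [powMod])]; simp [Q5]
    have B6 : σ6.r .B = q - 1 := by rw [a6.var .B (by simp [powMod])]; simp [B5]
    have L6 : σ6.r .L = (q - 1) ^ (r - 1) := by rw [a6.var .L (by simp [powMod])]; simp [L5]
    have V6 : σ6.r .V = (q - 1) ^ r := by rw [a6.var .V (by simp [powMod])]; simp [V5]
    have z6 : σ6.r .ze = σ4.r .ze := by rw [a6.var .ze (by simp [powMod])]; simp [z5]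
    have i6 : σ6.r .inv = (Q - (Q - 1) / (q - 1)) ^ r % Q := by rw [h6]; simp [Q5, q5]
    refine ((tr_powTable Q6 B6 ((congrArg Nat.cast z6).trans h4.2) hQ1 (by rw [z6]; exact h4.1)
      hQW).time (by omega)).seq fun σ7 a7 h7 => ?_
    have e7 : σ7.r .g = g := by rw [a7.var .g (by simp [powTable]), e6]
    have q7 : σ7.r .q = q := by rw [a7.var .q (by simp [powTable]), q6]
    have Q7 : σ7.r .Q = Q := by rw [a7.var .Q (by simp [powTable]), Q6]
    have B7 : σ7.r .B = q - 1 := by rw [a7.var .B (by simp [powTable]), B6]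
    have L7 : σ7.r .L = (q - 1) ^ (r - 1) := by rw [a7.var .L (by simp [powTable]), L6]
    have V7 : σ7.r .V = (q - 1) ^ r := by rw [a7.var .V (by simp [powTable]), V6]
    have i7 : σ7.r .inv = (Q - (Q - 1) / (q - 1)) ^ r % Q := by
      rw [a7.var .inv (by simp [powTable]), i6]
    -- The last entry of the first table is `ζ ^ (B - 1)`, the inverse of `ζ`; the second table is
    -- built from it.
    have h7l := h7 (q - 1 - 1) (by omega)
    refine (Tr.asg_seq (T := (4 * g + 4) * 20 + 10)
      (by simp [B7, NeZero.ne w]; omega) ?_).time (by simp)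
    refine (tr_powTable (Q := Q) (B := q - 1) (by simp [Q7]) (by simp [B7])
      (by simpa [B7] using h7l.2) hQ1 (by simp [B7, h7l.1]) hQW).mono (by omega) fun σ8 a8 h8 => ?_
    have e8 : σ8.r .g = g := by rw [a8.var .g (by simp [powTable])]; simp [e7]
    have q8 : σ8.r .q = q := by rw [a8.var .q (by simp [powTable])]; simp [q7]
    have Q8 : σ8.r .Q = Q := by rw [a8.var .Q (by simp [powTable])]; simp [Q7]
    have B8 : σ8.r .B = q - 1 := by rw [a8.var .B (by simp [powTable])]; simp [B7]
    have L8 : σ8.r .L = (q - 1) ^ (r - 1) := by rw [a8.var .L (by simp [powTable])]; simp [L7]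
    have V8 : σ8.r .V = (q - 1) ^ r := by rw [a8.var .V (by simp [powTable])]; simp [V7]
    have i8 : σ8.r .inv = (Q - (Q - 1) / (q - 1)) ^ r % Q := by
      rw [a8.var .inv (by simp [powTable])]; simp [i7]
    have t8 : σ8.m .pw1 = σ7.m .pw1 := by rw [a8.arr .pw1 (by simp [powTable])]; simp
    refine ⟨⟨?_, ?_, ?_, ?_, ?_, ?_, ?_, ?_, ?_, ?_⟩, e8⟩
    · omega
    · omega
    · omega
    · omega
    · rw [Q8, q8, h3]
    · rw [L8, B8]
    · rw [V8, B8]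
    · rw [i8, Q8]
      exact Nat.mod_lt _ (by omega)
    · rw [i8, Q8, B8]
      exact pred_pow_mul_inv_pow h3 (by omega)
    · rw [Q8, B8, t8]
      exact ⟨_, _, IsGen.orth' h3 (by omega) y2 he, h7, h8⟩
  · have h1 : 1 ≤ g ^ 3 := Nat.one_le_pow _ _ hg0
    have h2 : g ≤ g ^ 3 := Nat.le_self_pow (by omega) g
    have h3 : g * e ≤ g ^ 3 * e := Nat.mul_le_mul_right _ h2
    have h4 : e ≤ g ^ 3 * e := Nat.le_mul_of_pos_left _ h1
    ring_nf
    ring_nf at h3 h4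
    omega

end WordRAM

namespace WordRAM

/-! ### Hash codes -/

/-- The vector of the residues of `a` modulo `P 0, …, P (r - 1)`, as a number in base `B`. -/
def hashCode (B r : ℕ) (P : ℕ → ℕ) (a : ℕ) : ℕ := ∑ j ∈ Finset.range r, a % P j * B ^ j

/-- The subset sums of the moduli, digit by digit: the digit `j` is `P j` or `0` according to
whether `j` is a binary digit of `s`. -/
def carryCode (B r : ℕ) (P : ℕ → ℕ) (s : ℕ) : ℕ :=
  ∑ j ∈ Finset.range r, s / 2 ^ j % 2 * P j * B ^ j

/-- The moduli are positive, and sums of two residues fit into a digit in base `B`. -/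
def Moduli (B r : ℕ) (P : ℕ → ℕ) : Prop := ∀ j < r, 0 < P j ∧ 2 * P j ≤ B

theorem Moduli.digit_lt {B r : ℕ} {P : ℕ → ℕ} (h : Moduli B r P) (a s : ℕ) :
    ∀ j < r, a % P j + s / 2 ^ j % 2 * P j < B := by
  intro j hj
  obtain ⟨h1, h2⟩ := h j hj
  have h3 := Nat.mod_lt a h1
  have h4 : s / 2 ^ j % 2 * P j ≤ 1 * P j := Nat.mul_le_mul_right _ (by omega)
  omega

theorem hashCode_add_carryCode (B r : ℕ) (P : ℕ → ℕ) (a s : ℕ) :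
    hashCode B r P a + carryCode B r P s =
      ∑ j ∈ Finset.range r, (a % P j + s / 2 ^ j % 2 * P j) * B ^ j := by
  simp only [hashCode, carryCode, ← Finset.sum_add_distrib, add_mul]

theorem Moduli.hashCode_add_lt {B r : ℕ} {P : ℕ → ℕ} (h : Moduli B r P) (a s : ℕ) :
    hashCode B r P a + carryCode B r P s < B ^ r := by
  rw [hashCode_add_carryCode]
  exact digitSum_lt r (h.digit_lt a s)

theorem Moduli.hashCode_lt {B r : ℕ} {P : ℕ → ℕ} (h : Moduli B r P) (a : ℕ) :
    hashCode B r P a < B ^ r := by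
  have := h.hashCode_add_lt a 0
  omega

/-- `code[i] := ` the hash code of `inp[i]`. -/
def hashAll (r : ℕ) : Prog :=
  forLoop .i Var.n (asg .x 0 ;; asg .y 1 ;; forLoop .j (.num r)
    (asg .x (Var.x + .get .inp Var.i % .get .P Var.j * Var.y) ;; asg .y (Var.y * Var.B)) ;;
    sto .code Var.i Var.x)

/-- `off[s] := ` the carry code of `s`. -/
def carryAll (r : ℕ) : Prog :=
  forLoop .i (.num (2 ^ r)) (asg .x 0 ;; asg .y 1 ;; asg .z Var.i ;; forLoop .j (.num r)
    (asg .x (Var.x + Var.z % 2 * .get .P Var.j * Var.y) ;; asg .y (Var.y * Var.B) ;;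
      asg .z (Var.z / 2)) ;;
    sto .off Var.i Var.x)

variable {w : ℕ} [NeZero w]

theorem tr_hashAll {σ : NSt} {n r B : ℕ} {P A : ℕ → ℕ} (hn : σ.r .n = n) (hB : σ.r .B = B)
    (hA : ∀ i < n, σ.m .inp i = A i) (hP : ∀ j < r, σ.m .P j = P j) (hM : Moduli B r P)
    (hBr : 0 < B) (hW : B ^ r < 2 ^ w) (hr : r < 2 ^ w) :
    Tr w (hashAll r) σ (n * (r * 30 + 40) + 10) fun σ' =>
      ∀ i < n, σ'.m .code i = hashCode B r P (A i) := by
  refine (Tr.forLoop_const (N := n) (c := r * 30 + 20)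
    (I := fun i σ' => ∀ k < i, σ'.m .code k = hashCode B r P (A k)) ?_ (by simp) (by simp)
    ?_).time ?_
  · intro σ' h
    simp [h.var .n (by simp), hn]
  · intro i hi σ' h hi' hI
    have eB : σ'.r .B = B := (h.var .B (by simp)).trans hB
    have eA : σ'.m .inp i = A i := by rw [h.arr .inp (by simp), hA i hi]
    have eP : ∀ j < r, σ'.m .P j = P j := fun j hj => by rw [h.arr .P (by simp), hP j hj]
    refine (Tr.asg_seq (by simp) (Tr.asg_seq (by simp [NeZero.ne w])
      ((Tr.forLoop_const (N := r) (c := 15)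
      (I := fun j σ' => σ'.r .x = ∑ l ∈ Finset.range j, A i % P l * B ^ l ∧ σ'.r .y = B ^ j)
      ?_ (by simp) (by simp) ?_).seq (T₂ := 3) fun σ1 h1 hI1 => ?_))).time ?_
    · intro σ1 h1
      simp [hr]
    · intro j hj σ1 h1 hj' hI1
      have eB1 : σ1.r .B = B := by rw [h1.var .B (by simp)]; simp [eB]
      have ei1 : σ1.r .i = i := by rw [h1.var .i (by simp)]; simp [hi']
      have eA1 : σ1.m .inp i = A i := by rw [h1.arr .inp (by simp)]; simp [eA]
      have eP1 : σ1.m .P j = P j := by rw [h1.arr .P (by simp)]; simp [eP j hj]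
      have hlt : ∑ l ∈ Finset.range (j + 1), A i % P l * B ^ l < 2 ^ w := by
        refine (digitSum_lt (j + 1) fun l hl => ?_).trans_le
          ((Nat.pow_le_pow_right hBr hj).trans hW.le)
        have := hM.digit_lt (A i) 0 l (by omega)
        omega
      have hpow : B ^ (j + 1) < 2 ^ w := (Nat.pow_le_pow_right hBr hj).trans_lt hW
      rw [Finset.sum_range_succ] at hlt
      rw [pow_succ] at hpow
      refine (Tr.asg_seq ?_ (Tr.asg ?_ ?_)).time (by simp)
      · simp only [Expr.ok_add, Expr.ok_mul, Expr.ok_mod, Expr.ok_var, Expr.ok_get,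
          Expr.eval_mod, Expr.eval_mul, Expr.eval_get, Expr.eval_var, hI1.1, hI1.2, eA1, ei1, hj',
          eP1, true_and]
        omega
      · simpa [hI1.2, eB1] using hpow
      · simp [hI1.1, hI1.2, eA1, ei1, hj', eP1, eB1, Finset.sum_range_succ, pow_succ]
    · have ei1 : σ1.r .i = i := by rw [h1.var .i (by simp)]; simp [hi']
      have ec1 : σ1.m .code = σ'.m .code := by rw [h1.arr .code (by simp)]; simp
      refine (Tr.sto (by simp) (by simp) ?_).time (by simp)
      intro k hk
      simp only [NSt.set_m, Expr.eval_var, NSt.put_m_same, ei1, ec1]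
      split_ifs with hki
      · rw [hI1.1, hki, hashCode]
      · exact hI k (by omega)
    · simp
      omega
  · simp
    ring_nf
    omega

theorem tr_carryAll {σ : NSt} {r B : ℕ} {P : ℕ → ℕ} (hB : σ.r .B = B)
    (hP : ∀ j < r, σ.m .P j = P j) (hM : Moduli B r P)
    (hBr : 0 < B) (hW : B ^ r < 2 ^ w) (hr : 2 ^ r < 2 ^ w) :
    Tr w (carryAll r) σ (2 ^ r * (r * 30 + 40) + 10) fun σ' =>
      ∀ s < 2 ^ r, σ'.m .off s = carryCode B r P s := by
  have hrW : r < 2 ^ w := Nat.lt_two_pow_self.trans hr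
  have hw1 : 1 ≤ w := Nat.one_le_iff_ne_zero.2 (NeZero.ne w)
  refine (Tr.forLoop_const (N := 2 ^ r) (c := r * 30 + 20)
    (I := fun i σ' => ∀ k < i, σ'.m .off k = carryCode B r P k) ?_ (by simp) (by simp) ?_).time ?_
  · intro σ' h
    simpa using hr
  · intro i hi σ' h hi' hI
    have eB : σ'.r .B = B := (h.var .B (by simp)).trans hB
    have eP : ∀ j < r, σ'.m .P j = P j := fun j hj => by rw [h.arr .P (by simp), hP j hj]
    refine (Tr.asg_seq (by simp) (Tr.asg_seq (by simp [NeZero.ne w]) (Tr.asg_seq (by simp)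
      ((Tr.forLoop_const (N := r) (c := 20)
      (I := fun j σ' => σ'.r .x = ∑ l ∈ Finset.range j, i / 2 ^ l % 2 * P l * B ^ l ∧
        σ'.r .y = B ^ j ∧ σ'.r .z = i / 2 ^ j)
      ?_ (by simp) (by simp [hi']) ?_).seq (T₂ := 3) fun σ1 h1 hI1 => ?_)))).time ?_
    · intro σ1 h1
      simp [hrW]
    · intro j hj σ1 h1 hj' hI1
      have eB1 : σ1.r .B = B := by rw [h1.var .B (by simp)]; simp [eB]
      have eP1 : σ1.m .P j = P j := by rw [h1.arr .P (by simp)]; simp [eP j hj]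
      have hlt : ∑ l ∈ Finset.range (j + 1), i / 2 ^ l % 2 * P l * B ^ l < 2 ^ w := by
        refine (digitSum_lt (j + 1) fun l hl => ?_).trans_le
          ((Nat.pow_le_pow_right hBr hj).trans hW.le)
        have := hM.digit_lt 0 i l (by omega)
        omega
      have hpow : B ^ (j + 1) < 2 ^ w := (Nat.pow_le_pow_right hBr hj).trans_lt hW
      rw [Finset.sum_range_succ] at hlt
      have hle : i / 2 ^ j % 2 * P j ≤ i / 2 ^ j % 2 * P j * B ^ j :=
        Nat.le_mul_of_pos_right _ (pow_pos hBr j)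
      rw [pow_succ] at hpow
      -- The constant `2` has to be a word. If it were not, `2 ^ r < 2 ^ w` would leave only `r =
      -- 0`, and there would be no digit `j < r`.
      have h2 : 2 < 2 ^ w := by
        by_contra hc
        have hr0 : r = 0 := by
          by_contra h0
          have : 2 ^ 1 ≤ 2 ^ r := Nat.pow_le_pow_right (by omega) (by omega)
          omega
        omega
      refine (Tr.asg_seq ?_ (Tr.asg_seq ?_ (Tr.asg ?_ ?_))).time (by simp)
      · simp only [Expr.ok_add, Expr.ok_mul, Expr.ok_mod, Expr.ok_var, Expr.ok_get, Expr.ok_ofNat,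
          Expr.eval_mod, Expr.eval_mul, Expr.eval_get, Expr.eval_var, Expr.eval_ofNat, hI1.1,
          hI1.2.1, hI1.2.2, hj', eP1, true_and]
        omega
      · simpa [hI1.2.1, eB1] using hpow
      · simpa using h2
      · simp [hI1.1, hI1.2.1, hI1.2.2, hj', eP1, eB1, Finset.sum_range_succ, pow_succ,
          Nat.div_div_eq_div_mul]
    · have ei1 : σ1.r .i = i := by rw [h1.var .i (by simp)]; simp [hi']
      have ec1 : σ1.m .off = σ'.m .off := by rw [h1.arr .off (by simp)]; simp
      refine (Tr.sto (by simp) (by simp) ?_).time (by simp)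
      intro k hk
      simp only [NSt.set_m, Expr.eval_var, NSt.put_m_same, ei1, ec1]
      split_ifs with hki
      · rw [hI1.1, hki, carryCode]
      · exact hI k (by omega)
    · simp
      omega
  · simp
    ring_nf
    omega

/-! ### Histograms -/

/-- Fill the first `V` cells of an array with zeros. -/
def clear (a : Arr) : Prog := forLoop .i Var.V (sto a Var.i 0)

/-- Copy the first `V` cells of an array. -/
def copy (a b : Arr) : Prog := forLoop .i Var.V (sto a Var.i (.get b Var.i))

theorem tr_clear {σ : NSt} {a : Arr} {V : ℕ} (hV : σ.r .V = V) :
    Tr w (clear a) σ (V * 11 + 6) fun σ' => ∀ y < V, σ'.m a y = 0 := by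
  refine (Tr.forLoop_const (N := V) (c := 3) (I := fun i σ' => ∀ k < i, σ'.m a k = 0) ?_ (by simp)
    (by simp) ?_).time (by simp)
  · intro σ' h
    simp [h.var .V (by simp), hV]
  · intro i hi σ' h hi' hI
    refine (Tr.sto (by simp) (by simp) ?_).time (by simp)
    intro k hk
    simp only [NSt.set_m, NSt.put_m_same, Expr.eval_var, Expr.eval_ofNat, hi']
    split_ifs with hki
    · rfl
    · exact hI k (by omega)

theorem tr_copy {σ : NSt} {a b : Arr} {V : ℕ} (hab : b ≠ a) (hV : σ.r .V = V) :
    Tr w (copy a b) σ (V * 12 + 6) fun σ' => ∀ y < V, σ'.m a y = σ.m b y := by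
  refine (Tr.forLoop_const (N := V) (c := 4) (I := fun i σ' => ∀ k < i, σ'.m a k = σ.m b k) ?_
    (by simp) (by simp) ?_).time (by simp)
  · intro σ' h
    simp [h.var .V (by simp), hV]
  · intro i hi σ' h hi' hI
    refine (Tr.sto (by simp) (by simp) ?_).time (by simp)
    intro k hk
    simp only [NSt.set_m, NSt.put_m_same, Expr.eval_var, Expr.eval_get, hi',
      h.arr b (by simpa using hab)]
    split_ifs with hki
    · rw [hki]
    · exact hI k (by omega)

/-- Count modulo `Q` how often each hash code occurs. -/
def histCode : Prog :=
  forLoop .i Var.n (sto .T (.get .code Var.i) ((.get .T (.get .code Var.i) + 1) % Var.Q))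

/-- Count modulo `Q` how often each sum of a hash code and a carry code occurs. -/
def histCarry (r : ℕ) : Prog :=
  forLoop .j (.num (2 ^ r)) (forLoop .i Var.n
    (sto .T (.get .code Var.i + .get .off Var.j)
      ((.get .T (.get .code Var.i + .get .off Var.j) + 1) % Var.Q)))

/-- The array `T` holds the function `F` modulo `Q`. -/
def HoldsMod (a : Arr) (V Q : ℕ) (F : ℕ → ZMod Q) (σ : NSt) : Prop :=
  ∀ y < V, σ.m a y < Q ∧ (σ.m a y : ZMod Q) = F y

theorem tr_histCode {σ : NSt} {n V Q : ℕ} {c : ℕ → ℕ} (hn : σ.r .n = n) (hQ : σ.r .Q = Q)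
    (hc : ∀ i < n, σ.m .code i = c i) (hcV : ∀ i < n, c i < V) (h0 : ∀ y < V, σ.m .T y = 0)
    (hQ0 : 0 < Q) (hW : Q < 2 ^ w) :
    Tr w histCode σ (n * 20 + 10) (HoldsMod .T V Q fun y =>
      ∑ i ∈ Finset.range n, if y = c i then 1 else 0) := by
  refine (Tr.forLoop_const (N := n) (c := 10) (I := fun i => HoldsMod .T V Q fun y =>
      ∑ i ∈ Finset.range i, if y = c i then 1 else 0) ?_ (by simp) ?_ ?_).time (by simp; omega)
  · intro σ' h
    simp [h.var .n (by simp), hn]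
  · intro y hy
    simp [h0 y hy, hQ0]
  · intro i hi σ' h hi' hI
    have eQ : σ'.r .Q = Q := (h.var .Q (by simp)).trans hQ
    have ec : σ'.m .code i = c i := by rw [h.arr .code (by simp), hc i hi]
    have hT := hI _ (hcV i hi)
    refine (Tr.sto (by simp) ?_ ?_).time (by simp)
    · simp [hi', ec, NeZero.ne w]
      omega
    · intro y hy
      simp only [NSt.set_m, NSt.put_m_same, Expr.eval_get, Expr.eval_var, Expr.eval_mod,
        Expr.eval_add, Expr.eval_ofNat, hi', ec, eQ, Finset.sum_range_succ]
      split_ifs with hyc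
      · refine ⟨Nat.mod_lt _ hQ0, ?_⟩
        rw [natCast_mod_self, Nat.cast_add, hT.2, hyc]
        simp
      · simpa using hI y hy

theorem tr_histCarry {σ : NSt} {n r V Q : ℕ} {c o : ℕ → ℕ} (hn : σ.r .n = n) (hQ : σ.r .Q = Q)
    (hc : ∀ i < n, σ.m .code i = c i) (ho : ∀ s < 2 ^ r, σ.m .off s = o s)
    (hcV : ∀ i < n, ∀ s < 2 ^ r, c i + o s < V) (h0 : ∀ y < V, σ.m .T y = 0)
    (hQ0 : 0 < Q) (hW : Q < 2 ^ w) (hVW : V < 2 ^ w) (hr : 2 ^ r < 2 ^ w) :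
    Tr w (histCarry r) σ (2 ^ r * (n * 30 + 20) + 10) (HoldsMod .T V Q fun y =>
      ∑ s ∈ Finset.range (2 ^ r), ∑ i ∈ Finset.range n, if y = c i + o s then 1 else 0) := by
  refine (Tr.forLoop_const (N := 2 ^ r) (c := n * 30 + 10) (I := fun s => HoldsMod .T V Q fun y =>
      ∑ s ∈ Finset.range s, ∑ i ∈ Finset.range n, if y = c i + o s then 1 else 0) ?_ (by simp) ?_
      ?_).time ?_
  · intro σ' h
    simpa using hr
  · intro y hy
    simp [h0 y hy, hQ0]
  · intro s hs σ' h hs' hI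
    have eQ : σ'.r .Q = Q := (h.var .Q (by simp)).trans hQ
    have en : σ'.r .n = n := (h.var .n (by simp)).trans hn
    have eo : σ'.m .off s = o s := by rw [h.arr .off (by simp), ho s hs]
    refine (Tr.forLoop_const (N := n) (c := 18) (I := fun i => HoldsMod .T V Q fun y =>
      ∑ s ∈ Finset.range s, ∑ i ∈ Finset.range n, (if y = c i + o s then 1 else 0) +
      ∑ i ∈ Finset.range i, if y = c i + o s then 1 else 0) ?_ (by simp) ?_ ?_).mono ?_ ?_
    · intro σ1 h1
      simp [h1.var .n (by simp), en]
    · intro y hy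
      simpa using hI y hy
    · intro i hi σ1 h1 hi' hI1
      have eQ1 : σ1.r .Q = Q := by rw [h1.var .Q (by simp)]; simpa using eQ
      have es1 : σ1.r .j = s := by rw [h1.var .j (by simp)]; simpa using hs'
      have eo1 : σ1.m .off s = o s := by rw [h1.arr .off (by simp)]; simpa using eo
      have ec1 : σ1.m .code i = c i := by
        rw [h1.arr .code (by simp)]
        rw [h.arr .code (by simp), hc i hi]
      have hT := hI1 _ (hcV i hi s hs)
      have hlt := (hcV i hi s hs).trans hVW
      refine (Tr.sto ?_ ?_ ?_).time (by simp)
      · simpa [hi', es1, ec1, eo1] using hlt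
      · simp [hi', es1, ec1, eo1, NeZero.ne w, hlt]
        omega
      · intro y hy
        simp only [NSt.set_m, NSt.put_m_same, Expr.eval_get, Expr.eval_var, Expr.eval_mod,
          Expr.eval_add, Expr.eval_ofNat, hi', ec1, es1, eo1, eQ1, Finset.sum_range_succ]
        split_ifs with hyc
        · refine ⟨Nat.mod_lt _ hQ0, ?_⟩
          rw [natCast_mod_self, Nat.cast_add, hT.2, hyc]
          simp [add_assoc]
        · simpa using hI1 y hy
    · simp
      omega
    · intro σ1 h1 hI1 y hy
      simpa only [NSt.set_m, Finset.sum_range_succ] using hI1 y hy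
  · simp
    ring_nf
    omega

end WordRAM

namespace WordRAM

/-! ### The Fourier transform -/

/-- `acc := ∑ l, T[k * B + l] * z ^ l mod Q`. -/
def fourierEntry : Prog :=
  asg .acc 0 ;; asg .y 1 ;; forLoop .l Var.B
    (asg .acc ((Var.acc + .get .T (Var.k * Var.B + Var.l) * Var.y) % Var.Q) ;;
      asg .y (Var.y * Var.z % Var.Q))

/-- Compute the entries of the transform with a fixed new digit `j`. -/
def fourierRow : Prog :=
  forLoop .k Var.L (fourierEntry ;; sto .T2 (Var.j * Var.L + Var.k) Var.acc)

/-- One pass of the transform: replace the lowest digit by a frequency, which becomes the highest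
digit. The array `tab` holds the powers of the root of unity. -/
def fourierPass (tab : Arr) : Prog :=
  forLoop .j Var.B (asg .z (.get tab Var.j) ;; fourierRow) ;; copy .T .T2

/-- The transform over all `r` digits. -/
def fourier (r : ℕ) (tab : Arr) : Prog := forLoop .a5 (.num r) (fourierPass tab)

theorem mul_add_lt_mul {k l L B : ℕ} (hk : k < L) (hl : l < B) : k * B + l < L * B := by
  have : (k + 1) * B ≤ L * B := Nat.mul_le_mul_right _ hk
  rw [add_mul] at this
  omega

variable {w : ℕ} [NeZero w]

theorem tr_fourierEntry {σ : NSt} {B L Q k : ℕ} {z : ZMod Q} {F : ℕ → ZMod Q}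
    (hB : σ.r .B = B) (hQ : σ.r .Q = Q) (hk' : σ.r .k = k) (hk : k < L)
    (hz : σ.r .z < Q) (hz' : (σ.r .z : ZMod Q) = z)
    (hF : HoldsMod .T (L * B) Q F σ) (hQ1 : 1 < Q) (hW : Q * Q < 2 ^ w) (hVW : L * B < 2 ^ w) :
    Tr w fourierEntry σ (B * 30 + 12) fun σ' => σ'.r .acc < Q ∧
      (σ'.r .acc : ZMod Q) = ∑ l ∈ Finset.range B, F (k * B + l) * z ^ l := by
  refine (Tr.asg_seq (by simp) (Tr.asg_seq (by simp [NeZero.ne w])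
    (Tr.forLoop_const (N := B) (c := 19)
    (I := fun l σ' => (σ'.r .y < Q ∧ (σ'.r .y : ZMod Q) = z ^ l) ∧ σ'.r .acc < Q ∧
      (σ'.r .acc : ZMod Q) = ∑ l ∈ Finset.range l, F (k * B + l) * z ^ l)
    ?_ (by simp) ?_ ?_))).mono ?_ fun σ' _ h => h.2
  · intro σ2 h2
    simp [h2.var .B (by simp), hB]
  · simp [hQ1]
    omega
  · intro l hl σ2 h2 hl' hI2
    have eB2 : σ2.r .B = B := by rw [h2.var .B (by simp)]; simpa using hB
    have eQ2 : σ2.r .Q = Q := by rw [h2.var .Q (by simp)]; simpa using hQ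
    have ek2 : σ2.r .k = k := by rw [h2.var .k (by simp)]; simpa using hk'
    have ez2 : σ2.r .z = σ.r .z := by rw [h2.var .z (by simp)]; simp
    have hidx : k * B + l < L * B := mul_add_lt_mul hk hl
    have eT2 : σ2.m .T (k * B + l) = σ.m .T (k * B + l) := by
      rw [h2.arr .T (by simp)]
      simp
    obtain ⟨hT, hT'⟩ := hF _ hidx
    have hm1 : σ.m .T (k * B + l) * σ2.r .y ≤ (Q - 1) * (Q - 1) :=
      Nat.mul_le_mul (by omega) (by omega)
    have hm2 : σ2.r .y * σ.r .z ≤ (Q - 1) * (Q - 1) :=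
      Nat.mul_le_mul (by omega) (by omega)
    -- A product of two residues plus a third residue is still below `Q * Q`, so one reduction at
    -- the end of each step is enough.
    have hm3 : (Q - 1) * (Q - 1) + Q ≤ Q * Q := by
      obtain ⟨q, rfl⟩ : ∃ q, Q = q + 1 := ⟨Q - 1, by omega⟩
      have : (q + 1) * (q + 1) = q * q + 2 * q + 1 := by ring
      simp only [add_tsub_cancel_right]
      omega
    refine (Tr.asg_seq ?_ (Tr.asg ?_ ?_)).time (by simp)
    · simp only [Expr.ok_add, Expr.ok_mul, Expr.ok_mod, Expr.ok_var, Expr.ok_get,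
        Expr.eval_add, Expr.eval_mul, Expr.eval_get, Expr.eval_var, ek2, eB2, hl', eT2,
        true_and, and_true]
      omega
    · simp [ez2]
      omega
    · simp only [NSt.set_r_same, ne_eq, reduceCtorEq, not_false_eq_true, NSt.set_r_of_ne,
        Expr.eval_mod, Expr.eval_mul, Expr.eval_var, Expr.eval_add, Expr.eval_get, ek2, eB2,
        hl', eT2, eQ2, ez2, natCast_mod_self, Finset.sum_range_succ]
      refine ⟨⟨Nat.mod_lt _ (by omega), ?_⟩, Nat.mod_lt _ (by omega), ?_⟩
      · rw [Nat.cast_mul, hI2.1.2, hz', pow_succ]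
      · rw [Nat.cast_add, Nat.cast_mul, hI2.2.2, hT', hI2.1.2]
  · simp
    omega

theorem tr_fourierRow {σ : NSt} {B L Q j : ℕ} {z : ZMod Q} {F : ℕ → ZMod Q}
    (hB : σ.r .B = B) (hL : σ.r .L = L) (hQ : σ.r .Q = Q) (hj' : σ.r .j = j) (hj : j < B)
    (hz : σ.r .z < Q) (hz' : (σ.r .z : ZMod Q) = z)
    (hF : HoldsMod .T (L * B) Q F σ) (hQ1 : 1 < Q) (hW : Q * Q < 2 ^ w) (hVW : L * B < 2 ^ w) :
    Tr w fourierRow σ (L * (B * 30 + 40) + 10) fun σ' =>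
      (∀ x < j * L, σ'.m .T2 x = σ.m .T2 x) ∧ ∀ h < L, σ'.m .T2 (j * L + h) < Q ∧
        (σ'.m .T2 (j * L + h) : ZMod Q) = ∑ l ∈ Finset.range B, F (h * B + l) * z ^ l := by
  refine (Tr.forLoop_const (N := L) (c := B * 30 + 20) (I := fun k σ' =>
    (∀ x < j * L, σ'.m .T2 x = σ.m .T2 x) ∧ ∀ h < k, σ'.m .T2 (j * L + h) < Q ∧
        (σ'.m .T2 (j * L + h) : ZMod Q) = ∑ l ∈ Finset.range B, F (h * B + l) * z ^ l)
    ?_ (by simp [fourierEntry]) (by simp) ?_).time ?_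
  · intro σ1 h1
    simp [h1.var .L (by simp [fourierEntry]), hL]
  · intro k hk σ1 h1 hk' hI1
    have eB1 : σ1.r .B = B := (h1.var .B (by simp [fourierEntry])).trans hB
    have eQ1 : σ1.r .Q = Q := (h1.var .Q (by simp [fourierEntry])).trans hQ
    have eL1 : σ1.r .L = L := (h1.var .L (by simp [fourierEntry])).trans hL
    have ej1 : σ1.r .j = j := (h1.var .j (by simp [fourierEntry])).trans hj'
    have ez1 : σ1.r .z = σ.r .z := h1.var .z (by simp [fourierEntry])
    have eT1 : σ1.m .T = σ.m .T := h1.arr .T (by simp [fourierEntry])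
    have hF1 : HoldsMod .T (L * B) Q F σ1 := by
      intro y hy
      rw [eT1]
      exact hF y hy
    refine ((tr_fourierEntry (z := z) eB1 eQ1 hk' hk (by rwa [ez1]) (by rwa [ez1]) hF1 hQ1 hW
        hVW).seq
      (T₂ := 7) fun σ2 h2 hI2 => (Tr.sto ?_ (by simp) ?_).time (by simp)).time (by omega)
    all_goals
      have eL2 : σ2.r .L = L := (h2.var .L (by simp [fourierEntry])).trans eL1
      have ej2 : σ2.r .j = j := (h2.var .j (by simp [fourierEntry])).trans ej1
      have ek2 : σ2.r .k = k := (h2.var .k (by simp [fourierEntry])).trans hk'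
    · have : j * L + k < L * B := mul_comm L B ▸ mul_add_lt_mul hj hk
      simp [ej2, eL2, ek2]
      omega
    · have eT2 : σ2.m .T2 = σ1.m .T2 := h2.arr .T2 (by simp [fourierEntry])
      simp only [NSt.set_m, NSt.put_m_same, Expr.eval_add, Expr.eval_mul, Expr.eval_var, ej2,
        eL2, ek2, eT2]
      refine ⟨fun x hx => ?_, fun h hh => ?_⟩
      · rw [if_neg (by omega)]
        exact hI1.1 x hx
      · by_cases hhk : h = k
        · subst hhk
          simpa using hI2
        · simp only [add_right_inj, if_neg hhk]
          exact hI1.2 h (by omega)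
  · simp
    ring_nf
    omega

theorem tr_fourierPass {σ : NSt} {tab : Arr} {B L Q : ℕ} {ζ : ZMod Q} {F : ℕ → ZMod Q}
    (htab : tab ≠ .T ∧ tab ≠ .T2) (hB : σ.r .B = B) (hL : σ.r .L = L) (hQ : σ.r .Q = Q)
    (hV : σ.r .V = L * B) (ht : HoldsMod tab B Q (fun j => ζ ^ j) σ)
    (hF : HoldsMod .T (L * B) Q F σ) (hQ1 : 1 < Q) (hW : Q * Q < 2 ^ w) (hVW : L * B < 2 ^ w) :
    Tr w (fourierPass tab) σ (B * (L * (B * 30 + 40) + 25) + 20 + (L * B * 12 + 6)) fun σ' =>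
      (∀ y < L * B, σ'.m .T y < Q) ∧ ∀ j < B, ∀ h < L,
        (σ'.m .T (j * L + h) : ZMod Q) = ∑ l ∈ Finset.range B, F (h * B + l) * ζ ^ (j * l) := by
  have idx {j h : ℕ} (hj : j < B) (hh : h < L) : j * L + h < L * B :=
    mul_comm L B ▸ mul_add_lt_mul hj hh
  refine (Tr.forLoop_const (N := B) (c := L * (B * 30 + 40) + 13) (I := fun i σ' =>
    ∀ j < i, ∀ h < L, σ'.m .T2 (j * L + h) < Q ∧
      (σ'.m .T2 (j * L + h) : ZMod Q) = ∑ l ∈ Finset.range B, F (h * B + l) * ζ ^ (j * l))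
    ?_ (by simp [fourierRow, fourierEntry]) (by simp) ?_).seq (T₂ := L * B * 12 + 6)
    (fun σ1 h1 hI1 => ?_) |>.time ?_
  · intro σ' h
    simp [h.var .B (by simp [fourierRow, fourierEntry]), hB]
  · intro j hj σ' h hj' hI
    have eB : σ'.r .B = B := (h.var .B (by simp [fourierRow, fourierEntry])).trans hB
    have eL : σ'.r .L = L := (h.var .L (by simp [fourierRow, fourierEntry])).trans hL
    have eQ : σ'.r .Q = Q := (h.var .Q (by simp [fourierRow, fourierEntry])).trans hQ
    have et : σ'.m tab j < Q ∧ (σ'.m tab j : ZMod Q) = ζ ^ j := by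
      rw [h.arr tab (by simp [fourierRow, fourierEntry, htab.2])]
      exact ht j hj
    have hF' : HoldsMod .T (L * B) Q F σ' := by
      intro y hy
      rw [h.arr .T (by simp [fourierRow, fourierEntry])]
      exact hF y hy
    refine (Tr.asg_seq (by simp) ((tr_fourierRow (B := B) (L := L) (Q := Q) (j := j)
      (z := ζ ^ j) (F := F) (by simpa using eB) (by simpa using eL) (by simpa using eQ)
      (by simpa using hj') hj (by simpa [hj'] using et.1) (by simpa [hj'] using et.2)
      (fun y hy => by simpa using hF' y hy) hQ1 hW hVW).post ?_)).time (by simp; omega)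
    rintro σ1 h1 ⟨hI1, hI2⟩ i hi h hh
    simp only [NSt.set_m] at hI1 ⊢
    rcases Nat.lt_or_ge i j with hij | hij
    · have : (i + 1) * L ≤ j * L := Nat.mul_le_mul_right _ hij
      rw [add_mul] at this
      rw [hI1 _ (by omega)]
      exact hI i hij h hh
    · rw [show i = j by omega]
      simpa only [pow_mul] using hI2 h hh
  · have eV1 : σ1.r .V = L * B := (h1.var .V (by simp [fourierRow, fourierEntry])).trans hV
    refine (tr_copy (by decide) eV1).post fun σ2 _ h2 => ⟨fun y hy => ?_, fun j hj h hh => ?_⟩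
    · have hL0 : 0 < L := Nat.pos_of_ne_zero fun h0 => by simp [h0] at hy
      have hj : y / L < B := Nat.div_lt_of_lt_mul hy
      have hh : y % L < L := Nat.mod_lt _ hL0
      have e : y / L * L + y % L = y := by rw [mul_comm]; exact Nat.div_add_mod y L
      rw [h2 y hy]
      have := (hI1 _ hj _ hh).1
      rwa [e] at this
    · rw [h2 _ (idx hj hh)]
      exact (hI1 j hj h hh).2
  · simp
    ring_nf
    omega

/-- Every pass consumes the lowest digit and puts a frequency on top, so the digits rotate and all
passes are identical. After `t` passes the `t` lowest original digits have become the top block `J`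
of frequencies and the remaining digits `h` have moved down. After `r` passes the rotation is
complete and the frequencies stand in their natural order. Each pass has `B ^ r` entries with `B`
terms. -/
theorem tr_fourier {σ : NSt} {tab : Arr} {B Q r : ℕ} {ζ : ZMod Q} {F : ℕ → ZMod Q}
    (htab : tab ≠ .T ∧ tab ≠ .T2) (hr : 0 < r) (hrW : r < 2 ^ w) (hB0 : 0 < B) (hB : σ.r .B = B)
    (hL : σ.r .L = B ^ (r - 1)) (hQ : σ.r .Q = Q) (hV : σ.r .V = B ^ r)
    (ht : HoldsMod tab B Q (fun j => ζ ^ j) σ) (hF : HoldsMod .T (B ^ r) Q F σ) (hQ1 : 1 < Q)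
    (hW : Q * Q < 2 ^ w) (hVW : B ^ r < 2 ^ w) :
    Tr w (fourier r tab) σ (r * (200 * B ^ (r + 1)) + 10) (HoldsMod .T (B ^ r) Q fun J =>
      ∑ X ∈ Finset.range (B ^ r), F X * chi ζ B r J X) := by
  have eLB : B ^ (r - 1) * B = B ^ r := by rw [← pow_succ, Nat.sub_add_cancel hr]
  refine (Tr.forLoop_const (N := r) (c := 190 * B ^ (r + 1)) (I := fun t σ' =>
    (∀ y < B ^ r, σ'.m .T y < Q) ∧ ∀ J < B ^ t, ∀ h < B ^ (r - t),
      (σ'.m .T (J * B ^ (r - t) + h) : ZMod Q) =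
        ∑ X ∈ Finset.range (B ^ t), F (h * B ^ t + X) * chi ζ B t J X)
    ?_ (by simp [fourierPass, fourierRow, fourierEntry, copy]) ?_ ?_).mono ?_ ?_
  · intro σ' h
    simpa using hrW
  · refine ⟨fun y hy => by simpa using (hF y hy).1, fun J hJ h hh => ?_⟩
    have : J = 0 := by simpa using hJ
    subst this
    simpa [chi] using (hF h (by simpa using hh)).2
  · intro t htr σ' h _ hI
    have eB : σ'.r .B = B := (h.var .B (by simp [fourierPass, fourierRow, fourierEntry,
        copy])).trans hB
    have eL : σ'.r .L = B ^ (r - 1) := (h.var .L (by simp [fourierPass, fourierRow, fourierEntry,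
        copy])).trans hL
    have eQ : σ'.r .Q = Q := (h.var .Q (by simp [fourierPass, fourierRow, fourierEntry,
        copy])).trans hQ
    have eV : σ'.r .V = B ^ (r - 1) * B := by
      rw [eLB, h.var .V (by simp [fourierPass, fourierRow, fourierEntry, copy]), hV]
    have et : HoldsMod tab B Q (fun j => ζ ^ j) σ' := by
      intro j hj
      rw [h.arr tab (by simp [fourierPass, fourierRow, fourierEntry, copy, htab])]
      exact ht j hj
    refine (tr_fourierPass (F := fun y => (σ'.m .T y : ZMod Q)) htab eB eL eQ eV et
      (by rw [eLB]; exact fun y hy => ⟨hI.1 y hy, rfl⟩) hQ1 hW (by rw [eLB]; exact hVW)).mono ?_ ?_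
    · have e1 : B ^ (r + 1) = B * (B ^ (r - 1) * B) := by rw [eLB, pow_succ']
      have h1 : 1 ≤ B ^ (r - 1) := Nat.one_le_pow _ _ hB0
      rw [e1]
      have h2 : B ^ (r - 1) ≤ B ^ (r - 1) * B := Nat.le_mul_of_pos_right _ hB0
      have h3 : B * 1 ≤ B * (B ^ (r - 1) * B) := Nat.mul_le_mul_left _ (by omega)
      have h4 : B ^ (r - 1) * B ≤ B * (B ^ (r - 1) * B) := Nat.le_mul_of_pos_left _ hB0
      ring_nf at h3 h4 ⊢
      omega
    · rintro σ1 - ⟨h1, h2⟩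
      simp only [NSt.set_m]
      rw [eLB] at h1
      refine ⟨h1, fun J' hJ' hi hhi => ?_⟩
      have hBt : 0 < B ^ t := Nat.pow_pos hB0
      -- The new frequency digit `j` stands above the `t` earlier ones; the digit `l` that it
      -- replaces has position `t` in the original argument.
      obtain ⟨j, J, hj, hJ, rfl⟩ : ∃ j J, j < B ∧ J < B ^ t ∧ J' = j * B ^ t + J := by
        refine ⟨J' / B ^ t, J' % B ^ t, ?_, Nat.mod_lt _ hBt, ?_⟩
        · exact Nat.div_lt_of_lt_mul (by rwa [pow_succ] at hJ')
        · rw [mul_comm]; exact (Nat.div_add_mod _ _).symm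
      have e2 : B ^ t * B ^ (r - (t + 1)) = B ^ (r - 1) := by
        rw [← pow_add]; congr 1; omega
      have e3 : B ^ (r - t) = B ^ (r - (t + 1)) * B := by
        rw [← pow_succ]; congr 1; omega
      have hh : J * B ^ (r - (t + 1)) + hi < B ^ (r - 1) := by
        rw [← e2]; exact mul_add_lt_mul hJ hhi
      have := h2 j hj _ hh
      rw [show (j * B ^ t + J) * B ^ (r - (t + 1)) + hi =
        j * B ^ (r - 1) + (J * B ^ (r - (t + 1)) + hi) by rw [← e2]; ring, this, pow_succ,
        mul_comm (B ^ t) B, sum_range_mul_split]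
      refine Finset.sum_congr rfl fun l hl => ?_
      have hl' := Finset.mem_range.1 hl
      have hidx : hi * B + l < B ^ (r - t) := by
        rw [e3]; exact mul_add_lt_mul hhi hl'
      rw [show (J * B ^ (r - (t + 1)) + hi) * B + l = J * B ^ (r - t) + (hi * B + l) by
        rw [e3]; ring, hI.2 J hJ _ hidx, Finset.sum_mul]
      refine Finset.sum_congr rfl fun X hX => ?_
      rw [chi_split ζ hj hJ hl' (Finset.mem_range.1 hX), mul_assoc]
      congr 2
      ring
  · have h1 : 1 ≤ B ^ (r + 1) := Nat.one_le_pow _ _ hB0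
    have : r * (190 * B ^ (r + 1) + (1 + 7)) ≤ r * (200 * B ^ (r + 1)) :=
      Nat.mul_le_mul_left _ (by omega)
    simp only [Expr.cost_num]
    omega
  · rintro σ' - ⟨h1, h2⟩ J hJ
    refine ⟨h1 J hJ, ?_⟩
    have := h2 J hJ 0 (by simp)
    simpa using this

end WordRAM

namespace WordRAM

/-! ### Counting the coincidences of hash codes -/

/-- The number of quadruples `(s, i, j, k)` such that the hash codes of `A j` and `A k` add up to
the hash code of `A i` plus the carry code of `s`. -/
def tripleCount (n r B : ℕ) (P A : ℕ → ℕ) : ℕ :=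
  ∑ s ∈ Finset.range (2 ^ r), ∑ i ∈ Finset.range n, ∑ j ∈ Finset.range n, ∑ k ∈ Finset.range n,
    if hashCode B r P (A j) + hashCode B r P (A k) = hashCode B r P (A i) + carryCode B r P s
    then 1 else 0

section
variable {R : Type*} [CommRing R]

theorem sum_ite_eq_mul {ι : Type*} (V : ℕ) (s : Finset ι) (c : ι → ℕ) (hc : ∀ i ∈ s, c i < V)
    (f : ℕ → R) :
    ∑ X ∈ Finset.range V, (∑ i ∈ s, if X = c i then 1 else 0) * f X = ∑ i ∈ s, f (c i) := by
  simp only [Finset.sum_mul]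
  rw [Finset.sum_comm]
  refine Finset.sum_congr rfl fun i hi => ?_
  simp [hc i hi]

/-- The transform of a histogram is a sum of characters over the points counted. Hence the product
of the three transforms at `J` is a sum over quadruples `(s, i, j, k)`, and after summation over `J`
the orthogonality relation keeps exactly the coincidences, each with weight `B ^ r`. The third
transform uses the inverse root `ζ'`, since the target stands on the other side of the equation. -/
theorem sum_fourier_eq_tripleCount {n r B : ℕ} {P : ℕ → ℕ} (A : ℕ → ℕ) {ζ ζ' : R}
    (hM : Moduli B r P) (hB : 0 < B) (h : Orth B ζ ζ') :
    ∑ J ∈ Finset.range (B ^ r),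
      (∑ X ∈ Finset.range (B ^ r), (∑ i ∈ Finset.range n,
        if X = hashCode B r P (A i) then 1 else 0) * chi ζ B r J X) *
      (∑ X ∈ Finset.range (B ^ r), (∑ i ∈ Finset.range n,
        if X = hashCode B r P (A i) then 1 else 0) * chi ζ B r J X) *
      (∑ X ∈ Finset.range (B ^ r), (∑ s ∈ Finset.range (2 ^ r), ∑ i ∈ Finset.range n,
        if X = hashCode B r P (A i) + carryCode B r P s then 1 else 0) * chi ζ' B r J X) =
      (B : R) ^ r * (tripleCount n r B P A : R) := by
  have h1 (J : ℕ) := sum_ite_eq_mul (B ^ r) (Finset.range n) (fun i => hashCode B r P (A i))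
    (fun i _ => hM.hashCode_lt _) (chi ζ B r J)
  have h2 (J : ℕ) := sum_ite_eq_mul (B ^ r) (Finset.range (2 ^ r) ×ˢ Finset.range n)
    (fun x => hashCode B r P (A x.2) + carryCode B r P x.1)
    (fun x _ => hM.hashCode_add_lt _ _) (chi ζ' B r J)
  simp only [Finset.sum_product] at h2
  have h3 {a : ℕ → R} {b : ℕ → ℕ → R} : (∑ j ∈ Finset.range n, a j) * (∑ k ∈ Finset.range n, a k) *
      (∑ s ∈ Finset.range (2 ^ r), ∑ i ∈ Finset.range n, b s i) =
      ∑ s ∈ Finset.range (2 ^ r), ∑ i ∈ Finset.range n, ∑ j ∈ Finset.range n,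
        ∑ k ∈ Finset.range n, a j * a k * b s i := by
    rw [Finset.sum_mul_sum, Finset.mul_sum]
    refine Finset.sum_congr rfl fun s _ => ?_
    rw [Finset.mul_sum]
    refine Finset.sum_congr rfl fun i _ => ?_
    rw [Finset.sum_mul]
    exact Finset.sum_congr rfl fun j _ => Finset.sum_mul ..
  simp only [h1, h2, h3, tripleCount, Nat.cast_sum]
  simp only [Finset.mul_sum]
  rw [Finset.sum_comm]
  refine Finset.sum_congr rfl fun s _ => ?_
  rw [Finset.sum_comm]
  refine Finset.sum_congr rfl fun i _ => ?_
  rw [Finset.sum_comm]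
  refine Finset.sum_congr rfl fun j _ => ?_
  rw [Finset.sum_comm]
  refine Finset.sum_congr rfl fun k _ => ?_
  have hdig (a : ℕ) : ∀ l < r, dig B (hashCode B r P a) l = a % P l := fun l hl =>
    dig_digitSum (fun j hj => by have := hM.digit_lt a 0 j hj; omega) hl
  have hX : ∀ l < r, dig B (hashCode B r P (A j)) l + dig B (hashCode B r P (A k)) l < B := by
    intro l hl
    rw [hdig _ l hl, hdig _ l hl]
    obtain ⟨h3, h4⟩ := hM l hl
    have := Nat.mod_lt (A j) h3
    have := Nat.mod_lt (A k) h3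
    omega
  rw [h.sum_chi (hM.hashCode_lt (A j)) (hM.hashCode_lt (A k)) (hM.hashCode_add_lt (A i) s) hB hX]
  split_ifs <;> simp

end

/-- `acc := ∑ J, FT[J] ^ 2 * T[J] mod Q`. -/
def spectralSum : Prog :=
  asg .acc 0 ;; forLoop .i Var.V (asg .acc
    ((Var.acc + .get .FT Var.i * .get .FT Var.i % Var.Q * .get .T Var.i) % Var.Q))

/-- Compute all hash codes and the number `S` of coincidences between them. -/
def countTriples (r : ℕ) : Prog :=
  hashAll r ;; carryAll r ;; clear .T ;; histCode ;; fourier r .pw1 ;; copy .FT .T ;;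
  clear .T ;; histCarry r ;; fourier r .pw2 ;; spectralSum ;; asg .S (Var.acc * Var.inv % Var.Q)

theorem Agree.weaken {p P : Prog} {σ σ' : NSt} (h : Agree p σ σ')
    (hv : ∀ v, P.keepsVar v = true → p.keepsVar v = true)
    (ha : ∀ a, P.keepsArr a = true → p.keepsArr a = true) : Agree P σ σ' :=
  ⟨fun v h' => h.var v (hv v h'), fun a h' => h.arr a (ha a h')⟩

/-- The variables that `countTriples` modifies. -/
def countVars : List Var := [.i, .j, .k, .l, .x, .y, .z, .acc, .a5, .S]

/-- The arrays that `countTriples` modifies. -/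
def countArrs : List Arr := [.code, .off, .T, .T2, .FT]

theorem countTriples_keepsVar {r : ℕ} {v : Var} (hv : v ∉ countVars) :
    (countTriples r).keepsVar v = true := by
  simp only [countVars, List.mem_cons, List.not_mem_nil, or_false, not_or] at hv
  simp [countTriples, hashAll, carryAll, clear, copy, histCode, histCarry, fourier, fourierPass,
    fourierRow, fourierEntry, spectralSum, hv]

theorem countTriples_keepsArr {r : ℕ} {a : Arr} (ha : a ∉ countArrs) :
    (countTriples r).keepsArr a = true := by
  simp only [countArrs, List.mem_cons, List.not_mem_nil, or_false, not_or] at ha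
  simp [countTriples, hashAll, carryAll, clear, copy, histCode, histCarry, fourier, fourierPass,
    fourierRow, fourierEntry, spectralSum, ha]

variable {w : ℕ} [NeZero w]

theorem tr_spectralSum {σ : NSt} {V Q : ℕ} {F H : ℕ → ZMod Q} (hV : σ.r .V = V) (hQ : σ.r .Q = Q)
    (hF : HoldsMod .FT V Q F σ) (hH : HoldsMod .T V Q H σ) (hQ1 : 1 < Q) (hW : Q * Q < 2 ^ w) :
    Tr w spectralSum σ (V * 30 + 20) fun σ' => σ'.r .acc < Q ∧
      (σ'.r .acc : ZMod Q) = ∑ J ∈ Finset.range V, F J * F J * H J := by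
  refine (Tr.asg_seq (by simp) (Tr.forLoop_const (N := V) (c := 20) (I := fun i σ' =>
    σ'.r .acc < Q ∧ (σ'.r .acc : ZMod Q) = ∑ J ∈ Finset.range i, F J * F J * H J)
    ?_ (by simp) ?_ ?_)).time ?_
  · intro σ' h
    simp [h.var .V (by simp), hV]
  · simp
    omega
  · intro i hi σ' h hi' hI
    have eQ : σ'.r .Q = Q := by rw [h.var .Q (by simp)]; simpa using hQ
    have eF : σ'.m .FT = σ.m .FT := by rw [h.arr .FT (by simp)]; simp
    have eT : σ'.m .T = σ.m .T := by rw [h.arr .T (by simp)]; simp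
    obtain ⟨f1, f2⟩ := hF i hi
    obtain ⟨g1, g2⟩ := hH i hi
    have hm1 : σ.m .FT i * σ.m .FT i ≤ (Q - 1) * (Q - 1) := Nat.mul_le_mul (by omega) (by omega)
    have hm4 := Nat.mod_lt (σ.m .FT i * σ.m .FT i) (show 0 < Q by omega)
    have hm2 : σ.m .FT i * σ.m .FT i % Q * σ.m .T i ≤ (Q - 1) * (Q - 1) :=
      Nat.mul_le_mul (by omega) (by omega)
    have hm3 : (Q - 1) * (Q - 1) + Q ≤ Q * Q := by
      obtain ⟨q, rfl⟩ : ∃ q, Q = q + 1 := ⟨Q - 1, by omega⟩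
      have : (q + 1) * (q + 1) = q * q + 2 * q + 1 := by ring
      simp only [add_tsub_cancel_right]
      omega
    refine (Tr.asg ?_ ?_).time (by simp)
    · simp only [Expr.ok_add, Expr.ok_mul, Expr.ok_mod, Expr.ok_var, Expr.ok_get,
        Expr.eval_mul, Expr.eval_mod, Expr.eval_get, Expr.eval_var, hi', eF, eT, eQ,
        true_and, and_true]
      omega
    · simp only [NSt.set_r_same, ne_eq, reduceCtorEq, not_false_eq_true, NSt.set_r_of_ne,
        Expr.eval_mod, Expr.eval_mul, Expr.eval_var, Expr.eval_add, Expr.eval_get, hi', eF, eT, eQ,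
        natCast_mod_self, Nat.cast_add, Nat.cast_mul, Finset.sum_range_succ, hI.2, f2, g2]
      exact ⟨Nat.mod_lt _ (by omega), trivial⟩
  · simp
    omega

/-- The spectral sum equals `B ^ r` times the count modulo `Q`. Multiplication by the stored inverse
of `B ^ r` leaves the residue of the count, and by `hS` this is the count itself. -/
theorem tr_countTriples {σ : NSt} {n r e : ℕ} {P A : ℕ → ℕ} (hp : Params r e σ) (hr : 0 < r)
    (he : 0 < e) (hn : σ.r .n = n) (hA : ∀ i < n, σ.m .inp i = A i)
    (hP : ∀ j < r, σ.m .P j = P j) (hM : Moduli (σ.r .B) r P) (hW : σ.r .Q * σ.r .Q < 2 ^ w)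
    (hVW : σ.r .V < 2 ^ w) (hrW : 2 ^ r < 2 ^ w) (hS : tripleCount n r (σ.r .B) P A < σ.r .Q) :
    Tr w (countTriples r) σ (n * 2 ^ r * (r + 1) * 200 + (r + 1) * 2 ^ r * 1000 * σ.r .B ^ (r + 1))
      fun σ' => σ'.r .S = tripleCount n r (σ.r .B) P A ∧
        (∀ i < n, σ'.m .code i = hashCode (σ.r .B) r P (A i)) ∧
        ∀ s < 2 ^ r, σ'.m .off s = carryCode (σ.r .B) r P s := by
  obtain ⟨hg, hq1, hq2, hB, hQe, hL, hV, hinv, hinv', ζ, ζ', horth, ht1, ht2⟩ := hp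
  have hB0 : 0 < σ.r .B := by omega
  have hQ1 : 1 < σ.r .Q := by
    rw [hQe]
    exact Nat.one_lt_pow he.ne' (by omega)
  generalize eB : σ.r .B = B at *
  generalize eQ : σ.r .Q = Q at *
  generalize eL : σ.r .L = L at *
  generalize eV : σ.r .V = V at *
  subst hL hV
  have hQW : Q < 2 ^ w := by
    have : Q ≤ Q * Q := Nat.le_mul_of_pos_left _ (by omega)
    omega
  have hrW' : r < 2 ^ w := Nat.lt_two_pow_self.trans hrW
  set c : ℕ → ℕ := fun i => hashCode B r P (A i) with hc
  set o : ℕ → ℕ := carryCode B r P with ho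
  set F : ℕ → ZMod Q := fun y => ∑ i ∈ Finset.range n, if y = c i then 1 else 0 with hF
  set H : ℕ → ZMod Q := fun y => ∑ s ∈ Finset.range (2 ^ r), ∑ i ∈ Finset.range n,
    if y = c i + o s then 1 else 0 with hH
  have kv {v : Var} (hv : v ∉ countVars) := countTriples_keepsVar (r := r) hv
  have ka {a : Arr} (ha : a ∉ countArrs) := countTriples_keepsArr (r := r) ha
  -- Whatever the whole program keeps is kept by each component, so agreement with the initial
  -- values can be propagated from one component to the next.
  have step {p : Prog} {τ τ' : NSt} (h : Agree (countTriples r) σ τ) (h' : Agree p τ τ')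
      (hv : ∀ v, (countTriples r).keepsVar v = true → p.keepsVar v = true := by
        intro v hv
        simp only [countTriples, keepsVar_seq] at hv
        tauto)
      (ha : ∀ a, (countTriples r).keepsArr a = true → p.keepsArr a = true := by
        intro a ha
        simp only [countTriples, keepsArr_seq] at ha
        tauto) : Agree (countTriples r) σ τ' := h.trans (h'.weaken hv ha)
  have vars {τ : NSt} (h : Agree (countTriples r) σ τ) : τ.r .n = n ∧ τ.r .B = B ∧
      τ.r .L = B ^ (r - 1) ∧ τ.r .V = B ^ r ∧ τ.r .Q = Q ∧ τ.r .inv = σ.r .inv := by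
    refine ⟨?_, ?_, ?_, ?_, ?_, ?_⟩ <;> rw [h.var _ (kv (by decide))] <;> assumption
  apply Tr.time
  · apply Tr.seq (tr_hashAll hn eB hA hP hM hB0 hVW hrW')
    intro σ1 a1 h1
    have A1 := step (Agree.refl _ _) a1
    apply Tr.seq (tr_carryAll (P := P) (vars A1).2.1
        (fun j hj => by rw [A1.arr .P (ka (by decide)), hP j hj]) hM hB0 hVW hrW)
    intro σ2 a2 h2
    have A2 := step A1 a2
    apply Tr.seq (tr_clear (vars A2).2.2.2.1)
    intro σ3 a3 h3
    have A3 := step A2 a3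
    have c3 : ∀ i < n, σ3.m .code i = c i := fun i hi => by
      rw [a3.arr .code (by simp [clear]), a2.arr .code (by simp [carryAll]), h1 i hi]
    have o3 : ∀ s < 2 ^ r, σ3.m .off s = o s := fun i hi => by
      rw [a3.arr .off (by simp [clear]), h2 i hi]
    apply Tr.seq (tr_histCode (vars A3).1 (vars A3).2.2.2.2.1 c3
        (fun i _ => hM.hashCode_lt _) h3 (by omega) hQW)
    intro σ4 a4 h4
    have A4 := step A3 a4
    apply Tr.seq (tr_fourier (tab := .pw1) (ζ := ζ) (F := F) (by decide) hr hrW' hB0 (vars A4).2.1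
        (vars A4).2.2.1 (vars A4).2.2.2.2.1 (vars A4).2.2.2.1
        (fun j hj => by rw [A4.arr .pw1 (ka (by decide))]; exact ht1 j hj) h4 hQ1 hW hVW)
    intro σ5 a5 h5
    have A5 := step A4 a5
    apply Tr.seq (tr_copy (by decide) (vars A5).2.2.2.1)
    intro σ6 a6 h6
    have A6 := step A5 a6
    apply Tr.seq (tr_clear (vars A6).2.2.2.1)
    intro σ7 a7 h7
    have A7 := step A6 a7
    have fk : (fourier r .pw1).keepsArr .code = true ∧ (fourier r .pw1).keepsArr .off = true := by
      simp [fourier, fourierPass, fourierRow, fourierEntry, copy]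
    have c7 : ∀ i < n, σ7.m .code i = c i := fun i hi => by
      rw [a7.arr .code (by simp [clear]), a6.arr .code (by simp [copy]), a5.arr .code fk.1,
        a4.arr .code (by simp [histCode]), c3 i hi]
    have o7 : ∀ s < 2 ^ r, σ7.m .off s = o s := fun i hi => by
      rw [a7.arr .off (by simp [clear]), a6.arr .off (by simp [copy]), a5.arr .off fk.2,
        a4.arr .off (by simp [histCode]), o3 i hi]
    apply Tr.seq (tr_histCarry (vars A7).1 (vars A7).2.2.2.2.1 c7 o7
        (fun i _ s _ => hM.hashCode_add_lt _ _) h7 (by omega) hQW hVW hrW)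
    intro σ8 a8 h8
    have A8 := step A7 a8
    apply Tr.seq (tr_fourier (tab := .pw2) (ζ := ζ') (F := H) (by decide) hr hrW' hB0 (vars A8).2.1
        (vars A8).2.2.1 (vars A8).2.2.2.2.1 (vars A8).2.2.2.1
        (fun j hj => by rw [A8.arr .pw2 (ka (by decide))]; exact ht2 j hj) h8 hQ1 hW hVW)
    intro σ9 a9 h9
    have A9 := step A8 a9
    have fk' : (fourier r .pw2).keepsArr .code = true ∧ (fourier r .pw2).keepsArr .off = true ∧
        (fourier r .pw2).keepsArr .FT = true := by
      simp [fourier, fourierPass, fourierRow, fourierEntry, copy]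
    apply Tr.seq (tr_spectralSum (vars A9).2.2.2.1 (vars A9).2.2.2.2.1
        (F := fun J => ∑ X ∈ Finset.range (B ^ r), F X * chi ζ B r J X) (fun J hJ => by
          rw [a9.arr .FT fk'.2.2, a8.arr .FT (by simp [histCarry]), a7.arr .FT (by simp [clear]),
            h6 J hJ]
          exact h5 J hJ) h9 hQ1 hW)
    intro σ10 a10 h10
    have A10 := step A9 a10
    obtain ⟨hacc, hacc'⟩ := h10
    rw [sum_fourier_eq_tripleCount A hM hB0 horth] at hacc'
    refine Tr.asg ?_ ⟨?_, ?_, ?_⟩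
    · simp [(vars A10).2.2.2.2.2]
      exact (Nat.mul_le_mul hacc.le hinv.le).trans_lt hW
    · simp only [Expr.eval_mod, Expr.eval_mul, Expr.eval_var, NSt.set_r_same,
        (vars A10).2.2.2.2.2, (vars A10).2.2.2.2.1]
      have : ((σ10.r .acc * σ.r .inv % Q : ℕ) : ZMod Q) = (tripleCount n r B P A : ℕ) := by
        rw [natCast_mod_self, Nat.cast_mul, hacc', mul_right_comm, mul_comm (_ ^ r), hinv', one_mul]
      rw [ZMod.natCast_eq_natCast_iff] at this
      have h' := Nat.ModEq.eq_of_lt_of_lt this (Nat.mod_lt _ (by omega)) hS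
      exact h'
    · intro i hi
      simp only [NSt.set_m]
      rw [a10.arr .code (by simp [spectralSum]), a9.arr .code fk'.1,
        a8.arr .code (by simp [histCarry]), c7 i hi]
    · intro i hi
      simp only [NSt.set_m]
      rw [a10.arr .off (by simp [spectralSum]), a9.arr .off fk'.2.1,
        a8.arr .off (by simp [histCarry]), o7 i hi]
  · have h1 : 1 ≤ B ^ r := Nat.one_le_pow _ _ hB0
    have h2 : B ^ r ≤ B ^ (r + 1) := Nat.pow_le_pow_right hB0 (by omega)
    have h3 : 1 ≤ 2 ^ r := Nat.one_le_two_pow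
    simp only [Expr.cost_mod, Expr.cost_mul, Expr.cost_var]
    generalize B ^ r = V at *
    generalize B ^ (r + 1) = V' at *
    generalize 2 ^ r = R at *
    have h4 : V' ≤ V' * R := Nat.le_mul_of_pos_right _ h3
    have h5 : r * V' ≤ r * (V' * R) := Nat.mul_le_mul_left _ h4
    have h6 : R ≤ V' * R := Nat.le_mul_of_pos_left _ (by omega)
    have h7 : r * R ≤ r * (V' * R) := Nat.mul_le_mul_left _ h6
    have h8 : n * 1 ≤ n * R := Nat.mul_le_mul_left _ h3
    have h9 : n * r * 1 ≤ n * r * R := Nat.mul_le_mul_left _ h3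
    ring_nf at h4 h5 h6 h7 h8 h9 ⊢
    omega

end WordRAM

namespace WordRAM

/-! ### Greedy selection of the moduli -/

/-- The moduli with index at least `t` are replaced by `1`. -/
def cut (P : ℕ → ℕ) (t : ℕ) : ℕ → ℕ := fun j => if j < t then P j else 1

/-- Modulus number `t` is at most `g`, and no other choice of it yields fewer coincidences
of hash codes, if the later moduli are `1`. -/
def GreedyAt (n r B g : ℕ) (A P : ℕ → ℕ) (t : ℕ) : Prop :=
  1 ≤ P t ∧ P t ≤ g ∧ ∀ p, 1 ≤ p → p ≤ g →
    tripleCount n r B (cut P (t + 1)) A ≤ tripleCount n r B (Function.update (cut P t) t p) A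

theorem cut_succ (P : ℕ → ℕ) (t : ℕ) : cut P (t + 1) = Function.update (cut P t) t (P t) := by
  funext j
  by_cases h : j = t
  · simp [cut, h]
  · simp only [cut, ne_eq, h, not_false_eq_true, Function.update_of_ne]
    congr 1
    simp
    omega

theorem cut_congr {P P' : ℕ → ℕ} {t : ℕ} (h : ∀ j < t, P j = P' j) : cut P t = cut P' t := by
  funext j
  simp only [cut]
  split_ifs with hj
  · exact h j hj
  · rfl

theorem cut_update (P : ℕ → ℕ) (t p : ℕ) :
    cut (Function.update P t p) (t + 1) = Function.update (cut P t) t p := by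
  rw [cut_succ, Function.update_self, cut_congr fun j hj => Function.update_of_ne hj.ne p P]

theorem GreedyAt.congr {n r B g t : ℕ} {A P P' : ℕ → ℕ} (hP : GreedyAt n r B g A P t)
    (h : ∀ j ≤ t, P j = P' j) : GreedyAt n r B g A P' t := by
  simp only [GreedyAt]
  rw [← cut_congr (P := P) (t := t + 1) fun j hj => h j (by omega),
    ← cut_congr (P := P) (t := t) fun j hj => h j (by omega), ← h t le_rfl]
  exact hP

theorem tripleCount_le (n r B : ℕ) (P A : ℕ → ℕ) : tripleCount n r B P A ≤ 2 ^ r * n ^ 3 := by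
  have key {N b : ℕ} {f : ℕ → ℕ} (h : ∀ i, f i ≤ b) : ∑ i ∈ Finset.range N, f i ≤ N * b := by
    simpa using Finset.sum_le_card_nsmul (Finset.range N) f b fun i _ => h i
  refine (key fun s => key fun i => key fun j => key (b := 1) fun k => ?_).trans
    (le_of_eq (by ring))
  split_ifs <;> omega

theorem hashCode_congr {B r : ℕ} {P P' : ℕ → ℕ} (h : ∀ j < r, P j = P' j) (a : ℕ) :
    hashCode B r P a = hashCode B r P' a :=
  Finset.sum_congr rfl fun j hj => by rw [h j (Finset.mem_range.1 hj)]

theorem carryCode_congr {B r : ℕ} {P P' : ℕ → ℕ} (h : ∀ j < r, P j = P' j) (s : ℕ) :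
    carryCode B r P s = carryCode B r P' s :=
  Finset.sum_congr rfl fun j hj => by rw [h j (Finset.mem_range.1 hj)]

theorem tripleCount_congr {n r B : ℕ} {P P' A : ℕ → ℕ} (h : ∀ j < r, P j = P' j) :
    tripleCount n r B P A = tripleCount n r B P' A := by
  simp only [tripleCount, hashCode_congr h, carryCode_congr h]

/-- Find the best modulus number `a1`. -/
def selectOne (r : ℕ) : Prog :=
  asg .best Var.Q ;; asg .bp 1 ;; forLoop .a2 Var.g (sto .P Var.a1 (Var.a2 + 1) ;;
    countTriples r ;; cond (Expr.lt Var.S Var.best) (asg .best Var.S ;; asg .bp (Var.a2 + 1))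
        .skip) ;;
  sto .P Var.a1 Var.bp

/-- Choose all moduli, one after the other, and count the coincidences of hash codes. -/
def selectAll (r : ℕ) : Prog :=
  forLoop .x (.num r) (sto .P Var.x 1) ;; forLoop .a1 (.num r) (selectOne r) ;; countTriples r

/-- All parameters are computed, and the input is the list `A 0, …, A (n - 1)`. -/
structure Ready (r e n : ℕ) (A : ℕ → ℕ) (σ : NSt) : Prop where
  params : Params r e σ
  n_eq : σ.r .n = n
  inp_eq : ∀ i < n, σ.m .inp i = A i

theorem Ready.of_agree {r e n : ℕ} {A : ℕ → ℕ} {p : Prog} {σ σ' : NSt} (h : Ready r e n A σ)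
    (ha : Agree p σ σ')
    (hv : ∀ v ∈ ([.n, .g, .q, .B, .Q, .L, .V, .inv] : List Var), p.keepsVar v = true)
    (hm : ∀ a ∈ ([.inp, .pw1, .pw2] : List Arr), p.keepsArr a = true) : Ready r e n A σ' := by
  simp only [List.forall_mem_cons, List.not_mem_nil, IsEmpty.forall_iff, implies_true,
    and_true] at hv hm
  obtain ⟨v1, v2, v3, v4, v5, v6, v7, v8⟩ := hv
  obtain ⟨m1, m2, m3⟩ := hm
  have e1 := ha.var _ v1
  have e2 := ha.var _ v2
  have e3 := ha.var _ v3
  have e4 := ha.var _ v4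
  have e5 := ha.var _ v5
  have e6 := ha.var _ v6
  have e7 := ha.var _ v7
  have e8 := ha.var _ v8
  obtain ⟨⟨h1, h2, h3, h4, h5, h6, h7, h8, h9, h10⟩, hn, hA⟩ := h
  refine ⟨⟨?_, ?_, ?_, ?_, ?_, ?_, ?_, ?_, ?_, ?_⟩, ?_, ?_⟩
  · rwa [e2]
  · rwa [e2, e3]
  · rwa [e2, e3]
  · rwa [e3, e4]
  · rwa [e3, e5]
  · rwa [e4, e6]
  · rwa [e4, e7]
  · rwa [e5, e8]
  · rwa [e4, e5, e8]
  · rwa [e4, e5, ha.arr _ m2, ha.arr _ m3]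
  · rwa [e1]
  · rwa [ha.arr _ m1]

/-- A bound for the running time of `countTriples`. -/
def countTime (n r B : ℕ) : ℕ := n * 2 ^ r * (r + 1) * 200 + (r + 1) * 2 ^ r * 1000 * B ^ (r + 1)

@[simp] theorem keepsVar_countTriples {r : ℕ} {v : Var} :
    v ∉ countVars → (countTriples r).keepsVar v = true := countTriples_keepsVar

theorem selectOne_keepsVar {r : ℕ} {v : Var} (hv : v ∉ countVars)
    (hv' : v ∉ ([.best, .bp, .a2] : List Var)) : (selectOne r).keepsVar v = true := by
  simp only [List.mem_cons, List.not_mem_nil, or_false, not_or] at hv'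
  simp [selectOne, hv', countTriples_keepsVar hv]

theorem selectOne_keepsArr {r : ℕ} {a : Arr} (ha : a ∉ countArrs) (ha' : a ≠ .P) :
    (selectOne r).keepsArr a = true := by
  simp [selectOne, ha', countTriples_keepsArr ha]

theorem selectAll_keepsVar {r : ℕ} {v : Var} (hv : v ∉ countVars)
    (hv' : v ∉ ([.best, .bp, .a1, .a2] : List Var)) : (selectAll r).keepsVar v = true := by
  have h1 : v ≠ .x := fun h => hv (by simp [h, countVars])
  simp only [List.mem_cons, List.not_mem_nil, or_false, not_or] at hv'
  simp [selectAll, hv', countTriples_keepsVar hv, selectOne_keepsVar hv, h1]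

theorem selectAll_keepsArr {r : ℕ} {a : Arr} (ha : a ∉ countArrs) (ha' : a ≠ .P) :
    (selectAll r).keepsArr a = true := by
  simp [selectAll, ha', countTriples_keepsArr ha, selectOne_keepsArr ha ha']

variable {w : ℕ} [NeZero w]

theorem Ready.tr_countTriples {σ : NSt} {n r e g B : ℕ} {A P : ℕ → ℕ} (h : Ready r e n A σ)
    (hg : σ.r .g = g) (hB : σ.r .B = B) (hr : 0 < r) (he : 0 < e) (hW : σ.r .Q * σ.r .Q < 2 ^ w)
    (hVW : σ.r .V < 2 ^ w) (hrW : 2 ^ r < 2 ^ w) (hS : 2 ^ r * n ^ 3 < σ.r .Q)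
    (hP : ∀ j < r, σ.m .P j = P j) (hPg : ∀ j < r, 1 ≤ P j ∧ P j ≤ g) :
    Tr w (countTriples r) σ (countTime n r B) fun σ' =>
      σ'.r .S = tripleCount n r B P A ∧ (∀ i < n, σ'.m .code i = hashCode B r P (A i)) ∧
        ∀ s < 2 ^ r, σ'.m .off s = carryCode B r P s := by
  subst hB
  refine WordRAM.tr_countTriples h.params hr he h.n_eq h.inp_eq hP (fun j hj => ?_) hW hVW hrW
    ((tripleCount_le ..).trans_lt hS)
  have h1 := h.params.q_ge
  have h2 := h.params.B_eq
  have h3 := hPg j hj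
  omega

/-- Derandomization by exact evaluation: for each candidate, the number of coincidences is computed
with all later moduli equal to `1`, which impose no condition. The loop index starts at `0`, so
iteration `i` tests the modulus `i + 1`. -/
theorem tr_selectOne {σ : NSt} {n r e g B t : ℕ} {A P : ℕ → ℕ} (h : Ready r e n A σ)
    (hg : σ.r .g = g) (hB : σ.r .B = B) (hr : t < r) (he : 0 < e) (hW : σ.r .Q * σ.r .Q < 2 ^ w)
    (hVW : σ.r .V < 2 ^ w) (hrW : 2 ^ r < 2 ^ w) (hS : 2 ^ r * n ^ 3 < σ.r .Q) (ht : σ.r .a1 = t)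
    (hP : ∀ j < r, σ.m .P j = cut P t j) (hPg : ∀ j < t, 1 ≤ P j ∧ P j ≤ g) :
    Tr w (selectOne r) σ (g * (countTime n r B + 30) + 20) fun σ' => ∃ p,
      (∀ j < r, σ'.m .P j = cut (Function.update P t p) (t + 1) j) ∧
        GreedyAt n r B g A (Function.update P t p) t := by
  set f : ℕ → ℕ := fun p => tripleCount n r B (Function.update (cut P t) t p) A with hf
  have hg1 : 1 ≤ g := hg ▸ h.params.one_le_g
  have hQW : σ.r .Q < 2 ^ w := by
    have : σ.r .Q ≤ σ.r .Q * σ.r .Q := Nat.le_mul_of_pos_left _ (by omega)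
    omega
  have hgQ : g < σ.r .Q := by
    rw [h.params.Q_eq, ← hg]
    have h1 := h.params.q_ge
    have h2 := Nat.le_self_pow he.ne' (σ.r .q)
    omega
  have hrt : t < 2 ^ w := by
    have := Nat.lt_two_pow_self (n := r)
    omega
  refine (Tr.asg_seq (by simp) (Tr.asg_seq (by simp [NeZero.ne w]) ((Tr.forLoop_const (N := g)
    (c := countTime n r B + 20) (I := fun i σ' => (∀ j < r, j ≠ t → σ'.m .P j = cut P t j) ∧
      1 ≤ σ'.r .bp ∧ σ'.r .bp ≤ g ∧ (∀ p, 1 ≤ p → p ≤ i → σ'.r .best ≤ f p) ∧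
      (σ'.r .best = if i = 0 then σ.r .Q else f (σ'.r .bp)))
    ?_ (by simp [countVars]) ?_ ?_).seq (T₂ := 3)
      fun σ1 h1 hI1 => ?_))).time ?_
  · intro σ' h'
    rw [Expr.eval_var, h'.var .g (by simp [countVars])]
    simp [hg]
  · refine ⟨fun j hj _ => by simpa using hP j hj, by simp, by simpa using hg1, fun p h1 h2 => ?_,
      by simp⟩
    omega
  · intro i hi σ1 h1 hi1 ⟨I1, I2, I3, I4, I5⟩
    have hR : Ready r e n A σ1 := (h.of_agree (p := selectOne r)
      (σ' := (σ.set .best (σ.r .Q)).set .bp 1) ⟨fun v hv => ?_, fun v hv => rfl⟩ (by simp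
          [selectOne, countVars])
        (by simp [selectOne, countTriples_keepsArr, countArrs])).of_agree h1
        (by simp [countVars])
        (by simp [countTriples_keepsArr, countArrs])
    · have eQ : σ1.r .Q = σ.r .Q := by
        rw [h1.var .Q (by simp [countVars])]; simp
      have eV : σ1.r .V = σ.r .V := by
        rw [h1.var .V (by simp [countVars])]; simp
      have eB : σ1.r .B = B := by
        rw [h1.var .B (by simp [countVars])]; simp [hB]
      have eg : σ1.r .g = g := by
        rw [h1.var .g (by simp [countVars])]; simp [hg]
      have ea : σ1.r .a1 = t := by
        rw [h1.var .a1 (by simp [countVars])]; simp [ht]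
      refine (Tr.sto_seq (by simp) (by simp [NeZero.ne w, hi1]; omega) (Tr.seq
        (T₂ := 15) (Ready.tr_countTriples (n := n) (e := e) (A := A) (B := B) (g := g)
          (P := Function.update (cut P t) t (i + 1))
          (hR.of_agree (p := selectOne r) ⟨fun v hv => rfl, fun a ha => ?_⟩
            (by simp [selectOne, countVars])
            (by simp [selectOne, countTriples_keepsArr, countArrs])) (by simp [eg])
            (by simp [eB]) (by omega) he (by simpa [eQ] using hW) (by simpa [eV] using hVW) hrW
            (by simpa [eQ] using hS) ?_ ?_)
          fun σ2 h2 hI2 => (Tr.cond (T := 8) (by simp) ?_ ?_).time (by simp))).time ?_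
      · have : a ≠ .P := by
          rintro rfl
          simp [selectOne] at ha
        simp [this]
      · intro j hj
        by_cases hjt : j = t
        · simp [ea, hi1, hjt]
        · simp [ea, hjt, I1 j hj hjt]
      · intro j hj
        by_cases hjt : j = t
        · subst hjt
          simp
          omega
        · simp only [ne_eq, hjt, not_false_eq_true, Function.update_of_ne, cut]
          split_ifs with hj'
          · exact hPg j hj'
          · omega
      all_goals try
        have eP : ∀ j < r, j ≠ t → σ2.m .P j = cut P t j := by
          intro j hj hjt
          rw [h2.arr .P (by simp [countTriples_keepsArr, countArrs])]
          simp [ea, hjt, I1 j hj hjt]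
        have ebp : σ2.r .bp = σ1.r .bp := by
          rw [h2.var .bp (by simp [countVars])]; simp
        have ebest : σ2.r .best = σ1.r .best := by
          rw [h2.var .best (by simp [countVars])]; simp
        have ea2 : σ2.r .a2 = i := by
          rw [h2.var .a2 (by simp [countVars])]; simp [hi1]
        have eS : σ2.r .S = f (i + 1) := hI2.1
      · intro h3
        have h3' : f (i + 1) < σ1.r .best := by simpa [eS, ebest] using h3
        refine (Tr.asg_seq (by simp) (Tr.asg (by simp [NeZero.ne w, ea2]; omega)
          ⟨?_, ?_, ?_, ?_, ?_⟩)).time (by simp)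
        · simpa using eP
        · simp
        · simp [ea2]; omega
        · intro p hp1 hp2
          simp only [ne_eq, reduceCtorEq, not_false_eq_true, NSt.set_r_of_ne, NSt.set_r_same,
            Expr.eval_var, eS]
          rcases Nat.lt_or_ge i p with hp | hp
          · have : p = i + 1 := by omega
            rw [this]
          · exact h3'.le.trans (I4 p hp1 hp)
        · simp [eS, ea2]
      · intro h3
        have h3' : σ1.r .best ≤ f (i + 1) := by simpa [eS, ebest] using h3
        refine (Tr.skip ⟨?_, ?_, ?_, ?_, ?_⟩).time (by omega)
        · simpa using eP
        · simpa [ebp] using I2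
        · simpa [ebp] using I3
        · intro p hp1 hp2
          simp only [ne_eq, reduceCtorEq, not_false_eq_true, NSt.set_r_of_ne, ebest]
          rcases Nat.lt_or_ge i p with hp | hp
          · have : p = i + 1 := by omega
            rw [this]
            exact h3'
          · exact I4 p hp1 hp
        -- The first candidate cannot be rejected: `best` starts at `Q`, which exceeds every
        -- possible count. So the initial value of `bp` never matters.
        · rcases Nat.eq_zero_or_pos i with rfl | hi0
          · simp only [if_pos] at I5
            have := tripleCount_le n r B (Function.update (cut P t) t (0 + 1)) A
            simp only [hf] at h3'
            omega
          · simp only [ne_eq, reduceCtorEq, not_false_eq_true, NSt.set_r_of_ne, ebest, ebp]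
            rw [I5]
            simp [hi0.ne']
      · simp
        omega
    · have : v ≠ .best ∧ v ≠ .bp := by
        constructor <;> rintro rfl <;> simp [selectOne] at hv
      simp [this]
  · obtain ⟨I1, I2, I3, I4, I5⟩ := hI1
    rw [if_neg (by omega)] at I5
    have ea : σ1.r .a1 = t := by
      rw [h1.var .a1 (by simp [countVars])]; simp [ht]
    refine (Tr.sto (by simp) (by simp) ⟨σ1.r .bp, ?_, ?_⟩).time (by simp)
    · intro j hj
      rw [cut_update]
      by_cases hjt : j = t
      · simp [hjt, ea]
      · simp [hjt, ea, I1 j hj hjt]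
    · refine ⟨by simpa using I2, by simpa using I3, fun p h2 h3 => ?_⟩
      rw [cut_update, cut_congr fun j hj => Function.update_of_ne hj.ne _ P]
      have := I4 p h2 h3
      rw [I5] at this
      exact this
  · simp
    ring_nf
    omega

/-- The count is repeated after the selection because the codes left in memory belong to the last
candidate that was tried, not to the one that was chosen. -/
theorem tr_selectAll {σ : NSt} {n r e g B : ℕ} {A : ℕ → ℕ} (h : Ready r e n A σ)
    (hg : σ.r .g = g) (hB : σ.r .B = B) (hr : 0 < r) (he : 0 < e) (hW : σ.r .Q * σ.r .Q < 2 ^ w)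
    (hVW : σ.r .V < 2 ^ w) (hrW : 2 ^ r < 2 ^ w) (hS : 2 ^ r * n ^ 3 < σ.r .Q) :
    Tr w (selectAll r) σ ((r + 1) * g * (countTime n r B + 100)) fun σ' => ∃ P : ℕ → ℕ,
      (∀ t < r, GreedyAt n r B g A P t) ∧ σ'.r .S = tripleCount n r B P A ∧
        (∀ i < n, σ'.m .code i = hashCode B r P (A i)) ∧
          ∀ s < 2 ^ r, σ'.m .off s = carryCode B r P s := by
  have hg1 : 1 ≤ g := hg ▸ h.params.one_le_g
  have hrW' : r < 2 ^ w := Nat.lt_two_pow_self.trans hrW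
  apply Tr.time
  · apply Tr.seq (Tr.forLoop_const (N := r) (c := 10) (I := fun i σ' => ∀ j < i, σ'.m .P j = 1)
      ?_ (by simp) (by simp) ?_)
    · intro σ1 h1 hI1
      have R1 : Ready r e n A σ1 := h.of_agree h1 (by simp) (by simp)
      have eQ1 : σ1.r .Q = σ.r .Q := h1.var .Q (by simp)
      have eV1 : σ1.r .V = σ.r .V := h1.var .V (by simp)
      have eB1 : σ1.r .B = B := (h1.var .B (by simp)).trans hB
      have eg1 : σ1.r .g = g := (h1.var .g (by simp)).trans hg
      have kv {v : Var} (h1 : v ∉ countVars) (h2 : v ∉ ([.best, .bp, .a1, .a2] : List Var)) :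
          (forLoop .a1 (.num r) (selectOne r)).keepsVar v = true := by
        simp only [List.mem_cons, List.not_mem_nil, or_false, not_or] at h2
        simp [selectOne_keepsVar h1, h2]
      have R {τ : NSt} (a : Agree (forLoop .a1 (.num r) (selectOne r)) σ1 τ) : Ready r e n A τ ∧
          τ.r .Q = σ.r .Q ∧ τ.r .V = σ.r .V ∧ τ.r .B = B ∧ τ.r .g = g := by
        refine ⟨R1.of_agree a ?_ ?_, ?_, ?_, ?_, ?_⟩
        · simp [selectOne_keepsVar, countVars]
        · simp [selectOne_keepsArr, countArrs]
        all_goals rw [a.var _ (kv (by decide) (by decide))]; assumption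
      apply Tr.seq (Tr.forLoop_const (N := r) (c := g * (countTime n r B + 30) + 20)
        (I := fun t σ' => ∃ P : ℕ → ℕ, (∀ j < r, σ'.m .P j = cut P t j) ∧
          ∀ j < t, GreedyAt n r B g A P j) ?_ ?_ ?_ ?_)
      · intro σ2 h2 ⟨P, hI2, hI3⟩
        obtain ⟨R2, eQ2, eV2, eB2, eg2⟩ := R h2
        refine (R2.tr_countTriples (P := P) eg2 eB2 hr he (by rwa [eQ2]) (by rwa [eV2]) hrW
          (by rwa [eQ2]) (fun j hj => by rw [hI2 j hj, cut, if_pos hj])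
          fun j hj => ⟨(hI3 j hj).1, (hI3 j hj).2.1⟩).post fun σ3 _ h3 => ⟨P, hI3, h3⟩
      · intro σ' _
        simp [hrW']
      · exact selectOne_keepsVar (by decide) (by decide)
      · refine ⟨fun _ => 1, fun j hj => ?_, by simp⟩
        simpa [cut] using hI1 j hj
      · intro t ht σ2 h2 ht2 ⟨P, hI2, hI3⟩
        obtain ⟨R2, eQ2, eV2, eB2, eg2⟩ := R h2
        refine (tr_selectOne (P := P) R2 eg2 eB2 ht he (by rwa [eQ2]) (by rwa [eV2]) hrW
          (by rwa [eQ2]) ht2 hI2 fun j hj => ⟨(hI3 j hj).1, (hI3 j hj).2.1⟩).post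
          fun σ3 _ ⟨p, h3, h4⟩ => ⟨Function.update P t p, by simpa using h3, fun j hj => ?_⟩
        rcases Nat.lt_or_ge j t with hj' | hj'
        · exact (hI3 j hj').congr fun i hi => (Function.update_of_ne (by omega) _ _).symm
        · rwa [show j = t by omega]
    · intro σ' _
      simp [hrW']
    · intro i hi σ' h' hi' hI
      refine (Tr.sto (by simp) (by simp [NeZero.ne w]) fun j hj => ?_).time (by simp)
      rcases Nat.lt_or_ge j i with hj' | hj'
      · simp [hi', hI j hj']
      · simp [hi', show j = i by omega]
  · have h1 : r * 1 ≤ r * g := Nat.mul_le_mul_left _ hg1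
    have h2 : countTime n r B * 1 ≤ countTime n r B * g := Nat.mul_le_mul_left _ hg1
    simp only [Expr.cost_num]
    ring_nf at h1 h2 ⊢
    omega

end WordRAM

namespace WordRAM

/-! ### The number of coincidences after the greedy selection -/

/-- Since each modulus is at most `B / 2`, neither side of the equation between codes has a carry in
base `B`, so it can be read off digit by digit. -/
theorem hashCode_add_eq_iff {B r : ℕ} {P : ℕ → ℕ} (h : Moduli B r P) (a b c s : ℕ) :
    hashCode B r P a + hashCode B r P b = hashCode B r P c + carryCode B r P s ↔
      ∀ l < r, a % P l + b % P l = c % P l + s / 2 ^ l % 2 * P l := by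
  have hdig (a : ℕ) : ∀ l < r, dig B (hashCode B r P a) l = a % P l := fun l hl =>
    dig_digitSum (fun j hj => by have := h.digit_lt a 0 j hj; omega) hl
  have hdig' (s : ℕ) : ∀ l < r, dig B (hashCode B r P c + carryCode B r P s) l =
      c % P l + s / 2 ^ l % 2 * P l := by
    intro l hl
    rw [hashCode_add_carryCode]
    exact dig_digitSum (h.digit_lt c s) hl
  rw [add_eq_iff_dig (h.hashCode_lt a) (h.hashCode_lt b) (h.hashCode_add_lt c s)]
  · refine forall₂_congr fun l hl => ?_
    rw [hdig a l hl, hdig b l hl, hdig' s l hl]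
  · intro l hl
    rw [hdig a l hl, hdig b l hl]
    obtain ⟨h1, h2⟩ := h l hl
    have := Nat.mod_lt a h1
    have := Nat.mod_lt b h1
    omega

theorem modEq_of_hashCode_add_eq {B r : ℕ} {P : ℕ → ℕ} (h : Moduli B r P) {a b c s : ℕ}
    (he : hashCode B r P a + hashCode B r P b = hashCode B r P c + carryCode B r P s) :
    ∀ l < r, a + b ≡ c [MOD P l] := by
  intro l hl
  have := (hashCode_add_eq_iff h a b c s).1 he l hl
  rw [Nat.ModEq, Nat.add_mod, this, Nat.add_mul_mod_self_right, Nat.mod_mod]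

/-- The sum of two residues is the residue of the sum, or exceeds it by one modulus. The binary
digits of `s` record which case occurs for which modulus. -/
theorem exists_hashCode_add_eq {B r : ℕ} {P : ℕ → ℕ} (h : Moduli B r P) {a b c : ℕ}
    (he : ∀ l < r, a + b ≡ c [MOD P l]) : ∃ s < 2 ^ r,
      hashCode B r P a + hashCode B r P b = hashCode B r P c + carryCode B r P s := by
  set d : ℕ → ℕ := fun l => if a % P l + b % P l < P l then 0 else 1 with hd
  have hd2 : ∀ l < r, d l < 2 := by
    intro l _
    simp only [hd]
    split_ifs <;> omega
  refine ⟨_, digitSum_lt r hd2, (hashCode_add_eq_iff h a b c _).2 fun l hl => ?_⟩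
  have h1 := dig_digitSum hd2 hl
  rw [dig] at h1
  rw [h1]
  obtain ⟨h2, -⟩ := h l hl
  have h3 := Nat.mod_lt a h2
  have h4 := Nat.mod_lt b h2
  have h5 := he l hl
  rw [Nat.ModEq, Nat.add_mod] at h5
  simp only [hd]
  split_ifs with h6
  · rw [Nat.mod_eq_of_lt h6] at h5
    omega
  · rw [Nat.mod_eq_sub_mod (by omega), Nat.mod_eq_of_lt (by omega)] at h5
    omega

/-- The triples `(i, j, k)` such that `A j + A k` is congruent to `A i` modulo `P 0, …, P (r - 1)`.
-/
def congTriples (n r : ℕ) (P A : ℕ → ℕ) : Finset (ℕ × ℕ × ℕ) :=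
  {x ∈ Finset.range n ×ˢ Finset.range n ×ˢ Finset.range n |
    ∀ l < r, A x.2.1 + A x.2.2 ≡ A x.1 [MOD P l]}

theorem tripleCount_eq (n r B : ℕ) (P A : ℕ → ℕ) : tripleCount n r B P A =
    ∑ s ∈ Finset.range (2 ^ r),
      (Finset.card {x ∈ Finset.range n ×ˢ Finset.range n ×ˢ Finset.range n |
        hashCode B r P (A x.2.1) + hashCode B r P (A x.2.2) =
          hashCode B r P (A x.1) + carryCode B r P s}) := by
  simp only [tripleCount, Finset.card_filter, Finset.sum_product]

/-- A coincidence with any `s` implies all the congruences, whence the crude factor `2 ^ r`.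
Together with `card_le_tripleCount` this relates the computed quantity to congruences, for which the
averaging argument is carried out. -/
theorem tripleCount_le_card {n r B : ℕ} {P A : ℕ → ℕ} (h : Moduli B r P) :
    tripleCount n r B P A ≤ 2 ^ r * (congTriples n r P A).card := by
  rw [tripleCount_eq]
  refine (Finset.sum_le_card_nsmul _ _ (congTriples n r P A).card fun s _ => ?_).trans
    (by simp)
  refine Finset.card_le_card fun x hx => ?_
  simp only [congTriples, Finset.mem_filter] at hx ⊢
  exact ⟨hx.1, modEq_of_hashCode_add_eq h hx.2⟩

theorem card_le_tripleCount {n r B : ℕ} {P A : ℕ → ℕ} (h : Moduli B r P) :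
    (congTriples n r P A).card ≤ tripleCount n r B P A := by
  rw [tripleCount_eq]
  refine (Finset.card_le_card fun x hx => ?_).trans Finset.card_biUnion_le
  simp only [congTriples, Finset.mem_filter, Finset.mem_biUnion, Finset.mem_range] at hx ⊢
  obtain ⟨s, hs, he⟩ := exists_hashCode_add_eq h hx.2
  exact ⟨s, hs, hx.1, he⟩

/-- Distinct prime divisors of `d` have a product that is at most `d`, and each of them is at least
`2`. -/
theorem card_primes_dvd_le {d D : ℕ} (hd : d ≠ 0) (hD : d ≤ D) (s : Finset ℕ)
    (hs : ∀ p ∈ s, p.Prime ∧ p ∣ d) : s.card ≤ Nat.log 2 D := by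
  refine Nat.le_log_of_pow_le (by norm_num) (le_trans ?_ hD)
  calc 2 ^ s.card ≤ ∏ p ∈ s, p := by
        rw [← Finset.prod_const]
        exact Finset.prod_le_prod' fun p hp => (hs p hp).1.two_le
    _ ≤ ∏ p ∈ d.primeFactors, p := by
        refine Finset.prod_le_prod_of_subset_of_one_le' (fun p hp => ?_) fun p hp _ =>
          (Nat.prime_of_mem_primeFactors hp).one_le
        exact Nat.mem_primeFactors.2 ⟨(hs p hp).1, (hs p hp).2, hd⟩
    _ ≤ d := Nat.le_of_dvd (by omega) (Nat.prod_primeFactors_dvd d)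

/-- Position `t` held the modulus `1`, whose congruence is void, so the new modulus adds exactly one
condition. -/
theorem congTriples_update {n r t p : ℕ} {P A : ℕ → ℕ} (ht : t < r) :
    congTriples n r (Function.update (cut P t) t p) A =
      {x ∈ congTriples n r (cut P t) A | A x.2.1 + A x.2.2 ≡ A x.1 [MOD p]} := by
  ext x
  simp only [congTriples, Finset.mem_filter, and_assoc, and_congr_right_iff]
  intro _
  constructor
  · intro h
    refine ⟨fun l hl => ?_, by simpa using h t ht⟩
    by_cases hlt : l = t
    · simp [cut, hlt, Nat.modEq_one]
    · simpa [hlt] using h l hl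
  · rintro ⟨h1, h2⟩ l hl
    by_cases hlt : l = t
    · simpa [hlt] using h2
    · simpa [hlt] using h1 l hl

theorem Moduli.cut {B r g t : ℕ} {P : ℕ → ℕ} (hB : 2 * g ≤ B) (hg : 1 ≤ g)
    (hP : ∀ j < t, 1 ≤ P j ∧ P j ≤ g) : Moduli B r (cut P t) := by
  intro j _
  simp only [WordRAM.cut]
  split_ifs with hj
  · have := hP j hj
    omega
  · omega

theorem Moduli.update {B r g t p : ℕ} {P : ℕ → ℕ} (h : Moduli B r P) (hB : 2 * g ≤ B) (h1 : 1 ≤ p)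
    (hp : p ≤ g) : Moduli B r (Function.update P t p) := by
  intro j hj
  by_cases hjt : j = t
  · subst hjt
    simp
    omega
  · simpa [hjt] using h j hj

/-- The greedy choice is at least as good as the average over the primes up to `g`. Double counting
pairs of a prime and a surviving triple, each triple is counted once for every prime divisor of `A j
+ A k - A i`. By `hA` this difference is nonzero, and it is at most `2 D` in absolute value, so
there are at most `log₂ (2 D)` such primes. -/
theorem primeCounting_mul_tripleCount_le {n r B g t D : ℕ} {P A : ℕ → ℕ} (hB : 2 * g ≤ B)
    (hg : 1 ≤ g) (ht : t < r) (hP : ∀ j < t, 1 ≤ P j ∧ P j ≤ g) (hgr : GreedyAt n r B g A P t)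
    (hA : ∀ i < n, ∀ j < n, ∀ k < n, A j + A k ≠ A i) (hD : ∀ i < n, A i ≤ D) :
    Nat.primeCounting g * tripleCount n r B (cut P (t + 1)) A ≤
      2 ^ r * Nat.log 2 (2 * D) * tripleCount n r B (cut P t) A := by
  set S := congTriples n r (cut P t) A with hS
  have hM : Moduli B r (cut P t) := .cut hB hg hP
  calc Nat.primeCounting g * tripleCount n r B (cut P (t + 1)) A
      = ∑ p ∈ g.primesLE, tripleCount n r B (cut P (t + 1)) A := by
        rw [Finset.sum_const, smul_eq_mul, Nat.primesLE_card_eq_primeCounting]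
    _ ≤ ∑ p ∈ g.primesLE, 2 ^ r *
          (Finset.card {x ∈ S | A x.2.1 + A x.2.2 ≡ A x.1 [MOD p]}) := by
        refine Finset.sum_le_sum fun p hp => ?_
        obtain ⟨hp1, hp2⟩ := Nat.mem_primesLE.1 hp
        have h1 : 1 ≤ p := hp2.one_le
        refine (hgr.2.2 p h1 hp1).trans ((tripleCount_le_card (hM.update hB h1 hp1)).trans ?_)
        rw [congTriples_update ht]
    _ = 2 ^ r * ∑ x ∈ S, (Finset.card {p ∈ g.primesLE | A x.2.1 + A x.2.2 ≡ A x.1 [MOD p]}) := by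
        rw [← Finset.mul_sum]
        congr 1
        exact Finset.sum_card_bipartiteAbove_eq_sum_card_bipartiteBelow
          (fun p (x : ℕ × ℕ × ℕ) => A x.2.1 + A x.2.2 ≡ A x.1 [MOD p])
    _ ≤ 2 ^ r * ∑ x ∈ S, Nat.log 2 (2 * D) := by
        refine Nat.mul_le_mul_left _ (Finset.sum_le_sum fun x hx => ?_)
        simp only [hS, congTriples, Finset.mem_filter, Finset.mem_product, Finset.mem_range] at hx
        obtain ⟨⟨h1, h2, h3⟩, -⟩ := hx
        have h4 := hA _ h1 _ h2 _ h3
        have h5 := hD _ h1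
        have h6 := hD _ h2
        have h7 := hD _ h3
        refine card_primes_dvd_le (d := Int.natAbs ((A x.1 : ℤ) - (A x.2.1 + A x.2.2 : ℕ)))
          (by omega) (by omega) _ fun p hp => ?_
        simp only [Finset.mem_filter] at hp
        exact ⟨(Nat.mem_primesLE.1 hp.1).2, Int.natCast_dvd.1 (Nat.modEq_iff_dvd.1 hp.2)⟩
    _ = 2 ^ r * Nat.log 2 (2 * D) * S.card := by
        rw [Finset.sum_const, smul_eq_mul]
        ring
    _ ≤ _ := Nat.mul_le_mul_left _ (card_le_tripleCount hM)

theorem primeCounting_pow_mul_tripleCount_le {n r B g D : ℕ} {P A : ℕ → ℕ} (hB : 2 * g ≤ B)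
    (hg : 1 ≤ g) (hgr : ∀ t < r, GreedyAt n r B g A P t)
    (hA : ∀ i < n, ∀ j < n, ∀ k < n, A j + A k ≠ A i) (hD : ∀ i < n, A i ≤ D) :
    Nat.primeCounting g ^ r * tripleCount n r B P A ≤
      (2 ^ r * Nat.log 2 (2 * D)) ^ r * (2 ^ r * n ^ 3) := by
  have key : ∀ t ≤ r, Nat.primeCounting g ^ t * tripleCount n r B (cut P t) A ≤
      (2 ^ r * Nat.log 2 (2 * D)) ^ t * (2 ^ r * n ^ 3) := by
    intro t
    induction t with
    | zero => simpa using tripleCount_le n r B (cut P 0) A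
    | succ t ih =>
      intro ht
      have h1 := primeCounting_mul_tripleCount_le hB hg ht
        (fun j hj => ⟨(hgr j (by omega)).1, (hgr j (by omega)).2.1⟩) (hgr t ht) hA hD
      calc _ = Nat.primeCounting g ^ t *
            (Nat.primeCounting g * tripleCount n r B (cut P (t + 1)) A) := by ring
        _ ≤ Nat.primeCounting g ^ t *
            (2 ^ r * Nat.log 2 (2 * D) * tripleCount n r B (cut P t) A) := Nat.mul_le_mul_left _ h1
        _ = 2 ^ r * Nat.log 2 (2 * D) *
            (Nat.primeCounting g ^ t * tripleCount n r B (cut P t) A) := by ring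
        _ ≤ _ := (Nat.mul_le_mul_left _ (ih (by omega))).trans_eq (by ring)
  rw [tripleCount_congr (P' := cut P r) fun j hj => by rw [cut, if_pos hj]]
  exact key r le_rfl

open Filter in
theorem eventually_log_le_rpow {δ b : ℝ} (hδ : 0 < δ) (hb : 0 < b) :
    ∀ᶠ g : ℕ in atTop, Real.log g ≤ b * (g : ℝ) ^ δ := by
  have h := ((isLittleO_log_rpow_atTop hδ).comp_tendsto
    (tendsto_natCast_atTop_atTop (R := ℝ))).bound hb
  filter_upwards [h, eventually_ge_atTop 1] with g hg h1
  have : (0 : ℝ) ≤ (g : ℝ) ^ δ := by positivity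
  simpa [Real.norm_of_nonneg this] using (le_abs_self _).trans hg

open Filter in
-- Chebyshev's lower bound of order `g / log g`, with the logarithm absorbed into `g ^ δ`.
theorem eventually_rpow_le_primeCounting {δ : ℝ} (hδ : 0 < δ) :
    ∀ᶠ g : ℕ in atTop, (g : ℝ) ^ (1 - δ) ≤ Nat.primeCounting g := by
  filter_upwards [eventually_log_le_rpow hδ (b := 1 / 8) (by norm_num),
    eventually_log_le_rpow one_pos (b := 1 / 8) (by norm_num), eventually_ge_atTop 2]
    with g h1 h2 hg
  have hg' : (2 : ℝ) ≤ g := by exact_mod_cast hg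
  have hlog : 0 < Real.log g := Real.log_pos (by linarith)
  refine le_trans ?_ (Chebyshev.pi_ge g)
  rw [le_div_iff₀ hlog]
  rw [Real.rpow_one] at h2
  have h3 : Real.log (g + 1) ≤ Real.log 2 + Real.log g := by
    rw [← Real.log_mul (by norm_num) (by linarith)]
    exact Real.log_le_log (by linarith) (by linarith)
  have h4 := Real.log_two_gt_d9
  have h5 : (g : ℝ) ^ (1 - δ) * Real.log g ≤ g / 8 := by
    calc _ ≤ (g : ℝ) ^ (1 - δ) * (1 / 8 * (g : ℝ) ^ δ) := by gcongr
      _ = (g : ℝ) ^ (1 - δ + δ) / 8 := by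
        rw [Real.rpow_add (by linarith)]
        ring
      _ = g / 8 := by simp
  nlinarith

open Filter in
/-- If the greedy selection guarantees `π(g) ^ r T ≤ (2 ^ r log₂ (2 n ^ c)) ^ r 2 ^ r n ^ 3`, then
`T` is at most a constant times `n ^ 3 / g ^ (r - 1)`. -/
theorem exists_le_mul_pow (K c : ℕ) (hK : 2 ≤ K) : ∃ Θ : ℕ, ∀ g n T : ℕ, 1 ≤ g → n < (g + 1) ^ K →
    1 ≤ n → T ≤ 2 ^ (2 * K - 3) * n ^ 3 →
    Nat.primeCounting g ^ (2 * K - 3) * T ≤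
      (2 ^ (2 * K - 3) * Nat.log 2 (2 * n ^ c)) ^ (2 * K - 3) * (2 ^ (2 * K - 3) * n ^ 3) →
    T ≤ Θ * g ^ (K + 4) := by
  obtain ⟨r, hr⟩ : ∃ r, r = 2 * K - 3 := ⟨_, rfl⟩
  rw [← hr]
  have hr0 : 0 < r := by omega
  -- Over `r` rounds, the logarithmic factors then cost at most `g ^ (1 / 2)`, and so does the loss
  -- of `π(g) ≥ g ^ (1 - δ)` against `g`. Together they cost a single factor `g`.
  set δ : ℝ := 1 / (2 * r) with hδ
  have hδ0 : 0 < δ := by positivity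
  have ev : ∀ᶠ g : ℕ in atTop, ((2 ^ r * (1 + K * c) * 2 : ℕ) : ℝ) * (1 + 2 * Real.log g) ≤
      (g : ℝ) ^ δ := by
    set C : ℝ := ((2 ^ r * (1 + K * c) * 2 : ℕ) : ℝ) with hC
    have hC0 : 0 < C := by
      rw [hC]
      exact_mod_cast (by positivity : 0 < 2 ^ r * (1 + K * c) * 2)
    filter_upwards [eventually_log_le_rpow hδ0 (b := 1 / (4 * C)) (by positivity),
      ((tendsto_rpow_atTop hδ0).comp (tendsto_natCast_atTop_atTop (R := ℝ))).eventually_ge_atTop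
        (2 * C)] with g h1 h2
    simp only [Function.comp] at h2
    have : C * Real.log g ≤ (g : ℝ) ^ δ / 4 := by
      calc _ ≤ C * (1 / (4 * C) * (g : ℝ) ^ δ) := by gcongr
        _ = _ := by field_simp
    linarith
  obtain ⟨G, hG⟩ := ((ev.and (eventually_rpow_le_primeCounting hδ0)).and
    (eventually_ge_atTop 2)).exists_forall_of_atTop
  -- The first summand settles `g < G` by the trivial bound on `T`, since `n` is then bounded; the
  -- second one comes from `n ≤ (2 g) ^ K` for large `g`.
  refine ⟨2 ^ r * (G + 1) ^ (K * 3) + 2 ^ r * 2 ^ (K * 3), fun g n T hg hn hn1 hT hT' => ?_⟩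
  rcases Nat.lt_or_ge g G with hgG | hgG
  · calc T ≤ 2 ^ r * n ^ 3 := hT
      _ ≤ 2 ^ r * ((G + 1) ^ K) ^ 3 := by
        gcongr
        exact hn.le.trans (Nat.pow_le_pow_left (by omega) _)
      _ = 2 ^ r * (G + 1) ^ (K * 3) * 1 := by rw [pow_mul, mul_one]
      _ ≤ _ := Nat.mul_le_mul (by omega) (Nat.one_le_pow _ _ hg)
  · obtain ⟨⟨h1, h2⟩, hg2⟩ := hG g hgG
    have hg0 : (0 : ℝ) < g := by exact_mod_cast hg
    have hn2 : n ≤ (2 * g) ^ K := hn.le.trans (Nat.pow_le_pow_left (by omega) _)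
    have hlog : ((2 ^ r * Nat.log 2 (2 * n ^ c) : ℕ) : ℝ) ≤ (g : ℝ) ^ δ := by
      refine le_trans ?_ h1
      have h3 : Nat.log 2 (2 * n ^ c) ≤ (1 + K * c) * (2 + Nat.log 2 g) := by
        have hlt : g < 2 ^ (Nat.log 2 g + 1) := Nat.lt_pow_succ_log_self (by norm_num) g
        have : 2 * n ^ c ≤ 2 ^ ((1 + K * c) * (2 + Nat.log 2 g)) := by
          calc 2 * n ^ c ≤ 2 * ((2 * g) ^ K) ^ c := by gcongr
            _ ≤ 2 * ((2 * 2 ^ (Nat.log 2 g + 1)) ^ K) ^ c := by gcongr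
            _ = 2 ^ (1 + (2 + Nat.log 2 g) * (K * c)) := by
              rw [← pow_succ', ← pow_mul, ← pow_mul, ← pow_succ']
              congr 1
              ring
            _ ≤ _ := Nat.pow_le_pow_right (by norm_num) (by ring_nf; omega)
        calc _ ≤ Nat.log 2 (2 ^ ((1 + K * c) * (2 + Nat.log 2 g))) := Nat.log_mono_right this
          _ = _ := Nat.log_pow (by norm_num) _
      have h4 : (Nat.log 2 g : ℝ) ≤ 2 * Real.log g := by
        have h5 : (Nat.log 2 g : ℝ) * Real.log 2 ≤ Real.log g := by
          rw [← Real.log_pow]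
          refine Real.log_le_log (by positivity) ?_
          exact_mod_cast Nat.pow_log_le_self 2 (by omega)
        have h6 := Real.log_two_gt_d9
        have h7 : (0 : ℝ) ≤ Nat.log 2 g := by positivity
        nlinarith
      calc ((2 ^ r * Nat.log 2 (2 * n ^ c) : ℕ) : ℝ)
          ≤ ((2 ^ r * ((1 + K * c) * (2 + Nat.log 2 g)) : ℕ) : ℝ) := by
            exact_mod_cast Nat.mul_le_mul_left _ h3
        _ = (2 ^ r * (1 + K * c) : ℝ) * (2 + Nat.log 2 g) := by push_cast; ring
        _ ≤ (2 ^ r * (1 + K * c) : ℝ) * (2 + 2 * Real.log g + 2 * Real.log g) := by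
            have h8 : 0 ≤ Real.log g := Real.log_nonneg (by exact_mod_cast hg)
            gcongr
            linarith
        _ = _ := by push_cast; ring
    have hgδ : ((g : ℝ) ^ δ) ^ r * ((g : ℝ) ^ δ) ^ r = g := by
      rw [← pow_add, ← Real.rpow_natCast, ← Real.rpow_mul hg0.le]
      have : δ * ((r + r : ℕ) : ℝ) = 1 := by
        rw [hδ]
        push_cast
        field_simp
        norm_num
      rw [this, Real.rpow_one]
    have hgδ' : (g : ℝ) ^ δ * (g : ℝ) ^ (1 - δ) = g := by
      rw [← Real.rpow_add hg0]
      simp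
    have hreal : (g : ℝ) ^ r * T ≤ g * (2 ^ r * n ^ 3) := by
      have hT'' : ((Nat.primeCounting g : ℝ) ^ r * T) ≤
          ((2 ^ r * Nat.log 2 (2 * n ^ c) : ℕ) : ℝ) ^ r * (2 ^ r * n ^ 3) := by
        exact_mod_cast hT'
      calc (g : ℝ) ^ r * T = ((g : ℝ) ^ δ) ^ r * (((g : ℝ) ^ (1 - δ)) ^ r * T) := by
            rw [← mul_assoc, ← mul_pow, hgδ']
        _ ≤ ((g : ℝ) ^ δ) ^ r * ((Nat.primeCounting g : ℝ) ^ r * T) := by gcongr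
        _ ≤ ((g : ℝ) ^ δ) ^ r * (((2 ^ r * Nat.log 2 (2 * n ^ c) : ℕ) : ℝ) ^ r *
              (2 ^ r * n ^ 3)) := by gcongr
        _ ≤ ((g : ℝ) ^ δ) ^ r * (((g : ℝ) ^ δ) ^ r * (2 ^ r * n ^ 3)) := by gcongr
        _ = g * (2 ^ r * n ^ 3) := by rw [← mul_assoc, hgδ]
    have hnat : g ^ r * T ≤ g * (2 ^ r * n ^ 3) := by exact_mod_cast hreal
    have hfin : g ^ r * T ≤ g ^ r * (2 ^ r * 2 ^ (K * 3) * g ^ (K + 4)) := by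
      calc _ ≤ g * (2 ^ r * ((2 * g) ^ K) ^ 3) := hnat.trans (by gcongr)
        _ = 2 ^ r * 2 ^ (K * 3) * (g ^ (K * 3 + 1)) := by ring
        -- With `r = 2 K - 3` the exponent `3 K + 1` splits in this way, which explains the exponent
        -- `K + 4` of the threshold.
        _ = 2 ^ r * 2 ^ (K * 3) * (g ^ (r + (K + 4))) := by
          congr 2
          omega
        _ = _ := by ring
    refine (Nat.le_of_mul_le_mul_left hfin (by positivity)).trans ?_
    exact Nat.mul_le_mul_right _ (by omega)

end WordRAM

namespace WordRAM

/-! ### Lists of the elements with a given hash code -/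

/-- For every number `v < V`, a linked list with the successors of the indices of all numbers whose
hash code is `v`, and its length. -/
def linkLists : Prog :=
  clear .num ;; forLoop .i Var.n (sto .nxt (Var.i + 1) (.get .head (.get .code Var.i)) ;;
    sto .head (.get .code Var.i) (Var.i + 1) ;;
    sto .num (.get .code Var.i) (.get .num (.get .code Var.i) + 1))

/-- The linked lists contain the successors of the indices `j < n`, ordered by hash code. -/
def Lists (n V : ℕ) (H : ℕ → ℕ) (σ : NSt) : Prop :=
  ∀ v < V, ∃ f : ℕ → ℕ, σ.m .head v = f 0 ∧
    (∀ k < σ.m .num v, 1 ≤ f k ∧ f k ≤ n ∧ H (f k - 1) = v ∧ σ.m .nxt (f k) = f (k + 1)) ∧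
    (∀ j < n, H j = v → ∃ k < σ.m .num v, f k = j + 1) ∧
    σ.m .num v = Finset.card {j ∈ Finset.range n | H j = v}

/-- Prepending an element shifts the enumeration `f` of its list by one. A list ends where its
length says, not at an end marker, so only `num` has to be initialized. -/
theorem Lists.insert {n V : ℕ} {H : ℕ → ℕ} {σ : NSt} (h : Lists n V H σ) :
    Lists (n + 1) V H (((σ.put .nxt (n + 1) (σ.m .head (H n))).put .head (H n) (n + 1)).put
      .num (H n) (σ.m .num (H n) + 1)) := by
  intro v hv
  obtain ⟨f, h1, h2, h3, h4⟩ := h v hv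
  by_cases hvn : v = H n
  · subst hvn
    refine ⟨fun k => if k = 0 then n + 1 else f (k - 1), by simp, ?_, ?_, ?_⟩
    · intro k hk
      simp only [NSt.put_m_same, if_true] at hk
      rcases Nat.eq_zero_or_pos k with rfl | hk0
      · simp [h1]
      · obtain ⟨g1, g2, g3, g4⟩ := h2 (k - 1) (by omega)
        have hne : f (k - 1) ≠ n + 1 := by omega
        have e1 : k - 1 + 1 = k := by omega
        rw [e1] at g4
        simp only [hk0.ne', if_false, ne_eq, reduceCtorEq, not_false_eq_true, NSt.put_m_of_ne,
          NSt.put_m_same, hne, g4, g3, Nat.succ_ne_zero, Nat.add_sub_cancel, and_true]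
        omega
    · intro j hj hjv
      simp only [NSt.put_m_same, if_true]
      by_cases hjn : j = n
      · exact ⟨0, by omega, by simp [hjn]⟩
      · obtain ⟨k, hk, hk'⟩ := h3 j (by omega) hjv
        exact ⟨k + 1, by omega, by simpa using hk'⟩
    · rw [Finset.range_add_one, Finset.filter_insert, if_pos rfl, Finset.card_insert_of_notMem
        (by simp), ← h4]
      simp
  · have hvn' : H n ≠ v := fun h => hvn h.symm
    refine ⟨f, by simp [hvn, h1], ?_, ?_, ?_⟩
    · intro k hk
      simp only [NSt.put_m_same, hvn, if_false, ne_eq, reduceCtorEq, not_false_eq_true,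
        NSt.put_m_of_ne] at hk
      obtain ⟨g1, g2, g3, g4⟩ := h2 k hk
      have hne : f k ≠ n + 1 := by omega
      simp only [ne_eq, reduceCtorEq, not_false_eq_true, NSt.put_m_of_ne,
        NSt.put_m_same, hne, g4, g3, if_false]
      exact ⟨g1, by omega, trivial, trivial⟩
    · intro j hj hjv
      have hjn : j ≠ n := by
        rintro rfl
        exact hvn hjv.symm
      obtain ⟨k, hk, hk'⟩ := h3 j (by omega) hjv
      exact ⟨k, by simpa [hvn] using hk, hk'⟩
    · rw [Finset.range_add_one, Finset.filter_insert, if_neg hvn', ← h4]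
      simp [hvn]

/-- All data that are needed to search for solutions among the coincidences of hash codes. -/
structure Linked (n V gs R : ℕ) (A H O : ℕ → ℕ) (σ : NSt) : Prop where
  n_eq : σ.r .n = n
  V_eq : σ.r .V = V
  gs_eq : σ.r .gs = gs
  inp_eq : ∀ i < n, σ.m .inp i = A i
  code_eq : ∀ i < n, σ.m .code i = H i
  off_eq : ∀ s < R, σ.m .off s = O s
  lists : Lists n V H σ

theorem Linked.of_agree {n V gs R : ℕ} {A H O : ℕ → ℕ} {p : Prog} {σ σ' : NSt}
    (h : Linked n V gs R A H O σ) (ha : Agree p σ σ')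
    (hv : ∀ v ∈ ([.n, .V, .gs] : List Var), p.keepsVar v = true)
    (hm : ∀ a ∈ ([.inp, .code, .off, .head, .nxt, .num] : List Arr), p.keepsArr a = true) :
    Linked n V gs R A H O σ' := by
  simp only [List.forall_mem_cons, List.not_mem_nil, IsEmpty.forall_iff, implies_true,
    and_true] at hv hm
  obtain ⟨v1, v2, v3⟩ := hv
  obtain ⟨m1, m2, m3, m4, m5, m6⟩ := hm
  obtain ⟨h1, h2, h3, h4, h5, h6, h7⟩ := h
  refine ⟨?_, ?_, ?_, ?_, ?_, ?_, ?_⟩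
  · rwa [ha.var _ v1]
  · rwa [ha.var _ v2]
  · rwa [ha.var _ v3]
  · rwa [ha.arr _ m1]
  · rwa [ha.arr _ m2]
  · rwa [ha.arr _ m3]
  · simpa only [Lists, ha.arr _ m4, ha.arr _ m5, ha.arr _ m6] using h7

/-- The value `a` is replaced by `1` if the condition `C` holds. -/
def Flag (C : Prop) (a a' : ℕ) : Prop := (C → a' = 1) ∧ (¬ C → a' = a)

theorem Flag.or {C D : Prop} {a b c : ℕ} (h : Flag C a b) (h' : Flag D b c) : Flag (C ∨ D) a c := by
  by_cases hD : D
  · exact ⟨fun _ => h'.1 hD, fun hn => absurd (.inr hD) hn⟩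
  · refine ⟨fun hc => ?_, fun hn => ?_⟩
    · rw [h'.2 hD]
      exact h.1 (hc.resolve_right hD)
    · rw [h'.2 hD]
      exact h.2 fun hc => hn (.inl hc)

theorem Flag.congr {C D : Prop} {a b : ℕ} (h : Flag C a b) (hCD : C ↔ D) : Flag D a b := by
  rwa [← propext hCD]

theorem Flag.of_false {C : Prop} {a : ℕ} (h : ¬ C) : Flag C a a := ⟨fun hc => absurd hc h, fun _ =>
    rfl⟩

theorem Flag.exists_lt_succ {C : ℕ → Prop} {i a b c : ℕ} (h : Flag (∃ k < i, C k) a b)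
    (h' : Flag (C i) b c) : Flag (∃ k < i + 1, C k) a c := by
  refine (h.or h').congr ⟨?_, ?_⟩
  · rintro (⟨k, hk, hc⟩ | hc)
    · exact ⟨k, by omega, hc⟩
    · exact ⟨i, by omega, hc⟩
  · rintro ⟨k, hk, hc⟩
    rcases Nat.lt_or_ge k i with h1 | h1
    · exact .inl ⟨k, h1, hc⟩
    · obtain rfl : k = i := by omega
      exact .inr hc

/-- Set `ans` to `1` if there is a number with hash code `z` that, added to number `idx`, yields
number `i`. -/
def walk : Prog :=
  asg .x (.get .head Var.z) ;; forLoop .l (.get .num Var.z)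
    (cond (.eq (.get .inp Var.idx + .get .inp (Var.x - 1)) (.get .inp Var.i))
      (asg .ans 1) .skip ;;
    asg .x (.get .nxt Var.x))

/-- Set `ans` to `1` if number `i` is the sum of a number in group `a1` and another number, whose
hash codes add up to the hash code of number `i` plus carry code `k`. -/
def checkGroup : Prog :=
  forLoop .j Var.gs (asg .idx (Var.a1 * Var.gs + Var.j) ;;
    cond (Expr.lt Var.idx Var.n)
      (cond (Expr.lt (.get .code Var.i + .get .off Var.k) (.get .code Var.idx)) .skip
        (asg .z (.get .code Var.i + .get .off Var.k - .get .code Var.idx) ;; walk))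
      .skip)

variable {w : ℕ} [NeZero w]

theorem tr_linkLists {σ : NSt} {n V : ℕ} {H : ℕ → ℕ} (hn : σ.r .n = n) (hV : σ.r .V = V)
    (hH : ∀ i < n, σ.m .code i = H i) (hHV : ∀ i < n, H i < V) (hW : n < 2 ^ w) :
    Tr w linkLists σ (V * 11 + n * 40 + 20) fun σ' => Lists n V H σ' := by
  apply Tr.time
  · apply Tr.seq (tr_clear hV)
    intro σ1 h1 hI1
    apply Tr.forLoop_const (N := n) (c := 30) (I := fun i σ' => Lists i V H σ')
    · intro σ' h
      simp [h.var .n (by simp), h1.var .n (by simp [clear]), hn]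
    · simp
    · intro v hv
      have := hI1 v hv
      exact ⟨fun _ => σ1.m .head v, by simp, by simp [this], by simp, by simp [this]⟩
    · intro i hi σ' h hi' hI
      have ec : σ'.m .code i = H i := by
        rw [h.arr .code (by simp), h1.arr .code (by simp [clear]), hH i hi]
      refine (Tr.sto_seq (by simp [NeZero.ne w, hi']; omega) (by simp) (Tr.sto_seq (by simp)
        (by simp [NeZero.ne w, hi']; omega) (Tr.sto (by simp) ?_ ?_))).time (by simp)
      · obtain ⟨f, -, -, -, h5⟩ := hI (H i) (hHV i hi)
        have h6 : Finset.card {j ∈ Finset.range i | H j = H i} ≤ i :=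
          (Finset.card_filter_le _ _).trans (by simp)
        simp [NeZero.ne w, hi', ec]
        omega
      · have h8 := hI.insert
        simpa [hi', ec, Lists] using h8
  · simp
    omega

/-- The number of pairs of a number in group `u` and another number whose hash codes add up to the
hash code of number `i` plus carry code `s`. -/
def pairCount (n gs : ℕ) (H O : ℕ → ℕ) (u s i : ℕ) : ℕ := ∑ y ∈ Finset.range gs,
  if u * gs + y < n then
    Finset.card {j ∈ Finset.range n | H (u * gs + y) + H j = H i + O s} else 0

theorem tr_walk {σ : NSt} {n V gs R z idx i : ℕ} {A H O : ℕ → ℕ} (h : Linked n V gs R A H O σ)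
    (hz : σ.r .z = z) (hzV : z < V) (hx : σ.r .idx = idx) (hxn : idx < n) (hi : σ.r .i = i)
    (hin : i < n) (hA : ∀ i < n, ∀ j < n, A i + A j < 2 ^ w) :
    Tr w walk σ (Finset.card {j ∈ Finset.range n | H j = z} * 30 + 20) fun σ' =>
      Flag (∃ j < n, H j = z ∧ A idx + A j = A i) (σ.r .ans) (σ'.r .ans) := by
  obtain ⟨f, h1, h2, h3, h4⟩ := h.lists z hzV
  refine (Tr.asg_seq (by simp) ((Tr.forLoop_const (N := σ.m .num z) (c := 20)
    (I := fun k σ' => σ'.r .x = f k ∧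
      Flag (∃ l < k, A idx + A (f l - 1) = A i) (σ.r .ans) (σ'.r .ans)) ?_ (by simp) ?_ ?_).post
      fun σ' _ h5 => h5.2.congr ?_)).time ?_
  · intro σ' h5
    simp [h5.arr .num (by simp), h5.var .z (by simp), hz]
  · exact ⟨by simp [hz, h1], by simpa using Flag.of_false not_false⟩
  · intro k hk σ' h5 hk' ⟨I1, I2⟩
    obtain ⟨f1, f2, f3, f4⟩ := h2 k hk
    have e1 : σ'.m .inp = σ.m .inp := by rw [h5.arr .inp (by simp)]; simp
    have e2 : σ'.m .nxt = σ.m .nxt := by rw [h5.arr .nxt (by simp)]; simp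
    have e3 : σ'.r .idx = idx := by rw [h5.var .idx (by simp)]; simpa using hx
    have e4 : σ'.r .i = i := by rw [h5.var .i (by simp)]; simpa using hi
    have hfk : f k - 1 < n := by omega
    refine (Tr.seq (T₂ := 3) (Tr.cond (T := 3) (Q := fun σ'' => σ''.r .x = f k ∧
      Flag (∃ l < k + 1, A idx + A (f l - 1) = A i) (σ.r .ans) (σ''.r .ans)) ?_ ?_ ?_)
      fun σ'' h6 ⟨h7, h8⟩ => (Tr.asg (by simp) ?_).time (by simp)).time (by simp)
    · simp [NeZero.ne w, I1, e1, e3, f1, h.inp_eq _ hxn, h.inp_eq _ hfk, hA _ hxn _ hfk]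
    · intro h6
      refine (Tr.asg (by simp [NeZero.ne w]) ⟨by simpa using I1, ?_⟩).time (by simp)
      simp [I1, e1, e3, e4, h.inp_eq _ hxn, h.inp_eq _ hfk, h.inp_eq _ hin] at h6
      exact I2.exists_lt_succ ⟨fun _ => by simp, fun h => absurd h6 h⟩
    · intro h6
      refine (Tr.skip ⟨I1, ?_⟩).time (by simp)
      simp [I1, e1, e3, e4, h.inp_eq _ hxn, h.inp_eq _ hfk, h.inp_eq _ hin] at h6
      exact I2.exists_lt_succ (.of_false h6)
    · have e5 : σ''.m .nxt = σ.m .nxt := by rw [h6.arr .nxt (by simp), e2]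
      refine ⟨?_, by simpa using h8⟩
      simp [h7, e5, f4]
  · constructor
    · rintro ⟨l, hl, h6⟩
      obtain ⟨f1, f2, f3, f4⟩ := h2 l hl
      exact ⟨f l - 1, by omega, f3, h6⟩
    · rintro ⟨j, hj, h6, h7⟩
      obtain ⟨l, hl, h8⟩ := h3 j hj h6
      exact ⟨l, hl, by rwa [h8, Nat.add_sub_cancel]⟩
  · rw [h4]
    simp
    omega

/-- Each member of the group costs a constant, plus a walk through the list of the numbers with the
complementary code. The walks add up to `pairCount`, the number of coincidences in question. -/
theorem tr_checkGroup {σ : NSt} {n V gs R u s i : ℕ} {A H O : ℕ → ℕ}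
    (h : Linked n V gs R A H O σ) (hu : σ.r .a1 = u) (hs : σ.r .k = s) (hsR : s < R)
    (hi : σ.r .i = i) (hin : i < n) (hV : H i + O s < V) (hVW : V < 2 ^ w)
    (hgW : u * gs + gs < 2 ^ w) (hA : ∀ i < n, ∀ j < n, A i + A j < 2 ^ w) :
    Tr w checkGroup σ (gs * 80 + pairCount n gs H O u s i * 30 + 10) fun σ' =>
      Flag (∃ y < gs, u * gs + y < n ∧ ∃ j < n, H (u * gs + y) + H j = H i + O s ∧
        A (u * gs + y) + A j = A i) (σ.r .ans) (σ'.r .ans) := by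
  refine (Tr.forLoop (N := gs) (c := fun y => 70 + (if u * gs + y < n then
    Finset.card {j ∈ Finset.range n | H (u * gs + y) + H j = H i + O s} else 0) * 30)
    (I := fun y σ' => Flag (∃ y' < y, u * gs + y' < n ∧ ∃ j < n,
      H (u * gs + y') + H j = H i + O s ∧ A (u * gs + y') + A j = A i) (σ.r .ans) (σ'.r .ans))
    ?_ (by simp [walk]) ?_ ?_).time ?_
  · intro σ' h'
    simp [h'.var .gs (by simp [walk]), h.gs_eq]
  · simpa using Flag.of_false not_false
  · intro y hy σ' h' hy' hI
    have L' := h.of_agree h' (by simp [walk]) (by simp [walk])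
    have e1 : σ'.r .a1 = u := by rw [h'.var .a1 (by simp [walk]), hu]
    have e2 : σ'.r .k = s := by rw [h'.var .k (by simp [walk]), hs]
    have e3 : σ'.r .i = i := by rw [h'.var .i (by simp [walk]), hi]
    have l1 : u * gs + y < 2 ^ w := by omega
    have l2 : u * gs < 2 ^ w := by omega
    have q1 := L'.n_eq
    have q2 := L'.code_eq _ hin
    have q3 := L'.off_eq _ hsR
    have q4 := L'.gs_eq
    have l3 : H i + O s < 2 ^ w := by omega
    refine (Tr.asg_seq (by simp [e1, q4, hy', l1, l2]) (Tr.cond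
      (T := 50 + (if u * gs + y < n then Finset.card
        {j ∈ Finset.range n | H (u * gs + y) + H j = H i + O s} else 0) * 30) (by simp) ?_
            ?_)).time ?_
    · intro hx
      simp [e1, q4, hy', q1] at hx
      rw [if_pos hx]
      have q5 := L'.code_eq _ hx
      refine (Tr.cond (T := 35 + (Finset.card
        {j ∈ Finset.range n | H (u * gs + y) + H j = H i + O s}) * 30)
        (by simp [e2, e3, q2, q3, l3]) ?_ ?_).time (by simp; omega)
      -- If the code already exceeds the target, the subtraction would underflow, and no partner can
      -- exist.
      · intro hlt
        simp [e1, e2, e3, q2, q3, q4, q5, hy'] at hlt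
        refine (Tr.skip (hI.exists_lt_succ (.of_false ?_))).time (by omega)
        rintro ⟨-, j, hj, h1, -⟩
        omega
      · intro hlt
        simp [e1, e2, e3, q2, q3, q4, q5, hy'] at hlt
        have hset : ∀ j, H j = H i + O s - H (u * gs + y) ↔ H (u * gs + y) + H j = H i + O s := by
          intro j
          omega
        have hw := tr_walk (w := w) (σ := (σ'.set .idx (u * gs + y)).set .z
          (H i + O s - H (u * gs + y))) (z := H i + O s - H (u * gs + y)) (idx := u * gs + y)
          (i := i) ((L'.of_agree (p := checkGroup) ⟨fun v hv => ?_, fun a _ => rfl⟩ (by simp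
              [checkGroup, walk])
            (by simp [checkGroup, walk]))) (by simp) (by omega) (by simp) hx
          (by simp [e3]) hin hA
        · simp only [hset] at hw
          refine (Tr.asg_seq (T := Finset.card
            {j ∈ Finset.range n | H (u * gs + y) + H j = H i + O s} * 30 + 20)
            (by simp [e1, e2, e3, q2, q3, q4, q5, hy', l3, hlt]) ?_).time ?_
          · simp only [Expr.eval_sub, Expr.eval_add, Expr.eval_mul, Expr.eval_get, Expr.eval_var,
              NSt.set_r_same, ne_eq, reduceCtorEq, not_false_eq_true, NSt.set_r_of_ne, NSt.set_m,
              e1, e2, e3, q2, q3, q4, q5, hy']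
            refine hw.post fun σ'' _ hf => ?_
            simp only [ne_eq, reduceCtorEq, not_false_eq_true, NSt.set_r_of_ne] at hf ⊢
            exact hI.exists_lt_succ (hf.congr ⟨fun ⟨j, h1⟩ => ⟨hx, j, h1⟩, fun ⟨_, j, h1⟩ => ⟨j,
                h1⟩⟩)
          · simp
            omega
        · have h3 : v ≠ .idx ∧ v ≠ .z := by
            constructor <;> rintro rfl <;> simp [checkGroup] at hv
          simp [h3]
    · intro hx
      simp [e1, q4, hy', q1] at hx
      refine (Tr.skip (hI.exists_lt_succ (.of_false ?_))).time (by omega)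
      rintro ⟨h1, -⟩
      omega
    · simp
      omega
  · simp only [Finset.sum_add_distrib, pairCount, Finset.sum_mul, Finset.sum_const,
      Finset.card_range, smul_eq_mul]
    simp
    omega

end WordRAM

namespace WordRAM

/-! ### The instances of All-Numbers 3SUM -/

/-- Insert `val` into the list `oin[0], …, oin[cnt - 1]`, unless it is there. The positions of the
elements of the list are stored in `pos`; the entries of `pos` for other numbers are arbitrary. -/
def insertVal : Prog :=
  cond (Expr.lt (.get .pos Var.val) Var.cnt * Expr.eq (.get .oin (.get .pos Var.val)) Var.val) .skip
    (sto .pos Var.val Var.cnt ;; sto .oin Var.cnt Var.val ;; asg .cnt (Var.cnt + 1))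

/-- The list `oin` consists of the numbers with the property `p`, of which there are at
most `N`. -/
structure Listed (p : ℕ → Prop) (N : ℕ) (σ : NSt) : Prop where
  cnt_le : σ.r .cnt ≤ N
  prop : ∀ x < σ.r .cnt, p (σ.m .oin x)
  mem : ∀ v, p v → σ.m .pos v < σ.r .cnt ∧ σ.m .oin (σ.m .pos v) = v
  pos_oin : ∀ x < σ.r .cnt, σ.m .pos (σ.m .oin x) = x

theorem Listed.of_eq {p q : ℕ → Prop} {N : ℕ} {σ σ' : NSt} (h : Listed p N σ)
    (hpq : ∀ v, p v ↔ q v) (h1 : σ'.r .cnt = σ.r .cnt) (h2 : σ'.m .oin = σ.m .oin)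
    (h3 : σ'.m .pos = σ.m .pos) : Listed q N σ' := by
  obtain rfl : p = q := funext fun v => propext (hpq v)
  obtain ⟨a, b, c, d⟩ := h
  constructor
  · rwa [h1]
  · rwa [h1, h2]
  · rwa [h1, h2, h3]
  · rwa [h1, h2, h3]

theorem Listed.mono {p : ℕ → Prop} {N N' : ℕ} {σ : NSt} (h : Listed p N σ) (hN : N ≤ N') :
    Listed p N' σ := ⟨h.cnt_le.trans hN, h.prop, h.mem, h.pos_oin⟩

/-- The oracle decides for each of the `N` numbers in `oin` whether it is a sum of two of them. -/
structure SumOracle (w : ℕ) (O : Prog) (N T : ℕ) : Prop where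
  keepsVar : ∀ v, v ≠ .onum → O.keepsVar v = true
  keepsArr : ∀ a, a ≠ .oin → a ≠ .oout → O.keepsArr a = true
  tr : ∀ σ : NSt, σ.r .onum = N → (∀ x < N, 1 ≤ σ.m .oin x ∧ σ.m .oin x ≤ N ^ 2) →
    (∀ x < N, ∀ y < N, σ.m .oin x = σ.m .oin y → x = y) → Tr w O σ T fun σ' =>
      ∀ i < N, σ'.m .oout i ≠ 0 ↔ ∃ a < N, ∃ b < N, σ.m .oin a + σ.m .oin b = σ.m .oin i

/-- List the hash codes of the numbers in group `a1`, of all numbers, and of all possible sums, in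
three separate intervals. -/
def buildList (R : ℕ) : Prog :=
  asg .cnt 0 ;;
  forLoop .j Var.gs (asg .idx (Var.a1 * Var.gs + Var.j) ;; cond (Expr.lt Var.idx Var.n)
    (asg .val (Var.V + .get .code Var.idx) ;; insertVal) .skip) ;;
  forLoop .i Var.n (asg .val (3 * Var.V + .get .code Var.i) ;; insertVal) ;;
  forLoop .k (.num R) (forLoop .i Var.n
    (asg .val (4 * Var.V + (.get .code Var.i + .get .off Var.k)) ;; insertVal))

/-- Extend the list to length `M * n`, by large numbers. -/
def padList (M : ℕ) : Prog :=
  asg .onum (.num M * Var.n) ;; forLoop .x Var.onum (cond (Expr.lt Var.x Var.cnt) .skip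
    (sto .oin Var.x (5 * Var.V + Var.x)))

/-- Search for solutions that are consistent with the answers of the oracle. -/
def report (R : ℕ) : Prog :=
  forLoop .k (.num R) (forLoop .i Var.n
    (asg .val (4 * Var.V + (.get .code Var.i + .get .off Var.k)) ;;
      cond (.get .oout (.get .pos Var.val)) checkGroup .skip))

/-- Search for solutions that involve a number in group `a1`. -/
def processGroup (R M : ℕ) (O : Prog) : Prog := buildList R ;; padList M ;; O ;; report R

/-- Split the numbers into `g ^ 5` groups, and search for solutions in each of them. -/
def processAll (R M : ℕ) (O : Prog) : Prog :=
  asg .a3 (Var.g * Var.g * Var.g * Var.g * Var.g) ;; asg .gs (Var.n / Var.a3 + 1) ;;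
  linkLists ;; asg .ans 0 ;; forLoop .a1 Var.a3 (processGroup R M O)

/-- The numbers in the list that is built for group `u`. -/
def InList (n V gs R u : ℕ) (H O : ℕ → ℕ) (v : ℕ) : Prop :=
  ((∃ y < gs, u * gs + y < n ∧ v = V + H (u * gs + y)) ∨ ∃ i < n, v = 3 * V + H i) ∨
    ∃ s < R, ∃ i < n, v = 4 * V + (H i + O s)

variable {w : ℕ} [NeZero w]

/-- A sparse set: `v` is in the list exactly if `pos[v]` points to an occupied cell of `oin` that
contains `v`. This test is sound for arbitrary contents of `pos`, so nothing has to be cleared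
between groups; clearing of order `V` cells for each of `g ^ 5` groups would be too slow. The
product of the two comparisons serves as their conjunction. -/
theorem tr_insertVal {σ : NSt} {p : ℕ → Prop} {N v : ℕ} (h : Listed p N σ) (hv : σ.r .val = v)
    (hN : N + 1 < 2 ^ w) :
    Tr w insertVal σ 30 (Listed (fun x => p x ∨ x = v) (N + 1)) := by
  obtain ⟨h1, h2, h3, h4⟩ := h
  refine (Tr.cond (T := 15) ?_ ?_ ?_).time (by simp)
  · simp only [Expr.ok_mul, Expr.ok_lt, Expr.ok_get, Expr.ok_var, Expr.ok_eq, Expr.eval_lt,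
      Expr.eval_eq, true_and]
    split_ifs <;> omega
  · intro h5
    have h6 : σ.m .pos v < σ.r .cnt ∧ σ.m .oin (σ.m .pos v) = v := by
      simpa [hv, and_comm] using h5
    have hpv : p v := by
      rw [← h6.2]
      exact h2 _ h6.1
    refine (Tr.skip ⟨by omega, fun x hx => .inl (h2 x hx), ?_, h4⟩).time (by omega)
    rintro x (hx | rfl)
    · exact h3 x hx
    · exact h6
  · intro h5
    have h6 : ¬ (σ.m .pos v < σ.r .cnt ∧ σ.m .oin (σ.m .pos v) = v) := by
      rintro ⟨g1, g2⟩
      simp [hv, g1, g2] at h5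
    have hpv : ¬ p v := fun hp => h6 (h3 v hp)
    refine (Tr.sto_seq (by simp) (by simp) (Tr.sto_seq (by simp) (by simp)
      (Tr.asg (by simp [NeZero.ne w]; omega) ⟨?_, ?_, ?_, ?_⟩))).time (by simp)
    · simpa using h1
    · intro x hx
      simp at hx
      by_cases hxc : x = σ.r .cnt
      · simp [hxc, hv]
      · simp [hxc]
        exact .inl (h2 x (by omega))
    · rintro x (hx | rfl)
      · have hxv : x ≠ v := by
          rintro rfl
          exact hpv hx
        obtain ⟨g1, g2⟩ := h3 x hx
        simp [hxv, hv, g2, g1.ne]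
        omega
      · simp [hv]
    · intro x hx
      simp at hx
      by_cases hxc : x = σ.r .cnt
      · simp [hxc]
      · have hx' : x < σ.r .cnt := by omega
        have hne : σ.m .oin x ≠ v := by
          intro he
          exact hpv (he ▸ h2 x hx')
        simp [hxc, hv, hne, h4 x hx']

theorem exists_lt_succ_iff {p : ℕ → Prop} {i : ℕ} :
    (∃ k < i + 1, p k) ↔ (∃ k < i, p k) ∨ p i := by
  constructor
  · rintro ⟨k, hk, h⟩
    rcases Nat.lt_or_ge k i with h1 | h1
    · exact .inl ⟨k, h1, h⟩
    · exact .inr ((show k = i by omega) ▸ h)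
  · rintro (⟨k, hk, h⟩ | h)
    · exact ⟨k, by omega, h⟩
    · exact ⟨i, by omega, h⟩

theorem tr_buildList {σ : NSt} {n V gs R u : ℕ} {A H O : ℕ → ℕ}
    (h : Linked n V gs R A H O σ) (hu : σ.r .a1 = u) (hV : ∀ i < n, ∀ s < R, H i + O s < V)
    (hH : ∀ i < n, H i < V)
    (hVW : 5 * V < 2 ^ w) (hgW : u * gs + gs < 2 ^ w) (hRW : R < 2 ^ w)
    (hNW : gs + n + R * n + 1 < 2 ^ w) :
    Tr w (buildList R) σ (gs * 100 + n * 100 + R * (n * 100 + 20) + 30)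
      (Listed (InList n V gs R u H O) (gs + n + R * n)) := by
  apply Tr.time
  · apply Tr.asg_seq (by simp)
    apply Tr.seq (Tr.forLoop_const (N := gs) (c := 60) (I := fun y =>
      Listed (fun v => ∃ y' < y, u * gs + y' < n ∧ v = V + H (u * gs + y')) y)
      ?_ (by simp [insertVal]) ?_ ?_)
    · intro σ1 a1 I1
      apply Tr.seq (Tr.forLoop_const (N := n) (c := 60) (I := fun i => Listed (fun v =>
          (∃ y < gs, u * gs + y < n ∧ v = V + H (u * gs + y)) ∨ ∃ i' < i, v = 3 * V + H i')
          (gs + i)) ?_ (by simp [insertVal]) ?_ ?_)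
      · intro σ2 a2 I2
        apply Tr.forLoop_const (N := R) (c := n * 80 + 10) (I := fun s => Listed (fun v =>
          ((∃ y < gs, u * gs + y < n ∧ v = V + H (u * gs + y)) ∨ ∃ i < n, v = 3 * V + H i) ∨
            ∃ s' < s, ∃ i < n, v = 4 * V + (H i + O s'))
          (gs + n + s * n)) ?_ (by simp [insertVal]) ?_ ?_
        · intro σ' h'
          simp [hRW]
        · refine (I2.of_eq (fun v => by simp) (by simp) (by simp) (by simp)).mono (by omega)
        · intro s hs σ' h' hs' hI
          refine (Tr.forLoop_const (N := n) (c := 60) (I := fun i => Listed (fun v =>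
            (((∃ y < gs, u * gs + y < n ∧ v = V + H (u * gs + y)) ∨ ∃ i < n, v = 3 * V + H i) ∨
              ∃ s' < s, ∃ i < n, v = 4 * V + (H i + O s')) ∨ ∃ i' < i, v = 4 * V + (H i' + O s))
                (gs + n + s * n + i)) ?_ (by simp [insertVal]) ?_ ?_).mono ?_ ?_
          · intro σ3 h3
            simp [h3.var .n (by simp [insertVal]), h'.var .n (by simp [insertVal]),
              a2.var .n (by simp [insertVal]), a1.var .n (by simp [insertVal]), h.n_eq]
          · exact hI.of_eq (fun v => by simp) (by simp) (by simp) (by simp)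
          · intro i hi σ3 h3 hi' hI3
            have q1 : σ3.r .V = V := by
              rw [h3.var .V (by simp [insertVal]), h'.var .V (by simp [insertVal]),
                a2.var .V (by simp [insertVal]), a1.var .V (by simp [insertVal])]
              simp [h.V_eq]
            have q2 : σ3.m .code i = H i := by
              rw [h3.arr .code (by simp [insertVal]), h'.arr .code (by simp [insertVal]),
                a2.arr .code (by simp [insertVal]), a1.arr .code (by simp [insertVal])]
              simp [h.code_eq i hi]
            have q2' : σ3.m .off s = O s := by
              rw [h3.arr .off (by simp [insertVal]), h'.arr .off (by simp [insertVal]),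
                a2.arr .off (by simp [insertVal]), a1.arr .off (by simp [insertVal])]
              simp [h.off_eq s hs]
            have q3 := hV i hi s hs
            have q4 : σ3.r .k = s := by rw [h3.var .k (by simp [insertVal]), hs']
            have q5 : s * n + n ≤ R * n := by
              have := Nat.mul_le_mul_right n (show s + 1 ≤ R by omega)
              linarith
            refine (Tr.asg_seq (by simp [q1, hi', q2, q2', q4]; omega) ((tr_insertVal (p := fun v =>
              (((∃ y < gs, u * gs + y < n ∧ v = V + H (u * gs + y)) ∨ ∃ i < n, v = 3 * V + H i) ∨
              ∃ s' < s, ∃ i < n, v = 4 * V + (H i + O s')) ∨ ∃ i' < i, v = 4 * V + (H i' + O s))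
              (N := gs + n + s * n + i) (v := 4 * V + (H i + O s)) ?_ (by simp [hi', q1, q2, q2',
                  q4])
                (by omega)).post fun σ'' _ h6 => ?_)).time (by simp)
            · exact hI3.of_eq (fun _ => Iff.rfl) (by simp) (by simp) (by simp)
            · refine h6.of_eq (fun v => ?_) (by simp) (by simp) (by simp)
              rw [exists_lt_succ_iff (i := i), or_assoc]
          · simp
            omega
          · intro σ3 h3 hI3
            refine (hI3.of_eq (fun v => ?_) (by simp) (by simp) (by simp)).mono (by ring_nf; omega)
            rw [exists_lt_succ_iff (i := s), or_assoc]
      · intro σ' h'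
        simp [h'.var .n (by simp [insertVal]), a1.var .n (by simp [insertVal]), h.n_eq]
      · refine I1.of_eq (fun v => by simp) (by simp) (by simp) (by simp)
      · intro i hi σ' h' hi' hI
        have q1 : σ'.r .V = V := by
          rw [h'.var .V (by simp [insertVal]), a1.var .V (by simp [insertVal])]
          simp [h.V_eq]
        have q2 : σ'.m .code i = H i := by
          rw [h'.arr .code (by simp [insertVal]), a1.arr .code (by simp [insertVal])]
          simp [h.code_eq i hi]
        have q3 := hH i hi
        refine (Tr.asg_seq (by simp [q1, hi', q2]; omega) ((tr_insertVal (p := fun v =>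
          (∃ y < gs, u * gs + y < n ∧ v = V + H (u * gs + y)) ∨ ∃ i' < i, v = 3 * V + H i')
          (N := gs + i) (v := 3 * V + H i) ?_ (by simp [hi', q1, q2]) (by nlinarith)).post
            fun σ'' _ h6 => ?_)).time (by simp)
        · exact hI.of_eq (fun _ => Iff.rfl) (by simp) (by simp) (by simp)
        · refine h6.of_eq (fun v => ?_) (by simp) (by simp) (by simp)
          rw [exists_lt_succ_iff, or_assoc]
    · intro σ' h'
      simp [h'.var .gs (by simp [insertVal]), h.gs_eq]
    · exact ⟨by simp, by simp, by simp, by simp⟩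
    · intro y hy σ' h' hy' hI
      have L' := (h.of_agree (p := buildList R) (σ' := σ.set .cnt 0) ⟨fun v hv => ?_, fun _ _ =>
          rfl⟩
        (by simp [buildList, insertVal]) (by simp [buildList, insertVal])).of_agree h'
        (by simp [insertVal]) (by simp [insertVal])
      · have e1 : σ'.r .a1 = u := by rw [h'.var .a1 (by simp [insertVal])]; simp [hu]
        have l1 : u * gs + y < 2 ^ w := by omega
        have l2 : u * gs < 2 ^ w := by omega
        have q4 := L'.gs_eq
        have q1 := L'.n_eq
        refine (Tr.asg_seq (by simp [e1, q4, hy', l1, l2]) (Tr.cond (T := 40) (by simp) ?_ ?_)).time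
          (by simp)
        · intro hx
          simp [e1, q4, hy', q1] at hx
          have q5 := L'.code_eq _ hx
          have q6 := hH _ hx
          have q7 := L'.V_eq
          refine (Tr.asg_seq (by simp [e1, q4, hy', q5, q7]; omega)
            ((tr_insertVal (p := fun v => ∃ y' < y, u * gs + y' < n ∧ v = V + H (u * gs + y'))
            (N := y) (v := V + H (u * gs + y)) ?_ (by simp [e1, q4, hy', q5, q7]) (by omega)).post
              fun σ'' _ h6 => ?_)).time (by simp)
          · exact hI.of_eq (fun _ => Iff.rfl) (by simp) (by simp) (by simp)
          · refine h6.of_eq (fun v => ?_) (by simp) (by simp) (by simp)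
            rw [exists_lt_succ_iff]
            simp [hx]
        · intro hx
          simp [e1, q4, hy', q1] at hx
          refine Tr.time (Tr.skip ?_) (show 1 ≤ 40 by norm_num)
          refine Listed.mono (hI.of_eq (fun v => ?_) (by simp) (by simp) (by simp)) (Nat.le_succ y)
          rw [exists_lt_succ_iff]
          simp [Nat.not_lt.2 hx]
      · have : v ≠ .cnt := by
          rintro rfl
          simp [buildList] at hv
        simp [this]
  · simp
    ring_nf
    omega

end WordRAM

/-! ### Calls of the All-Numbers program, and the search they trigger -/

namespace WordRAM

/-- The hash codes of a number in group `u` and of another number add up to the hash code of number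
`i` plus carry code `s`. -/
def HasPair (n gs : ℕ) (H O : ℕ → ℕ) (u s i : ℕ) : Prop :=
  ∃ y < gs, u * gs + y < n ∧ ∃ j < n, H (u * gs + y) + H j = H i + O s

/-- Number `i` is the sum of a number in group `u` and another number, and this is witnessed by
their
hash codes and carry code `s`. -/
def HasSum (n gs : ℕ) (A H O : ℕ → ℕ) (u s i : ℕ) : Prop :=
  ∃ y < gs, u * gs + y < n ∧ ∃ j < n, H (u * gs + y) + H j = H i + O s ∧
    A (u * gs + y) + A j = A i

theorem HasSum.hasPair {n gs u s i : ℕ} {A H O : ℕ → ℕ} (h : HasSum n gs A H O u s i) :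
    HasPair n gs H O u s i := by
  obtain ⟨y, h1, h2, j, h3, h4, -⟩ := h
  exact ⟨y, h1, h2, j, h3, h4⟩

/-- A positive answer comes with at least one coincidence, to which the time for searching the group
can be charged. -/
theorem HasPair.one_le {n gs u s i : ℕ} {H O : ℕ → ℕ} (h : HasPair n gs H O u s i) :
    1 ≤ pairCount n gs H O u s i := by
  obtain ⟨y, h1, h2, j, h3, h4⟩ := h
  refine le_trans ?_ (Finset.single_le_sum (fun _ _ => Nat.zero_le _) (Finset.mem_range.2 h1))
  rw [if_pos h2, Nat.succ_le_iff, Finset.card_pos]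
  exact ⟨j, by simp [h3, h4]⟩

/-- The groups partition an interval that contains all indices below `n`, so every coincidence is
counted in exactly one group. -/
theorem sum_pairCount {n gs G R : ℕ} {H O : ℕ → ℕ} (hG : n ≤ G * gs) :
    ∑ u ∈ Finset.range G, ∑ s ∈ Finset.range R, ∑ i ∈ Finset.range n, pairCount n gs H O u s i =
      ∑ s ∈ Finset.range R, ∑ i ∈ Finset.range n, ∑ j ∈ Finset.range n, ∑ k ∈ Finset.range n,
        if H j + H k = H i + O s then 1 else 0 := by
  have key (f : ℕ → ℕ) : ∀ G, ∑ u ∈ Finset.range G, ∑ y ∈ Finset.range gs, f (u * gs + y) =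
      ∑ x ∈ Finset.range (G * gs), f x := by
    intro G
    induction G with
    | zero => simp
    | succ G ih => rw [Finset.sum_range_succ, ih, Nat.succ_mul, Finset.sum_range_add]
  rw [Finset.sum_comm]
  refine Finset.sum_congr rfl fun s _ => ?_
  rw [Finset.sum_comm]
  refine Finset.sum_congr rfl fun i _ => ?_
  simp only [pairCount]
  rw [key (fun x => if x < n then Finset.card {j ∈ Finset.range n | H x + H j = H i + O s} else 0)]
  rw [← Finset.sum_subset (Finset.range_subset_range.2 hG)
    fun x _ hx => if_neg fun h => hx (Finset.mem_range.2 h)]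
  refine Finset.sum_congr rfl fun j hj => ?_
  rw [if_pos (Finset.mem_range.1 hj), Finset.card_filter]

theorem InList.bounds {n V gs R u v : ℕ} {H O : ℕ → ℕ} (h : InList n V gs R u H O v)
    (hH : ∀ i < n, H i < V) (hV : ∀ i < n, ∀ s < R, H i + O s < V) : V ≤ v ∧ v < 5 * V := by
  rcases h with (⟨y, -, h1, rfl⟩ | ⟨i, h1, rfl⟩) | ⟨s, h2, i, h1, rfl⟩
  · have := hH _ h1
    omega
  · have := hH _ h1
    omega
  · have := hV _ h1 _ h2
    omega

/-- The list `f` consists of the numbers in `InList`, and of numbers that are at least `5 * V`. -/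
theorem exists_add_eq_iff_hasPair {n V gs R u N s i : ℕ} {H O f : ℕ → ℕ} (hH : ∀ i < n, H i < V)
    (hV : ∀ i < n, ∀ s < R, H i + O s < V) (hs : s < R) (hi : i < n)
    (hf : ∀ v < 5 * V, (∃ x < N, f x = v) ↔ InList n V gs R u H O v) :
    (∃ a < N, ∃ b < N, f a + f b = 4 * V + (H i + O s)) ↔ HasPair n gs H O u s i := by
  have hz := hV i hi s hs
  constructor
  · rintro ⟨a, ha, b, hb, hab⟩
    have pa := (hf (f a) (by omega)).1 ⟨a, ha, rfl⟩
    have pb := (hf (f b) (by omega)).1 ⟨b, hb, rfl⟩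
    have ba := pa.bounds hH hV
    have bb := pb.bounds hH hV
    -- The target lies in `[4 V, 5 V)`. Two elements of `[V, 2 V)` add up to less than `4 V`, two of
    -- `[3 V, 4 V)` to at least `6 V`, and an element of `[4 V, 5 V)` exceeds the interval with any
    -- partner. Only a group code plus a general code remains.
    rcases pa with (⟨y, g1, g2, g3⟩ | ⟨j, g2, g3⟩) | ⟨t, -, j, g2, g3⟩
    · rcases pb with (⟨y', -, h2, h3⟩ | ⟨j', h2, h3⟩) | ⟨t', -, j', h2, h3⟩
      · have := hH _ g2
        have := hH _ h2
        omega
      · exact ⟨y, g1, g2, j', h2, by omega⟩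
      · omega
    · rcases pb with (⟨y', h1, h2, h3⟩ | ⟨j', h2, h3⟩) | ⟨t', -, j', h2, h3⟩
      · exact ⟨y', h1, h2, j, g2, by omega⟩
      · omega
      · omega
    · omega
  · rintro ⟨y, h1, h2, j, h3, h4⟩
    have b1 := hH _ h2
    have b2 := hH _ h3
    obtain ⟨a, ha, ha'⟩ := (hf (V + H (u * gs + y)) (by omega)).2 (.inl (.inl ⟨y, h1, h2, rfl⟩))
    obtain ⟨b, hb, hb'⟩ := (hf (3 * V + H j) (by omega)).2 (.inl (.inr ⟨j, h3, rfl⟩))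
    exact ⟨a, ha, b, hb, by omega⟩

variable {w : ℕ} [NeZero w]

/-- The universe of the call is the square of the list length, so the list is stretched to the fixed
length `M * n`. The padding numbers are distinct, and from `5 V` on they are too large to contribute
to a target. -/
theorem tr_padList {σ : NSt} {n V M : ℕ} (hn : σ.r .n = n) (hV : σ.r .V = V)
    (hV1 : 1 ≤ V) (hW : 5 * V + M * n < 2 ^ w) (hM : M < 2 ^ w) :
    Tr w (padList M) σ (M * n * 30 + 20) fun σ' => σ'.r .onum = M * n ∧
      ∀ x < M * n, σ'.m .oin x = if x < σ.r .cnt then σ.m .oin x else 5 * V + x := by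
  refine (Tr.asg_seq (by simp [hn, hM]; omega) ((Tr.forLoop_const (N := M * n) (c := 20)
    (I := fun i σ' => (∀ x < i, σ'.m .oin x = if x < σ.r .cnt then σ.m .oin x else 5 * V + x) ∧
      ∀ x, i ≤ x → σ'.m .oin x = σ.m .oin x)
    ?_ (by simp) ?_ ?_).post fun σ' h' hI => ⟨?_, hI.1⟩)).time ?_
  · intro σ' h'
    rw [Expr.eval_var, h'.var .onum (by simp)]
    simp [hn]
  · exact ⟨by simp, by simp⟩
  · intro i hi σ' h' hi' ⟨I1, I2⟩
    have e1 : σ'.r .cnt = σ.r .cnt := by rw [h'.var .cnt (by simp)]; simp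
    have e2 : σ'.r .V = V := by rw [h'.var .V (by simp)]; simp [hV]
    refine (Tr.cond (T := 10) (by simp) ?_ ?_).time (by simp)
    · intro h1
      simp [hi', e1] at h1
      refine (Tr.skip ⟨fun x hx => ?_, fun x hx => ?_⟩).time (by omega)
      · rcases Nat.lt_or_ge x i with h2 | h2
        · exact I1 x h2
        · obtain rfl : x = i := by omega
          simp [h1, I2]
      · simpa using I2 x (by omega)
    · intro h1
      simp [hi', e1] at h1
      refine (Tr.sto (by simp) (by simp [hi', e2]; omega) ⟨fun x hx => ?_, fun x hx => ?_⟩).time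
        (by simp)
      · rcases Nat.lt_or_ge x i with h2 | h2
        · simp [hi', h2.ne, I1 x h2]
        · obtain rfl : x = i := by omega
          simp [hi', e2, Nat.not_lt.2 h1]
      · simp [hi', show x ≠ i by omega, I2 x (by omega)]
  · simp
    omega
  · rw [h'.var .onum (by simp)]
    simp [hn]

theorem tr_report {σ : NSt} {n V gs R u : ℕ} {A H O : ℕ → ℕ} (h : Linked n V gs R A H O σ)
    (hu : σ.r .a1 = u) (hV : ∀ i < n, ∀ s < R, H i + O s < V) (hgs : 1 ≤ gs)
    (hVW : 5 * V < 2 ^ w) (hgW : u * gs + gs < 2 ^ w) (hnW : n < 2 ^ w) (hRW : R < 2 ^ w)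
    (hA : ∀ i < n, ∀ j < n, A i + A j < 2 ^ w)
    (hout : ∀ s < R, ∀ i < n, σ.m .oout (σ.m .pos (4 * V + (H i + O s))) ≠ 0 ↔
      HasPair n gs H O u s i) :
    Tr w (report R) σ ((∑ s ∈ Finset.range R, ∑ i ∈ Finset.range n, pairCount n gs H O u s i) *
        (gs * 120) + R * (n * 60 + 30) + 10) fun σ' =>
      Flag (∃ s < R, ∃ i < n, HasSum n gs A H O u s i) (σ.r .ans) (σ'.r .ans) := by
  refine (Tr.forLoop (N := R) (c := fun s => ∑ i ∈ Finset.range n,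
      (pairCount n gs H O u s i * (gs * 120) + 50) + 10)
    (I := fun s σ' => Flag (∃ s' < s, ∃ i < n, HasSum n gs A H O u s' i) (σ.r .ans) (σ'.r .ans))
    ?_ (by simp [checkGroup, walk]) ?_ ?_).time ?_
  · intro σ' _
    simp [hRW]
  · simpa using Flag.of_false not_false
  · intro s hs σ1 h1 hs1 I1
    have L1 := h.of_agree h1 (by simp [checkGroup, walk]) (by simp [checkGroup, walk])
    refine (Tr.forLoop (N := n) (c := fun i => pairCount n gs H O u s i * (gs * 120) + 42)
      (I := fun i σ' => Flag (∃ i' < i, HasSum n gs A H O u s i') (σ1.r .ans) (σ'.r .ans))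
      ?_ (by simp [checkGroup, walk]) ?_ ?_).mono ?_ ?_
    · intro σ' h'
      simp [h'.var .n (by simp [checkGroup, walk]), L1.n_eq]
    · simpa using Flag.of_false not_false
    · intro i hi σ2 h2 hi2 I2
      have L2 := L1.of_agree h2 (by simp [checkGroup, walk]) (by simp [checkGroup, walk])
      have q1 := L2.V_eq
      have q2 := L2.code_eq i hi
      have q3 := L2.off_eq s hs
      have q4 : σ2.r .k = s := by rw [h2.var .k (by simp [checkGroup, walk]), hs1]
      have q5 : σ2.r .a1 = u := by
        rw [h2.var .a1 (by simp [checkGroup, walk]), h1.var .a1 (by simp [checkGroup, walk]), hu]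
      have q6 := hV i hi s hs
      have q7 : σ2.m .oout = σ.m .oout := by
        rw [h2.arr .oout (by simp [checkGroup, walk]), h1.arr .oout (by simp [checkGroup, walk])]
      have q8 : σ2.m .pos = σ.m .pos := by
        rw [h2.arr .pos (by simp [checkGroup, walk]), h1.arr .pos (by simp [checkGroup, walk])]
      have q9 := hout s hs i hi
      refine (Tr.asg_seq (by simp [q1, q2, q3, q4, hi2]; omega) (Tr.cond
        (T := pairCount n gs H O u s i * (gs * 120) + 10) (by simp) ?_ ?_)).time (by simp; omega)
      · intro h3
        simp only [Expr.eval_get, Expr.eval_var, Expr.eval_add, Expr.eval_mul, NSt.set_m,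
          NSt.set_r_same, Expr.eval_ofNat, q1, q2, q3, q4, q7, q8, hi2] at h3
        have hp := q9.1 h3
        refine (tr_checkGroup (u := u) (s := s) (i := i) (L2.of_agree (p := report R) (σ' := σ2.set
            .val _)
          ⟨fun v hv => ?_, fun a _ => rfl⟩ (by simp [report, checkGroup, walk])
          (by simp [report, checkGroup, walk])) (by simp [q5]) (by simp [q4]) hs (by simp [hi2]) hi
          q6 (by omega) hgW hA).mono ?_ ?_
        · have : v ≠ .val := by
            rintro rfl
            simp [report] at hv
          simp [this]
        -- As there is at least one pair, both the group size and the number of pairs are bounded by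
        -- their product.
        · have h4 := hp.one_le
          generalize pairCount n gs H O u s i = p at *
          have h5 : gs * 1 ≤ gs * p := Nat.mul_le_mul_left _ h4
          have h6 : 1 * p ≤ gs * p := Nat.mul_le_mul_right _ hgs
          ring_nf at h5 h6 ⊢
          omega
        · intro σ3 _ h4
          simp only [ne_eq, reduceCtorEq, not_false_eq_true, NSt.set_r_of_ne] at h4 ⊢
          exact I2.exists_lt_succ h4
      · intro h3
        simp only [Expr.eval_get, Expr.eval_var, Expr.eval_add, Expr.eval_mul, NSt.set_m,
          NSt.set_r_same, Expr.eval_ofNat, q1, q2, q3, q4, q7, q8, hi2] at h3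
        refine (Tr.skip ?_).time (by omega)
        simp only [ne_eq, reduceCtorEq, not_false_eq_true, NSt.set_r_of_ne]
        exact I2.exists_lt_succ (.of_false fun hh => q9.2 hh.hasPair h3)
    · simp
    · intro σ3 _ h3
      simp only [ne_eq, reduceCtorEq, not_false_eq_true, NSt.set_r_of_ne]
      exact I1.exists_lt_succ h3
  · simp only [Finset.sum_add_distrib, ← Finset.sum_mul, Finset.sum_const, Finset.card_range,
      smul_eq_mul, Expr.cost_num]
    ring_nf
    omega

theorem tr_askOracle {σ : NSt} {n V gs R u M T : ℕ} {p : Prog} {A H O : ℕ → ℕ}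
    (h : Linked n V gs R A H O σ) (hp : SumOracle w p (M * n) T)
    (hu : σ.r .a1 = u) (hV1 : 1 ≤ V) (hV : ∀ i < n, ∀ s < R, H i + O s < V)
    (hH : ∀ i < n, H i < V) (hVW : 5 * V + M * n < 2 ^ w) (hgW : u * gs + gs < 2 ^ w)
    (hRW : R < 2 ^ w) (hMW : M < 2 ^ w) (hN : gs + n + R * n + 1 ≤ M * n)
    (hU : 5 * V + M * n ≤ (M * n) ^ 2) :
    Tr w (buildList R ;; padList M ;; p) σ (M * n * 300 + R * 20 + T + 100) fun σ' =>
      ∀ s < R, ∀ i < n, σ'.m .oout (σ'.m .pos (4 * V + (H i + O s))) ≠ 0 ↔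
        HasPair n gs H O u s i := by
  apply Tr.time
  · apply Tr.seq (tr_buildList h hu hV hH (by omega) hgW hRW (by omega))
    intro σ1 h1 hL
    have L1 := h.of_agree h1 (by simp [buildList, insertVal]) (by simp [buildList, insertVal])
    apply Tr.seq (tr_padList L1.n_eq L1.V_eq hV1 hVW hMW)
    intro σ2 h2 ⟨hnum, hin⟩
    have hpos2 : σ2.m .pos = σ1.m .pos := h2.arr .pos (by simp [padList])
    have hcnt : σ1.r .cnt < M * n := by have := hL.cnt_le; omega
    have hb : ∀ x < σ1.r .cnt, V ≤ σ1.m .oin x ∧ σ1.m .oin x < 5 * V :=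
      fun x hx => (hL.prop x hx).bounds hH hV
    have hlist : ∀ v < 5 * V, (∃ x < M * n, σ2.m .oin x = v) ↔ InList n V gs R u H O v := by
      intro v hv
      constructor
      · rintro ⟨x, hx, rfl⟩
        rw [hin x hx] at hv ⊢
        split_ifs at hv ⊢ with h3
        · exact hL.prop x h3
        · omega
      · intro hv'
        obtain ⟨g1, g2⟩ := hL.mem v hv'
        exact ⟨σ1.m .pos v, by omega, by rw [hin _ (by omega), if_pos g1, g2]⟩
    refine (hp.tr σ2 hnum ?_ ?_).post fun σ3 h3 h4 => ?_
    · intro x hx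
      rw [hin x hx]
      split_ifs with h5
      · have := hb x h5
        omega
      · omega
    · intro x hx y hy hxy
      rw [hin x hx, hin y hy] at hxy
      split_ifs at hxy with h5 h6 h7
      · rw [← hL.pos_oin x h5, ← hL.pos_oin y h6, hxy]
      · have := hb x h5
        omega
      · have := hb y h7
        omega
      · omega
    · intro s hs i hi
      rw [h3.arr .pos (hp.keepsArr _ (by decide) (by decide)), hpos2]
      obtain ⟨g1, g2⟩ := hL.mem (4 * V + (H i + O s)) (.inr ⟨s, hs, i, hi, rfl⟩)
      rw [h4 _ (by omega), hin (σ1.m .pos (4 * V + (H i + O s))) (by omega), if_pos g1, g2]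
      exact exists_add_eq_iff_hasPair hH hV hs hi hlist
  · have h1 : R * n ≤ M * n := by omega
    have h2 : R * (n * 100 + 20) = R * n * 100 + R * 20 := by ring
    rw [h2]
    omega

theorem tr_processGroup {σ : NSt} {n V gs R u M T : ℕ} {p : Prog} {A H O : ℕ → ℕ}
    (h : Linked n V gs R A H O σ) (hp : SumOracle w p (M * n) T)
    (hu : σ.r .a1 = u) (hV1 : 1 ≤ V) (hV : ∀ i < n, ∀ s < R, H i + O s < V)
    (hH : ∀ i < n, H i < V) (hVW : 5 * V + M * n < 2 ^ w) (hgs : 1 ≤ gs)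
    (hgW : u * gs + gs < 2 ^ w)
    (hRW : R < 2 ^ w) (hMW : M < 2 ^ w) (hN : gs + n + R * n + 1 ≤ M * n)
    (hU : 5 * V + M * n ≤ (M * n) ^ 2) (hA : ∀ i < n, ∀ j < n, A i + A j < 2 ^ w) :
    Tr w (processGroup R M p) σ
      ((∑ s ∈ Finset.range R, ∑ i ∈ Finset.range n, pairCount n gs H O u s i) * (gs * 120) +
        (M * n * 400 + R * 50 + T + 120)) fun σ' =>
      Flag (∃ s < R, ∃ i < n, HasSum n gs A H O u s i) (σ.r .ans) (σ'.r .ans) := by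
  have hkv {v : Var} (hv : v ∉ ([.cnt, .j, .idx, .val, .i, .k, .onum, .x] : List Var)) :
      (buildList R ;; padList M ;; p).keepsVar v = true := by
    simp only [List.mem_cons, List.not_mem_nil, or_false, not_or] at hv
    simp [buildList, insertVal, padList, hv, hp.keepsVar]
  have hka {a : Arr} (ha : a ∉ ([.pos, .oin, .oout] : List Arr)) :
      (buildList R ;; padList M ;; p).keepsArr a = true := by
    simp only [List.mem_cons, List.not_mem_nil, or_false, not_or] at ha
    simp [buildList, insertVal, padList, ha, hp.keepsArr]
  rw [show processGroup R M p = buildList R ;; padList M ;; p ;; report R from rfl]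
  have h1 := tr_askOracle h hp hu hV1 hV hH hVW hgW hRW hMW hN hU
  -- Sequences associate to the right; regrouping allows the part up to the oracle call to be
  -- treated as one program.
  have assoc {a b c d : Prog} {σ : NSt} {T : ℕ} {Q : NSt → Prop}
      (h : Tr w ((a ;; b ;; c) ;; d) σ T Q) : Tr w (a ;; b ;; c ;; d) σ T Q := by
    intro s hs
    obtain ⟨t, s', e, ht, hq⟩ := h s hs
    cases e with
    | seq e1 e4 => cases e1 with
      | seq e1 e2 => cases e2 with
        | seq e2 e3 => exact ⟨_, s', .seq e1 (.seq e2 (.seq e3 e4)), by omega, hq⟩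
  apply assoc
  have hnM : n ≤ M * n := by omega
  apply Tr.time
  · apply Tr.seq h1
    intro σ1 a1 h2
    have L1 := h.of_agree a1 (fun v hv => hkv (by revert v; decide))
      (fun a ha => hka (by revert a; decide))
    refine (tr_report L1 ((a1.var _ (hkv (by decide))).trans hu) hV hgs (by omega) hgW (by omega)
      hRW hA h2).post fun σ2 _ h3 => ?_
    rwa [a1.var _ (hkv (by decide))] at h3
  · have h2 : R * (n * 60 + 30) = R * n * 60 + R * 30 := by ring
    rw [h2]
    omega

/-- The number of groups balances the costs. A coincidence is charged the group size, about `n / g ^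
5`, while each group needs one call. For `O(g ^ (K + 4))` coincidences the searches then take time
`O(g ^ (2 K - 1))`. -/
theorem tr_processAll {σ : NSt} {n V g R M T : ℕ} {p : Prog} {A H O : ℕ → ℕ} (hn : σ.r .n = n)
    (hσV : σ.r .V = V) (hg : σ.r .g = g) (hinp : ∀ i < n, σ.m .inp i = A i)
    (hcode : ∀ i < n, σ.m .code i = H i) (hoff : ∀ s < R, σ.m .off s = O s)
    (hp : SumOracle w p (M * n) T) (hn1 : 1 ≤ n) (hg1 : 1 ≤ g) (hgW : g ^ 5 < 2 ^ w)
    (hV1 : 1 ≤ V) (hV : ∀ i < n, ∀ s < R, H i + O s < V)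
    (hH : ∀ i < n, H i < V) (hVW : 5 * V + M * n < 2 ^ w) (hnW : g ^ 5 + n < 2 ^ w)
    (hRW : R < 2 ^ w) (hMW : M < 2 ^ w) (hM : R + 4 ≤ M)
    (hU : 5 * V + M * n ≤ (M * n) ^ 2) (hA : ∀ i < n, ∀ j < n, A i + A j < 2 ^ w) :
    Tr w (processAll R M p) σ ((∑ s ∈ Finset.range R, ∑ i ∈ Finset.range n, ∑ j ∈ Finset.range n,
        ∑ k ∈ Finset.range n, if H j + H k = H i + O s then 1 else 0) * ((n / g ^ 5 + 1) * 120) +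
        g ^ 5 * (M * n * 400 + R * 50 + T + 140) + V * 11 + n * 40 + 100) fun σ' =>
      Flag (∃ u < g ^ 5, ∃ s < R, ∃ i < n, HasSum n (n / g ^ 5 + 1) A H O u s i) 0 (σ'.r .ans) := by
  set G := g ^ 5 with hG
  have hG1 : 1 ≤ G := Nat.one_le_pow _ _ hg1
  set gs := n / G + 1 with hgs
  have hGgs : n < G * gs := by
    have := Nat.div_add_mod n G
    have := Nat.mod_lt n hG1
    rw [hgs, mul_add, mul_one]
    omega
  have hGgs' : G * gs ≤ G + n := by
    have := Nat.div_mul_le_self n G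
    rw [hgs, mul_add, mul_one, mul_comm]
    omega
  have hgsn : gs ≤ n + 1 := by
    have := Nat.div_le_self n G
    omega
  have hN : gs + n + R * n + 1 ≤ M * n := by
    have : (R + 4) * n ≤ M * n := Nat.mul_le_mul_right _ hM
    have e : (R + 4) * n = R * n + 4 * n := by ring
    omega
  have hpow : g * g * g * g * g = G := by rw [hG]; ring
  have hk : g * g * g * g < 2 ^ w ∧ g * g * g < 2 ^ w ∧ g * g < 2 ^ w := by
    have h1 : g * g * g * g * 1 ≤ g * g * g * g * g := Nat.mul_le_mul_left _ hg1
    have h2 : g * g * g * 1 ≤ g * g * g * g := Nat.mul_le_mul_left _ hg1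
    have h3 : g * g * 1 ≤ g * g * g := Nat.mul_le_mul_left _ hg1
    omega
  have hkv {v : Var} (hv : v ∉ ([.cnt, .j, .idx, .val, .i, .k, .onum, .x, .ans, .z, .l] : List
      Var)) :
      (processGroup R M p).keepsVar v = true := by
    simp only [List.mem_cons, List.not_mem_nil, or_false, not_or] at hv
    simp [processGroup, report, checkGroup, walk, buildList, insertVal, padList, hv, hp.keepsVar]
  have hka {a : Arr} (ha : a ∉ ([.pos, .oin, .oout] : List Arr)) :
      (processGroup R M p).keepsArr a = true := by
    simp only [List.mem_cons, List.not_mem_nil, or_false, not_or] at ha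
    simp [processGroup, report, checkGroup, walk, buildList, insertVal, padList, ha, hp.keepsArr]
  have hlk : ∀ v ∈ ([.n, .V, .gs, .a3] : List Var), v ≠ .a1 ∧ (processGroup R M p).keepsVar v =
      true :=
    fun v hv => ⟨by revert v; decide, hkv (by revert v; decide)⟩
  apply Tr.time
  · apply Tr.asg_seq
    · simp only [Expr.ok_mul, Expr.ok_var, Expr.eval_mul, Expr.eval_var, hg, true_and, hpow, hk]
      exact hgW
    apply Tr.asg_seq
    · simp only [Expr.ok_add, Expr.ok_div, Expr.ok_var, Expr.eval_mul, Expr.eval_div, Expr.eval_var,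
        true_and, Expr.eval_ofNat, Expr.ok_ofNat, ne_eq, reduceCtorEq, not_false_eq_true,
        NSt.set_r_of_ne, NSt.set_r_same, hg, hpow, hn]
      omega
    apply Tr.seq (tr_linkLists (n := n) (V := V) (H := H) (by simp [hn]) (by simp [hσV])
      (by simpa using hcode) hH (by omega))
    intro σ1 a1 h1
    have eG : σ1.r .a3 = G := by
      rw [a1.var .a3 (by simp [linkLists, clear])]
      simpa [hg] using hpow
    have egs : σ1.r .gs = gs := by
      rw [a1.var .gs (by simp [linkLists, clear])]
      simp [hg, hpow, hn, hgs]
    have L1 : Linked n V gs R A H O σ1 := by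
      refine ⟨?_, ?_, egs, ?_, ?_, ?_, h1⟩
      · rw [a1.var .n (by simp [linkLists, clear])]; simp [hn]
      · rw [a1.var .V (by simp [linkLists, clear])]; simp [hσV]
      · rw [a1.arr .inp (by simp [linkLists, clear])]; simpa using hinp
      · rw [a1.arr .code (by simp [linkLists, clear])]; simpa using hcode
      · rw [a1.arr .off (by simp [linkLists, clear])]; simpa using hoff
    apply Tr.asg_seq (by simp)
    refine Tr.forLoop (N := G) (c := fun u => (∑ s ∈ Finset.range R, ∑ i ∈ Finset.range n,
        pairCount n gs H O u s i) * (gs * 120) + (M * n * 400 + R * 50 + T + 120))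
      (I := fun u σ' => Flag (∃ u' < u, ∃ s < R, ∃ i < n, HasSum n gs A H O u' s i) 0
        (σ'.r .ans)) ?_ (hkv (by decide)) ?_ ?_
    · intro σ' h'
      rw [Expr.eval_var, h'.var .a3 (by simpa using hlk .a3 (by decide))]
      simp [eG]
    · simpa using Flag.of_false not_false
    · intro u hu σ2 h2 hu2 I2
      have L2 := (L1.of_agree (p := asg .ans 0) (σ' := σ1.set .ans (Expr.eval σ1 0))
        ⟨fun v hv => by simp at hv; simp [hv], fun _ _ => rfl⟩ (by simp) (by simp)).of_agree h2
        (fun v hv => by simpa using hlk v (by revert v; decide))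
        (fun a ha => by simpa using hka (by revert a; decide))
      have hugs : u * gs + gs ≤ G * gs := by
        have := Nat.mul_le_mul_right gs (show u + 1 ≤ G by omega)
        linarith
      refine (tr_processGroup L2 hp hu2 hV1 hV hH hVW (Nat.succ_pos _)
        ((hugs.trans hGgs').trans_lt (by omega)) hRW hMW hN hU hA).post
        fun σ3 _ h3 => ?_
      simp only [ne_eq, reduceCtorEq, not_false_eq_true, NSt.set_r_of_ne]
      exact I2.exists_lt_succ h3
  · rw [← sum_pairCount (n := n) (gs := gs) (G := G) (R := R) hGgs.le]
    simp only [Finset.sum_add_distrib, ← Finset.sum_mul, Finset.sum_const, Finset.card_range,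
      smul_eq_mul]
    simp
    ring_nf
    omega

end WordRAM

namespace WordRAM

/-! ### The reduction -/

/-- Decide 3SUM with the help of the program `p` for All-Numbers 3SUM. -/
def threeSumProg (K r e M Θ : ℕ) (p : Prog) : Prog :=
  setup K r e ;; selectAll r ;; power .thr .g (.num (K + 4)) ;; asg .thr (.num Θ * Var.thr) ;;
  cond (Expr.lt Var.thr Var.S) (asg .ans 1) (processAll (2 ^ r) M p) ;; asg .n Var.ans

/-- There is a solution of 3SUM among `A 0, …, A (n - 1)`. -/
def Solvable (n : ℕ) (A : ℕ → ℕ) : Prop := ∃ i < n, ∃ j < n, ∃ k < n, A j + A k = A i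

/-- Reported solutions are genuine because the numbers themselves are compared. None is missed: a
true sum satisfies every congruence, so some carry code witnesses it, and the first summand, with
index `j`, belongs to group `j / gs`. -/
theorem exists_hasSum_iff {n gs G r B : ℕ} {A P : ℕ → ℕ} (hM : Moduli B r P) (hG : n ≤ G * gs)
    (hgs : 0 < gs) : (∃ u < G, ∃ s < 2 ^ r, ∃ i < n,
      HasSum n gs A (fun i => hashCode B r P (A i)) (carryCode B r P) u s i) ↔ Solvable n A := by
  constructor
  · rintro ⟨u, -, s, -, i, hi, y, -, hy, j, hj, -, h⟩
    exact ⟨i, hi, _, hy, j, hj, h⟩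
  · rintro ⟨i, hi, j, hj, k, hk, h⟩
    obtain ⟨s, hs, hs'⟩ := exists_hashCode_add_eq hM (a := A j) (b := A k) (c := A i)
      fun l _ => by rw [h]
    have e : j / gs * gs + j % gs = j := Nat.div_add_mod' j gs
    refine ⟨j / gs, Nat.div_lt_of_lt_mul (by rw [mul_comm]; omega), s, hs, i, hi, j % gs,
      Nat.mod_lt _ hgs, by rwa [e], k, hk, ?_⟩
    simp only [e]
    exact ⟨hs', h⟩

theorem countTime_mono {n r B B' : ℕ} (h : B ≤ B') : countTime n r B ≤ countTime n r B' := by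
  unfold countTime
  gcongr

/-- A bound for the running time of `threeSumProg`, where `T` is the running time of the program for
All-Numbers 3SUM. -/
def reductionTime (K r e M Θ g n T : ℕ) : ℕ :=
  ((n + 1) * ((K + 1) * 21 + 30) + 21000 * (e + 1) * g ^ 3) +
    ((r + 1) * g * (countTime n r (8 * g) + 100) + (Θ * g ^ (K + 4) * ((n / g ^ 5 + 1) * 120) +
      g ^ 5 * (M * n * 400 + 2 ^ r * 50 + T + 140) + (8 * g) ^ r * 11 + n * 40 + (K + 5) * 21 +
          200))

variable {w : ℕ} [NeZero w]

theorem tr_threeSumProg {σ : NSt} {n K r e g c M Θ T : ℕ} {A : ℕ → ℕ} {p : Prog} (hK : 6 ≤ K)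
    (hr : r = 2 * K - 3) (he : e = 3 * K + r) (hn : σ.r .n = n) (hA : ∀ i < n, σ.m .inp i = A i)
    (hn1 : 1 ≤ n) (hAn : ∀ i < n, A i ≤ n ^ c) (hg1 : g ^ K ≤ n) (hg2 : n < (g + 1) ^ K)
    (hΘ : ∀ g n T : ℕ, 1 ≤ g → n < (g + 1) ^ K → 1 ≤ n → T ≤ 2 ^ r * n ^ 3 →
      Nat.primeCounting g ^ r * T ≤ (2 ^ r * Nat.log 2 (2 * n ^ c)) ^ r * (2 ^ r * n ^ 3) →
      T ≤ Θ * g ^ (K + 4))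
    (hM : 2 ^ r + 5 * 8 ^ r + 4 ≤ M) (hp : SumOracle w p (M * n) T)
    (hW1 : (4 * g + 4) ^ e * (4 * g + 4) ^ e < 2 ^ w) (hW2 : n ^ K < 2 ^ w)
    (hW3 : (M * n) ^ 2 < 2 ^ w) (hW4 : 2 * n ^ c < 2 ^ w) (hW5 : Θ * g ^ (K + 4) < 2 ^ w) :
    Tr w (threeSumProg K r e M Θ p) σ (reductionTime K r e M Θ g n T) fun σ' =>
      Flag (Solvable n A) 0 (σ'.r .n) := by
  have hr0 : 0 < r := by omega
  have he0 : 0 < e := by omega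
  have hg0 : 1 ≤ g := by
    rcases Nat.eq_zero_or_pos g with rfl | h
    · simp at hg2
      omega
    · exact h
  have h2r : 0 < 2 ^ r := by positivity
  have h8r : 0 < 8 ^ r := by positivity
  have h4e : (4 * g + 4) ^ e < 2 ^ w :=
    (Nat.le_mul_of_pos_left _ (by positivity)).trans_lt hW1
  have heW : e < 2 ^ w := (Nat.lt_pow_self (by omega : 1 < 4 * g + 4)).trans h4e
  have hrW : 2 ^ r < 2 ^ w := (Nat.pow_le_pow_left (by omega : 2 ≤ 4 * g + 4) r).trans_lt
    ((Nat.pow_le_pow_right (by omega) (by omega)).trans_lt h4e)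
  have hgn : g ^ 5 ≤ n := (Nat.pow_le_pow_right hg0 (by omega)).trans hg1
  have hggn : g ≤ n := (Nat.le_self_pow (by norm_num) g).trans hgn
  -- This is the reason for `e = 3 K + r`: the modulus `Q = q ^ e` exceeds the trivial bound on the
  -- count.
  have hQ3 : 2 ^ r * n ^ 3 < (2 * g + 2) ^ e := by
    calc 2 ^ r * n ^ 3 < 2 ^ r * ((g + 1) ^ K) ^ 3 := by gcongr
      _ ≤ (2 * g + 2) ^ r * (2 * g + 2) ^ (3 * K) := by
        rw [← pow_mul, mul_comm K 3]
        exact Nat.mul_le_mul (Nat.pow_le_pow_left (by omega) _) (Nat.pow_le_pow_left (by omega) _)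
      _ = (2 * g + 2) ^ e := by rw [← pow_add, he, Nat.add_comm r]
  have hn3 : 2 * n ≤ 2 ^ r * n ^ 3 := Nat.mul_le_mul (Nat.le_self_pow hr0.ne' 2)
    (Nat.le_self_pow (by norm_num) n)
  have hQ3W : 2 ^ r * n ^ 3 < 2 ^ w :=
    hQ3.trans ((Nat.pow_le_pow_left (by omega) e).trans_lt h4e)
  have h8 : (8 * g) ^ r ≤ 8 ^ r * n ^ 2 := by
    rw [mul_pow]
    refine Nat.mul_le_mul_left _ ?_
    calc g ^ r ≤ g ^ (K * 2) := Nat.pow_le_pow_right hg0 (by omega)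
      _ = (g ^ K) ^ 2 := pow_mul ..
      _ ≤ n ^ 2 := Nat.pow_le_pow_left hg1 2
  -- The lists fit into the quadratic universe because `g ^ r ≤ n ^ 2`; the remaining constant `5 *
  -- 8 ^ r` is absorbed by `M`.
  have hU8 : 5 * (8 * g) ^ r + M * n ≤ (M * n) ^ 2 := by
    have h1 : (5 * 8 ^ r + 1) * (M * n * n) ≤ M * (M * n * n) := Nat.mul_le_mul_right _ (by omega)
    have h2 : M * n * 1 ≤ M * n * n := Nat.mul_le_mul_left _ hn1
    have h3 : 1 * n ^ 2 ≤ M * n ^ 2 := Nat.mul_le_mul_right _ (by omega)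
    have h4 : 5 * 8 ^ r * (1 * n ^ 2) ≤ 5 * 8 ^ r * (M * n ^ 2) := Nat.mul_le_mul_left _ h3
    have e1 : M * (M * n * n) = (M * n) ^ 2 := by ring
    have e2 : (5 * 8 ^ r + 1) * (M * n * n) = 5 * 8 ^ r * (M * n ^ 2) + M * n * n := by ring
    have e3 : 5 * 8 ^ r * (1 * n ^ 2) = 5 * (8 ^ r * n ^ 2) := by ring
    omega
  have hMn : M ≤ (M * n) ^ 2 := by
    have := Nat.le_mul_of_pos_right M hn1
    omega
  apply Tr.time
  · apply Tr.seq (tr_setup (by omega) hr0 (by omega) (by rwa [hn]) (by rwa [hn]) (by rwa [hn])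
      (by omega) heW (by rwa [hn]) hW1)
    intro σ1 a1 ⟨hpar, e1g⟩
    have R1 : Ready r e n A σ1 := by
      refine ⟨hpar, ?_, ?_⟩
      · rw [a1.var .n (by simp [setup, rootProg, searchGen, testGen, power, powMod, liftRoot,
          powTable]), hn]
      · rw [a1.arr .inp (by simp [setup, rootProg, searchGen, testGen, power, powMod, liftRoot,
          powTable])]
        exact hA
    have hB8 : σ1.r .B ≤ 8 * g := by
      have h1 := hpar.B_eq
      have h2 := hpar.q_le
      omega
    have hB1 : 2 * g ≤ σ1.r .B := by
      have h1 := hpar.B_eq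
      have h2 := hpar.q_ge
      omega
    have hQ4 : σ1.r .Q ≤ (4 * g + 4) ^ e := by
      rw [hpar.Q_eq]
      exact Nat.pow_le_pow_left (by have := hpar.q_le; omega) e
    have hV8 : σ1.r .V ≤ (8 * g) ^ r := by
      rw [hpar.V_eq]
      exact Nat.pow_le_pow_left hB8 r
    apply Tr.seq (T₁ := (r + 1) * g * (countTime n r (8 * g) + 100))
      ((tr_selectAll (B := σ1.r .B) R1 e1g rfl hr0 he0
        ((Nat.mul_le_mul hQ4 hQ4).trans_lt hW1) (by omega) hrW ?_).time ?_)
    · intro σ2 a2 ⟨P, hgr, hS, hcode, hoff⟩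
      have kv {v : Var} (h1 : v ∉ countVars) (h2 : v ∉ ([.best, .bp, .a1, .a2] : List Var)) :
          σ2.r v = σ1.r v := a2.var _ (selectAll_keepsVar h1 h2)
      have hPg : ∀ j < r, 1 ≤ P j ∧ P j ≤ g := fun j hj => ⟨(hgr j hj).1, (hgr j hj).2.1⟩
      have hMod : Moduli (σ1.r .B) r P := fun j hj => by
        have := hPg j hj
        omega
      apply Tr.seq (T₁ := (K + 4 + 1) * 21) ((tr_power (K := K + 4) (by decide) (by decide) (by
          decide)
        (fun σ' _ => ⟨by simp; omega, rfl⟩) (by rw [kv (by decide) (by decide)]; omega) ?_).time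
        (by simp))
      · intro σ3 a3 h3
        rw [kv (by decide) (by decide), e1g] at h3
        have keep3 {v : Var} (hv : v ∉ ([.thr, .j] : List Var)) : σ3.r v = σ2.r v := by
          simp only [List.mem_cons, List.not_mem_nil, or_false, not_or] at hv
          exact a3.var _ (by simp [power, hv])
        apply Tr.asg_seq
        · have h5 : Θ ≤ Θ * g ^ (K + 4) := Nat.le_mul_of_pos_right _ (by positivity)
          simp [h3, hW5]
          omega
        · refine Tr.seq (T₂ := 2) (R := fun σ' => Flag (Solvable n A) 0 (σ'.r .ans)) (Tr.cond
            (T := Θ * g ^ (K + 4) * ((n / g ^ 5 + 1) * 120) +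
              g ^ 5 * (M * n * 400 + 2 ^ r * 50 + T + 140) + (8 * g) ^ r * 11 + n * 40 + 100)
            (by simp) ?_ ?_) fun σ' _ h' => (Tr.asg (by simp) (by simpa using h')).time (by simp)
          · intro h4
            simp [h3, keep3, hS] at h4
            -- Above the threshold the answer is yes without exhibiting a solution: if there were
            -- none, the greedy bound would apply and contradict the count.
            refine (Tr.asg (by simp [NeZero.ne w]) ⟨by simp, fun hns => ?_⟩).time (by simp)
            have := hΘ g n _ hg0 hg2 hn1 (tripleCount_le n r (σ1.r .B) P A)
              (primeCounting_pow_mul_tripleCount_le hB1 hg0 hgr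
                (fun i hi j hj k hk h => hns ⟨i, hi, j, hj, k, hk, h⟩) hAn)
            omega
          · intro h4
            simp [h3, keep3, hS] at h4
            have hVB : σ1.r .V = σ1.r .B ^ r := hpar.V_eq
            have hV1 : 1 ≤ σ1.r .V := by
              rw [hVB]
              exact Nat.one_le_pow _ _ (by omega)
            refine (tr_processAll (n := n) (V := σ1.r .V) (g := g) (R := 2 ^ r) (A := A)
              (H := fun i => hashCode (σ1.r .B) r P (A i)) (O := carryCode (σ1.r .B) r P)
              ?_ ?_ ?_ ?_ ?_ ?_ hp hn1 hg0 (by omega) hV1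
              (fun i _ s _ => hVB ▸ hMod.hashCode_add_lt _ _) (fun i _ => hVB ▸ hMod.hashCode_lt _)
              (by omega) (by omega) hrW (by omega) (by omega) (by omega) ?_).mono ?_ ?_
            · simp [keep3, kv, countVars, R1.n_eq]
            · simp [keep3, kv, countVars]
            · simp [keep3, kv, countVars, e1g]
            · simp only [NSt.set_m]
              rw [a3.arr .inp (by simp [power]), a2.arr .inp (selectAll_keepsArr (by decide)
                (by decide))]
              exact R1.inp_eq
            · simp only [NSt.set_m]
              rw [a3.arr .code (by simp [power])]
              exact hcode
            · simp only [NSt.set_m]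
              rw [a3.arr .off (by simp [power])]
              exact hoff
            · intro i hi j hj
              have h6 := hAn i hi
              have h7 := hAn j hj
              omega
            · have h6 := Nat.mul_le_mul_right ((n / g ^ 5 + 1) * 120) h4
              have h7 : σ1.r .V * 11 ≤ (8 * g) ^ r * 11 := Nat.mul_le_mul_right _ hV8
              simp only [tripleCount] at h6
              omega
            · intro σ' _ h6
              refine h6.congr (exists_hasSum_iff hMod ?_ (Nat.succ_pos _))
              have h7 := Nat.div_add_mod n (g ^ 5)
              have h8 := Nat.mod_lt n (show 0 < g ^ 5 by positivity)
              rw [mul_add, mul_one]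
              omega
      · rw [kv (by decide) (by decide), e1g]
        calc g ^ (K + 4) ≤ (4 * g + 4) ^ (K + 4) := Nat.pow_le_pow_left (by omega) _
          _ ≤ (4 * g + 4) ^ e := Nat.pow_le_pow_right (by omega) (by omega)
          _ < 2 ^ w := h4e
    · rw [hpar.Q_eq]
      refine hQ3.trans_le (Nat.pow_le_pow_left ?_ e)
      have := hpar.q_ge
      omega
    · have := countTime_mono (n := n) (r := r) hB8
      gcongr
  · rw [reductionTime]
    simp [hn]
    omega

end WordRAM

namespace WordRAM

/-! ### Running time, word length, and the oracle -/

/-- Two terms attain the order `g ^ (2 K - 1)`: the greedy selection, with `g * B ^ (r + 1)`, and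
the searches, with `g ^ (K + 4) * g ^ (K - 5)`. Writing the lists takes time of order `g ^ 5 * n`,
hence `g ^ (K + 5)`, which is within the bound because `K ≥ 6`. -/
theorem exists_reductionTime_le {K r : ℕ} (e M Θ : ℕ) (hK : 6 ≤ K) (hr : r = 2 * K - 3) : ∃ C : ℕ,
    ∀ g n T : ℕ, 1 ≤ g → 1 ≤ n → n < (g + 1) ^ K →
      reductionTime K r e M Θ g n T ≤ C * g ^ (2 * K - 1) + g ^ 5 * T := by
  refine ⟨2 * 2 ^ K * ((K + 1) * 21 + 30) + 21000 * (e + 1) + ((r + 1) * (2 ^ K * 2 ^ r * (r + 1) *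
      200) +
    (r + 1) * ((r + 1) * 2 ^ r * 1000 * 8 ^ (r + 1)) + (r + 1) * 100 + Θ * 2 ^ (K + 1) * 120 +
    M * 2 ^ K * 400 + (2 ^ r * 50 + 140) + 8 ^ r * 11 + 2 ^ K * 40 + (K + 5) * 21 + 200),
    fun g n T hg hn1 hn => ?_⟩
  have hn2 : n ≤ 2 ^ K * g ^ K := by
    rw [← mul_pow]
    exact hn.le.trans (Nat.pow_le_pow_left (by omega) K)
  set Z := g ^ (2 * K - 1) with hZ
  have pw {m : ℕ} (hm : m ≤ 2 * K - 1) : g ^ m ≤ Z := Nat.pow_le_pow_right hg hm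
  have hnZ : n ≤ 2 ^ K * Z := hn2.trans (Nat.mul_le_mul_left _ (pw (by omega)))
  have hZ1 : 1 ≤ Z := Nat.one_le_pow _ _ hg
  have hgK : g ^ 5 * g ^ K ≤ Z := by
    rw [← pow_add]
    exact pw (by omega)
  have t1 : (n + 1) * ((K + 1) * 21 + 30) ≤ 2 * 2 ^ K * ((K + 1) * 21 + 30) * Z := by
    calc _ ≤ (2 * (2 ^ K * Z)) * ((K + 1) * 21 + 30) := Nat.mul_le_mul_right _ (by omega)
      _ = _ := by ring
  have t2 : 21000 * (e + 1) * g ^ 3 ≤ 21000 * (e + 1) * Z := Nat.mul_le_mul_left _ (pw (by omega))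
  have t3 : (r + 1) * g * (n * 2 ^ r * (r + 1) * 200) ≤
      (r + 1) * (2 ^ K * 2 ^ r * (r + 1) * 200) * Z := by
    calc _ ≤ (r + 1) * g * (2 ^ K * g ^ K * 2 ^ r * (r + 1) * 200) := by gcongr
      _ = (r + 1) * (2 ^ K * 2 ^ r * (r + 1) * 200) * g ^ (K + 1) := by ring
      _ ≤ _ := Nat.mul_le_mul_left _ (pw (by omega))
  have t4 : (r + 1) * g * ((r + 1) * 2 ^ r * 1000 * (8 * g) ^ (r + 1)) ≤
      (r + 1) * ((r + 1) * 2 ^ r * 1000 * 8 ^ (r + 1)) * Z := by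
    calc _ = (r + 1) * ((r + 1) * 2 ^ r * 1000 * 8 ^ (r + 1)) * g ^ (r + 2) := by ring
      _ ≤ _ := Nat.mul_le_mul_left _ (pw (by omega))
  have t5 : (r + 1) * g * 100 ≤ (r + 1) * 100 * Z := by
    calc _ = (r + 1) * 100 * g ^ 1 := by ring
      _ ≤ _ := Nat.mul_le_mul_left _ (pw (by omega))
  have t6 : Θ * g ^ (K + 4) * ((n / g ^ 5 + 1) * 120) ≤ Θ * 2 ^ (K + 1) * 120 * Z := by
    have h1 : n / g ^ 5 ≤ 2 ^ K * g ^ (K - 5) := by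
      refine Nat.div_le_of_le_mul (hn2.trans_eq ?_)
      rw [mul_left_comm, ← pow_add]
      congr 2
      omega
    have h2 : 1 ≤ 2 ^ K * g ^ (K - 5) := Nat.one_le_iff_ne_zero.2 (by positivity)
    calc _ ≤ Θ * g ^ (K + 4) * ((2 ^ K * g ^ (K - 5) + 2 ^ K * g ^ (K - 5)) * 120) := by gcongr
      _ = Θ * 2 ^ (K + 1) * 120 * g ^ (K + 4 + (K - 5)) := by ring
      _ ≤ _ := Nat.mul_le_mul_left _ (pw (by omega))
  have t7 : g ^ 5 * (M * n * 400) ≤ M * 2 ^ K * 400 * Z := by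
    calc _ ≤ g ^ 5 * (M * (2 ^ K * g ^ K) * 400) := by gcongr
      _ = M * 2 ^ K * 400 * (g ^ 5 * g ^ K) := by ring
      _ ≤ _ := Nat.mul_le_mul_left _ hgK
  have t8 : g ^ 5 * (2 ^ r * 50 + 140) ≤ 2 ^ r * 50 * Z + 140 * Z := by
    rw [mul_comm, ← add_mul]
    exact Nat.mul_le_mul_left _ (pw (by omega))
  have t9 : (8 * g) ^ r * 11 ≤ 8 ^ r * 11 * Z := by
    calc _ = 8 ^ r * 11 * g ^ r := by ring
      _ ≤ _ := Nat.mul_le_mul_left _ (pw (by omega))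
  have t10 : n * 40 ≤ 2 ^ K * 40 * Z := by
    calc _ ≤ 2 ^ K * Z * 40 := Nat.mul_le_mul_right _ hnZ
      _ = _ := by ring
  have t11 : (K + 5) * 21 ≤ (K + 5) * 21 * Z := Nat.le_mul_of_pos_right _ hZ1
  have t12 : 200 ≤ 200 * Z := Nat.le_mul_of_pos_right _ hZ1
  calc reductionTime K r e M Θ g n T = (n + 1) * ((K + 1) * 21 + 30) + 21000 * (e + 1) * g ^ 3 +
        ((r + 1) * g * (n * 2 ^ r * (r + 1) * 200) +
          (r + 1) * g * ((r + 1) * 2 ^ r * 1000 * (8 * g) ^ (r + 1)) + (r + 1) * g * 100 +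
          Θ * g ^ (K + 4) * ((n / g ^ 5 + 1) * 120) + g ^ 5 * (M * n * 400) +
          g ^ 5 * (2 ^ r * 50 + 140) + (8 * g) ^ r * 11 + n * 40 + (K + 5) * 21 + 200) +
          g ^ 5 * T := by
        rw [reductionTime, countTime]
        ring
    _ ≤ _ := by
        simp only [add_mul (c := Z)]
        gcongr

/-- All numbers in the program are polynomial in `n`; this converts such bounds into a word length
of the required form, with the constant `a` crudely replaced by `2 ^ a`. -/
theorem mul_pow_lt_two_pow {a b n w : ℕ} (h : (a + b) * (Nat.log 2 n + 1) ≤ w) :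
    a * (n + 1) ^ b < 2 ^ w := by
  have h1 : n + 1 ≤ 2 ^ (Nat.log 2 n + 1) := Nat.lt_pow_succ_log_self (by norm_num) n
  calc a * (n + 1) ^ b < 2 ^ a * (n + 1) ^ b := by
        gcongr
        exact Nat.lt_two_pow_self
    _ ≤ (2 ^ (Nat.log 2 n + 1)) ^ a * (2 ^ (Nat.log 2 n + 1)) ^ b := by
        refine Nat.mul_le_mul (Nat.pow_le_pow_left ?_ a) (Nat.pow_le_pow_left h1 b)
        exact Nat.le_self_pow (by omega) 2
    _ = 2 ^ ((a + b) * (Nat.log 2 n + 1)) := by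
        rw [← pow_mul, ← pow_mul, ← pow_add]
        congr 1
        ring
    _ ≤ 2 ^ w := Nat.pow_le_pow_right (by norm_num) h

theorem log_mul_add_one_le {M n : ℕ} (hM : 1 ≤ M) (hn : 1 ≤ n) :
    Nat.log 2 (M * n) + 1 ≤ (M + 1) * (Nat.log 2 n + 1) := by
  have h1 : n < 2 ^ (Nat.log 2 n + 1) := Nat.lt_pow_succ_log_self (by norm_num) n
  have h2 : M * n < 2 ^ (M + (Nat.log 2 n + 1)) := by
    rw [pow_add]
    exact Nat.mul_lt_mul'' Nat.lt_two_pow_self h1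
  have h3 := Nat.log_lt_of_lt_pow (by positivity) h2
  have h4 : M * 1 ≤ M * (Nat.log 2 n + 1) := Nat.mul_le_mul_left _ (by omega)
  rw [add_mul]
  omega

/-- The register that holds register number `r` of the program for All-Numbers 3SUM. -/
def oracleReg (r : ℕ) : ℕ := 2 * (r + Var.onum.ctorIdx)

/-- The bank that holds bank number `m` of the program for All-Numbers 3SUM. -/
def oracleBank (m : ℕ) : ℕ := m + Arr.oin.ctorIdx

/-- `onum` is the last variable, and `oin` and `oout` are the last arrays. Hence the shift sends the
input register to `onum`, the input and output banks to `oin` and `oout`, and all scratch space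
beyond the data of the reduction. Calls can be repeated without cleaning up, as the program
tolerates arbitrary contents outside its input. -/
theorem sumOracle_rename {w N T : ℕ} {p : Prog} (hN : N ^ 2 < 2 ^ w)
    (h : ∀ x : Fin N → ℕ, EnumeratesSubset N (N ^ 2) x → ∀ s : State w, HoldsInput x s →
      ∃ (t : ℕ) (s' : State w), Exec p s t s' ∧ t ≤ T ∧ AllNumbersThreeSum x s') :
    SumOracle w (p.rename oracleReg oracleBank) N T := by
  have hf : oracleReg.Injective := fun a b h => by unfold oracleReg at h; omega
  have hg : oracleBank.Injective := fun a b h => by unfold oracleBank at h; omega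
  have hNW : N < 2 ^ w := (Nat.le_self_pow (by norm_num) N).trans_lt hN
  refine ⟨fun v hv => Prog.keepsReg_rename (fun r => ?_) p,
    fun a ha ha' => Prog.keepsBank_rename (fun m => ?_) p, ?_⟩
  · have : v.ctorIdx < Var.onum.ctorIdx := by
      cases v <;> first | exact absurd rfl hv | decide
    unfold oracleReg Var.reg
    omega
  · have : a.ctorIdx < Arr.oin.ctorIdx := by
      cases a <;> first | exact absurd rfl ha | exact absurd rfl ha' | decide
    unfold oracleBank Arr.bank
    omega
  · rintro σ hn hrange hinj s rfl
    have hcell : ∀ i < N, s.view.m .oin i = (s.mem Arr.oin.bank (BitVec.ofNat w i)).toNat :=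
      fun i hi => if_pos (hi.trans hNW)
    obtain ⟨t, s', e, ht, hs'⟩ := h (fun i => s.view.m .oin i)
      ⟨fun i j hij => Fin.ext (hinj i i.2 j j.2 hij), by
        rintro _ ⟨i, rfl⟩
        exact hrange i i.2⟩ (s.pull oracleReg oracleBank) ⟨by
        apply BitVec.eq_of_toNat_eq
        rw [BitVec.toNat_ofNat, Nat.mod_eq_of_lt hNW, ← hn]
        rfl, fun i => by
        apply BitVec.eq_of_toNat_eq
        rw [BitVec.toNat_ofNat, Nat.mod_eq_of_lt ((hrange i i.2).2.trans_lt hN), hcell i i.2]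
        rfl⟩
    obtain ⟨u', eu, rfl⟩ := e.rename hf hg s rfl
    refine ⟨t, u', eu, ht, fun i hi => ?_⟩
    have h1 := hs' ⟨i, hi⟩
    have h2 : u'.view.m .oout i = ((u'.pull oracleReg oracleBank).mem 1 (BitVec.ofNat w i)).toNat :=
      if_pos (hi.trans hNW)
    rw [h2, h1]
    have hw : 0 < w := by
      rcases Nat.eq_zero_or_pos w with rfl | h
      · simp at hNW
        omega
      · exact h
    have h3 : (∃ a ∈ Set.range fun i : Fin N => s.view.m .oin i, ∃ b ∈ Set.range fun i : Fin N =>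
        s.view.m .oin i, a + b = s.view.m .oin i) ↔
        ∃ a < N, ∃ b < N, s.view.m .oin a + s.view.m .oin b = s.view.m .oin i := by
      constructor
      · rintro ⟨_, ⟨a, rfl⟩, _, ⟨b, rfl⟩, h⟩
        exact ⟨a, a.2, b, b.2, h⟩
      · rintro ⟨a, ha, b, hb, h⟩
        exact ⟨_, ⟨⟨a, ha⟩, rfl⟩, _, ⟨⟨b, hb⟩, rfl⟩, h⟩
    rw [← h3]
    split_ifs with h4
    · exact iff_of_true (by simp [hw.ne']) h4
    · exact iff_of_false (by simp) h4

theorem exists_pow_le_lt_succ_pow (n : ℕ) {K : ℕ} (hK : 0 < K) :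
    ∃ g ≤ n, g ^ K ≤ n ∧ n < (g + 1) ^ K := by
  refine ⟨Nat.findGreatest (fun g => g ^ K ≤ n) n, Nat.findGreatest_le n,
    Nat.findGreatest_spec (P := fun g => g ^ K ≤ n) (Nat.zero_le n) (by simp [hK.ne']), ?_⟩
  by_contra! h
  have h1 := (Nat.le_self_pow hK.ne' _).trans h
  exact Nat.findGreatest_is_greatest (Nat.lt_succ_self _) h1 h

/-- With `g ≤ n ^ (1 / K)` the first term has exponent `(2 K - 1) / K = 2 - 1 / K`. The oracle calls
have exponent `5 / K + 2 - ε`, which is no larger because `6 / K ≤ ε`. -/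
theorem reduction_time_le {K g n M T : ℕ} {C D ε : ℝ} (hK : 0 < K) (hε : 6 / ε ≤ K) (hε0 : 0 < ε)
    (hn : 1 ≤ n) (hg : g ^ K ≤ n) (hC : 0 ≤ C) (hD : 0 ≤ D)
    (hT : (T : ℝ) ≤ D * ((M * n : ℕ) : ℝ) ^ (2 - ε)) :
    C * g ^ (2 * K - 1) + g ^ 5 * T ≤ (C + D * (M : ℝ) ^ (2 - ε)) * (n : ℝ) ^ (2 - 1 / (K : ℝ)) :=
        by
  have hK0 : (0 : ℝ) < K := by exact_mod_cast hK
  have hn1 : (1 : ℝ) ≤ n := by exact_mod_cast hn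
  have hpow (m : ℕ) : (g : ℝ) ^ m ≤ (n : ℝ) ^ ((m : ℝ) / K) := by
    have h1 : (g : ℝ) ^ m = ((g : ℝ) ^ K) ^ ((m : ℝ) / K) := by
      rw [← Real.rpow_natCast, ← Real.rpow_natCast, ← Real.rpow_mul (by positivity)]
      congr 1
      field_simp
    rw [h1]
    exact Real.rpow_le_rpow (by positivity) (by exact_mod_cast hg) (by positivity)
  have h1 : (g : ℝ) ^ (2 * K - 1) ≤ (n : ℝ) ^ (2 - 1 / (K : ℝ)) := by
    refine (hpow _).trans_eq ?_
    congr 1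
    rw [Nat.cast_sub (by omega)]
    push_cast
    field_simp
  have h2 : (n : ℝ) ^ ((5 : ℕ) / (K : ℝ)) * (n : ℝ) ^ (2 - ε) ≤ (n : ℝ) ^ (2 - 1 / (K : ℝ)) := by
    rw [← Real.rpow_add (by linarith)]
    refine Real.rpow_le_rpow_of_exponent_le hn1 ?_
    have h3 : 6 / (K : ℝ) ≤ ε := by
      rw [div_le_iff₀ hK0]
      rwa [div_le_iff₀ hε0, mul_comm] at hε
    have h4 : 6 / (K : ℝ) = (5 : ℕ) / (K : ℝ) + 1 / K := by
      push_cast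
      ring
    linarith
  calc C * (g : ℝ) ^ (2 * K - 1) + g ^ 5 * T
      ≤ C * (n : ℝ) ^ (2 - 1 / (K : ℝ)) +
        (n : ℝ) ^ ((5 : ℕ) / (K : ℝ)) * (D * ((M * n : ℕ) : ℝ) ^ (2 - ε)) := by
        gcongr
        exact hpow 5
    _ = C * (n : ℝ) ^ (2 - 1 / (K : ℝ)) + D * (M : ℝ) ^ (2 - ε) *
          ((n : ℝ) ^ ((5 : ℕ) / (K : ℝ)) * (n : ℝ) ^ (2 - ε)) := by
        rw [Nat.cast_mul, Real.mul_rpow (by positivity) (by positivity)]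
        ring
    _ ≤ C * (n : ℝ) ^ (2 - 1 / (K : ℝ)) + D * (M : ℝ) ^ (2 - ε) * (n : ℝ) ^ (2 - 1 / (K : ℝ)) := by
        gcongr
    _ = _ := by ring

theorem threeSum_of_flag {w n : ℕ} [NeZero w] {x : Fin n → ℕ} {A : ℕ → ℕ} {s : State w}
    (hA : ∀ i : Fin n, A i = x i) (h : Flag (Solvable n A) 0 (s.view.r .n)) :
    ThreeSum x s := by
  have hiff : (∃ a ∈ Set.range x, ∃ b ∈ Set.range x, ∃ c ∈ Set.range x, a + b = c) ↔
      Solvable n A := by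
    constructor
    · rintro ⟨_, ⟨j, rfl⟩, _, ⟨k, rfl⟩, _, ⟨i, rfl⟩, h⟩
      exact ⟨i, i.2, j, j.2, k, k.2, by rwa [hA, hA, hA]⟩
    · rintro ⟨i, hi, j, hj, k, hk, h⟩
      refine ⟨_, ⟨⟨j, hj⟩, rfl⟩, _, ⟨⟨k, hk⟩, rfl⟩, _, ⟨⟨i, hi⟩, rfl⟩, ?_⟩
      rw [← hA, ← hA, ← hA]
      exact h
  apply BitVec.eq_of_toNat_eq
  change s.view.r .n = _
  rw [hiff]
  split_ifs with h1
  · rw [h.1 h1, BitVec.toNat_ofNat, Nat.mod_eq_of_lt (Nat.one_lt_two_pow (NeZero.ne w))]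
  · rw [h.2 h1]
    simp

end WordRAM

open WordRAM

theorem lemma4p4 (h : DeterministicThreeSumHypothesis) (ε : ℝ) (hε : 0 < ε) :
    ¬ SolvableInTime AllNumbersThreeSum (fun n => n ^ 2) (fun n => (n : ℝ) ^ (2 - ε)) := by
  rintro ⟨p, kp, Cp, hp⟩
  obtain ⟨K, hKε, hK⟩ : ∃ K : ℕ, 6 / ε ≤ K ∧ 6 ≤ K := by
    obtain ⟨K, hK⟩ := exists_nat_ge (6 / ε)
    exact ⟨max K 6, hK.trans (by exact_mod_cast le_max_left _ _), le_max_right _ _⟩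
  have hK0 : (0 : ℝ) < K := by exact_mod_cast (by omega : 0 < K)
  -- The hypothesis fixes the exponent `c` of the universe only after `K` is known; the constants
  -- `Θ`, `k` and `C` below may depend on both.
  obtain ⟨c, hc⟩ := h (1 / K) (by positivity)
  obtain ⟨Θ, hΘ⟩ := exists_le_mul_pow K c (by omega)
  set r := 2 * K - 3 with hr
  set e := 3 * K + r with he
  set M := 2 ^ r + 5 * 8 ^ r + 4 with hM
  obtain ⟨C, hC⟩ := exists_reductionTime_le e M Θ hK hr
  -- One summand `a + b` for each bound `a * (n + 1) ^ b` that must be below `2 ^ w`, and one for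
  -- the word length that the All-Numbers program demands on lists of length `M * n`.
  set k := (16 ^ e + 0 + (2 * e)) + (1 + K) + (M ^ 2 + 2) + (2 + c) + (Θ + (K + 4)) + kp * (M + 1)
    with hk
  refine hc ⟨threeSumProg K r e M Θ (p.rename oracleReg oracleBank), k,
    C + |Cp| * (M : ℝ) ^ (2 - ε), fun n hn x hx w hw s hs => ?_⟩
  have h2r : 0 < 2 ^ r := by positivity
  have h8r : 0 < 8 ^ r := by positivity
  have h16e : 0 < 16 ^ e := by positivity
  obtain ⟨g, hgn, hg1, hg2⟩ := exists_pow_le_lt_succ_pow n (by omega : 0 < K)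
  have hg0 : 1 ≤ g := by
    rcases Nat.eq_zero_or_pos g with rfl | h
    · simp at hg2
      omega
    · exact h
  have word {a b : ℕ} (hab : a + b ≤ k) : a * (n + 1) ^ b < 2 ^ w :=
    mul_pow_lt_two_pow ((Nat.mul_le_mul_right _ hab).trans hw)
  have hw1 : (4 * g + 4) ^ e * (4 * g + 4) ^ e < 2 ^ w := by
    calc _ = 16 ^ e * (g + 1) ^ (2 * e) := by
          rw [← mul_pow, pow_mul, ← mul_pow]
          congr 1
          ring
      _ ≤ 16 ^ e * (n + 1) ^ (2 * e) := by gcongr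
      _ < _ := word (by omega)
  have hw2 : n ^ K < 2 ^ w := by
    calc _ ≤ 1 * (n + 1) ^ K := by
          rw [one_mul]
          gcongr
          omega
      _ < _ := word (by omega)
  have hw3 : (M * n) ^ 2 < 2 ^ w := by
    calc _ ≤ M ^ 2 * (n + 1) ^ 2 := by
          rw [mul_pow]
          gcongr
          omega
      _ < _ := word (by omega)
  have hw4 : 2 * n ^ c < 2 ^ w := by
    calc _ ≤ 2 * (n + 1) ^ c := by
          gcongr
          omega
      _ < _ := word (by omega)
  have hw5 : Θ * g ^ (K + 4) < 2 ^ w := by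
    calc _ ≤ Θ * (n + 1) ^ (K + 4) := by
          gcongr
          omega
      _ < _ := word (by omega)
  have hwp : kp * (Nat.log 2 (M * n) + 1) ≤ w := by
    calc _ ≤ kp * ((M + 1) * (Nat.log 2 n + 1)) :=
          Nat.mul_le_mul_left _ (log_mul_add_one_le (by omega) hn)
      _ = kp * (M + 1) * (Nat.log 2 n + 1) := by ring
      _ ≤ k * (Nat.log 2 n + 1) := Nat.mul_le_mul_right _ (by omega)
      _ ≤ w := hw
  have : NeZero w := ⟨by
    rintro rfl
    have := word (a := 1) (b := 0) (by omega)
    simp at this⟩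
  have hxc (i : Fin n) : x i ≤ n ^ c := (hx.2 ⟨i, rfl⟩).2
  -- The absolute value makes the real bound nonnegative, so that it can be rounded down to a number
  -- of steps.
  set T := ⌊|Cp| * ((M * n : ℕ) : ℝ) ^ (2 - ε)⌋₊ with hT
  have horacle : SumOracle w (p.rename oracleReg oracleBank) (M * n) T := by
    refine sumOracle_rename hw3 fun y hy s hs => ?_
    obtain ⟨t, s', h1, h2, h3⟩ := hp (M * n) (Nat.mul_pos (by omega) hn) y hy w hwp s hs
    refine ⟨t, s', h1, Nat.le_floor (h2.trans ?_), h3⟩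
    gcongr
    exact le_abs_self Cp
  set A : ℕ → ℕ := fun i => if h : i < n then x ⟨i, h⟩ else 0 with hA
  have hnW : n < 2 ^ w := (Nat.le_self_pow (by omega) n).trans_lt hw2
  obtain ⟨t, s', h1, h2, h3⟩ := tr_threeSumProg (w := w) (σ := s.view) (n := n) (A := A) hK hr he
    (by
      change (s.reg 0).toNat = n
      rw [hs.1, BitVec.toNat_ofNat, Nat.mod_eq_of_lt hnW])
    (fun i hi => by
      have h1 : s.view.m .inp i = (s.mem 0 (BitVec.ofNat w i)).toNat := if_pos (hi.trans hnW)
      have h2 := hxc ⟨i, hi⟩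
      rw [h1, hs.2 ⟨i, hi⟩, BitVec.toNat_ofNat, Nat.mod_eq_of_lt (by omega)]
      simp [hA, hi])
    hn (fun i hi => by simpa [hA, hi] using hxc ⟨i, hi⟩) hg1 hg2 hΘ (by omega) horacle hw1 hw2 hw3
    hw4 hw5 s rfl
  refine ⟨t, s', h1, ?_, threeSum_of_flag (fun i => by simp [hA]) h3⟩
  have h4 : (t : ℝ) ≤ (C : ℝ) * g ^ (2 * K - 1) + g ^ 5 * T := by
    exact_mod_cast h2.trans (hC g n T hg0 hn hg2)
  exact h4.trans (reduction_time_le (by omega) hKε hε hn hg1 (by positivity) (abs_nonneg _)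
    (Nat.floor_le (by positivity)))
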